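/- \textbf{Setting.} Let $(\Omega,\mathcal F,P)$ be a probability space, $H\in(0,1)$, $B^H$ a fractional Brownian motion with Hurst parameter $H$ (a centred Gaussian process with $\mathbb E[B^H_sB^H_t]=\frac12(s^{2H}+t^{2H}-|t-s|^{2H})$), $\xi_n=\xi^H_n=B^H_{n+1}-B^H_n$ for $n\ge0$, $\mathcal F_0\subset\mathcal F$ a $\sigma$-algebra independent of $(\xi_n)_{n\ge 0}$, and $\mathcal F_n=\mathcal F_0\vee\sigma(\xi_0,\dots,\xi_{n-1})$. Let $\beta(n,k)$ $(k\le n)$ be the lower triangular Cholesky factor, with positive diagonal, of the covariance of $(\xi_n)$, let $\alpha$ be its (lower triangular) inverse, and put $\eta_n=\sum_{k=0}^n\alpha(n,k)\xi_k$; so $(\eta_n)$ is i.i.d. $N(0,1)$ and $\xi_n=\sum_{k=0}^n\beta(n,k)\eta_k$. Put $\gamma(n,k)=\sum_{l=0}^{n-1}\beta(n,l)\alpha(l,k)$ with $\alpha(l,k)=0$ for $k>l$; so $\mathbb E[\xi_n|\mathcal F_n]=\sum_{k=0}^{n-1}\gamma(n,k)\xi_k$. Let $\lambda>0$, $\gamma>1$,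 $\theta>1$, $\delta_i=1-(i+2)^{-\theta}$, $|\vec\delta|=\lim_n\delta_1\cdots\delta_n$, and $a,b\in\mathbb R$ with $a|\vec\delta|^2\ge b\ge1$. Let $L^{\beta}$ (resp. $\hat L^{\beta}$) be the set of real $(\mathcal F_n)$-adapted processes with $\sum_{n\ge0}e^{-\lambda n^\gamma}\mathbb E|X_n|^{\beta\delta_1\cdots\delta_n}<\infty$ (resp. $\sum_{n\ge0}e^{-\lambda n^\gamma}\mathbb E|X_n|^{\beta\delta_1^{-1}\cdots\delta_n^{-1}}<\infty$). A \emph{solution} of the infinite-horizon backward equation with generator $g(n,y,z)$, $$e^{-\lambda n^\gamma}(Y_n+Z_n\eta_n)=e^{-\lambda(n+1)^\gamma}\bigl(Y_{n+1}+g(n+1,Y_{n+1},Z_{n+1})\bigr)=:\Gamma_{n+1},\qquad \lim_{N\to\infty}\mathbb E\bigl[e^{-\lambda N^\gamma}|Y_N|^{2b\delta_1^{-1}\cdots\delta_N^{-1}}\bigr]=0, \tag{1}$$ is a pair $(Y,Z)\in\hat L^{2b}\times\hat L^{2b}$ that satisfies the terminal condition and, for all $n$, a.s. $e^{-\lambda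 n^\gamma}Y_n=\mathbb E[\Gamma_{n+1}|\mathcal F_n]$ and $e^{-\lambda n^\gamma}Z_n=\mathbb E[\eta_n\Gamma_{n+1}|\mathcal F_n]$ (that is, (1) holds modulo martingale differences conditionally orthogonal to $\eta_n$). \textbf{Control problem} (scalar case). Let $x$ be $\mathcal F_0$-measurable with $\mathbb E|x|^{2a}<\infty$ and $\mathbf U\subset\mathbb R$ closed and convex. The admissible controls $\mathbb U$ are the processes $u\in L^{2a}$ with values in $\mathbf U$. For $u\in\mathbb U$ let $X_0=x$, $X_{n+1}=X_n+b(n,X_n,u_n)+\sigma(n,X_n,u_n)\xi_n$, let $(Y,Z)$ solve (1) with generator $g(n,y,z)=f(n,X_n,y,z,u_n)$, and let $J(u)=\mathbb E[Y_0]$ (which is $Y_0$ if $\mathcal F_0$ is trivial). The random functions $b(n,x,u)$, $\sigma(n,x,u)$ are differentiable in $(x,u)$, $f(n,x,y,z,u)$ is differentiable in $(x,y,z,u)$, and: (H3.1) $b(\cdot,x,u),\sigma(\cdot,x,u)\in L^{2a}$ and $f(\cdot,x,y,z,u)\in\hat L^{2b}$ for all $x,y,z,u\in\mathbb R$. (H3.2)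 $b,\sigma$ are Lipschitz in $(x,u)$ and $f$ is Lipschitz in $(x,y,z,u)$, with a constant that does not depend on $(n,\omega)$. (H3.3) There is a random function $f_1(n,x,y,u)$ with $f_1(\cdot,x,y,u)\in\hat L^{2b}$ and $\lim_{N\to\infty}\mathbb E\bigl[e^{-\lambda N^\gamma}|f(N,x,y,z,u)-f_1(N,x,y,u)|^{2b\delta_1^{-1}\cdots\delta_N^{-1}}\bigr]=0$ for all $x,y,z,u$. \textbf{Theorem (stochastic maximum principle).} Assume (H3.1)--(H3.3). Let $u^*\in\mathbb U$ be optimal, i.e. $J(u^*)\le J(u)$ for all $u\in\mathbb U$, with corresponding $(X^*,Y^*,Z^*)$. Write $b_x^*(n),b_u^*(n),\sigma_x^*(n),\sigma_u^*(n)$ for the partial derivatives at $(X_n^*,u_n^*)$ and $f^*_x(n),f_y^*(n),f_z^*(n),f_u^*(n)$ for those at $(X_n^*,Y_n^*,Z_n^*,u_n^*)$. Let $k_0=0$, $k_1=-1$, $k_{n+1}=k_n+f_y^*(n)k_n+f_z^*(n)k_n\eta_n$ for $n\ge1$. Then the adjoint equation $$e^{-\lambda n^\gamma}(p_n+q_n\eta_n)=e^{-\lambda(n+1)^\gamma}\Bigl(p_{n+1}+b_x^*(n+1)p_{n+1}+\beta(n+1,n+1)\sigma_x^*(n+1)q_{n+1}-f_x^*(n+1)k_{n+1}+\sigma_x^*(n+1)p_{n+1}\mathbb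 E[\xi_{n+1}|\mathcal F_{n+1}]\Bigr),$$ $$\lim_{N\to\infty}\mathbb E\bigl[e^{-\lambda N^\gamma}|p_N|^{2b\delta_1^{-1}\cdots\delta_N^{-1}}\bigr]=0,$$ has a solution $(p,q)$, unique up to a.s. equality, and for every $u\in\mathbb U$, a.s. for all $n\ge0$, $$\Bigl[b_u^*(n)p_n+\sigma_u^*(n)p_n\sum_{k=0}^{n-1}\gamma(n,k)\xi_k+\beta(n,n)\sigma_u^*(n)q_n-f_u^*(n)k_n\Bigr](u_n-u_n^*)\ge0.$$ Equivalently, with the Hamiltonian $\mathcal H(n,x,y,z,u,p,q,k)=b(n,x,u)p+\sigma(n,x,u)p\,\mathbb E[\xi_n|\mathcal F_n]+\beta(n,n)\sigma(n,x,u)q-f(n,x,y,z,u)k$, one has $\mathcal H_u(n,X^*_n,Y^*_n,Z^*_n,u^*_n,p_n,q_n,k_n)(u_n-u_n^*)\ge0$ a.s. for all $n$. -/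

import Mathlib

open MeasureTheory ProbabilityTheory Filter Topology
open scoped NNReal ENNReal

noncomputable section

namespace FracControl

/-! ### Fractional noise and its innovations -/

/-- Fractional Brownian motion with Hurst parameter `H` (no path regularity is required, only the
finite dimensional laws matter here). -/
structure IsFractionalBrownianMotion {Ω : Type*} [MeasurableSpace Ω] (H : ℝ) (B : ℝ≥0 → Ω → ℝ)
    (μ : Measure Ω) : Prop where
  measurable : ∀ t, Measurable (B t)
  gaussian : IsGaussianProcess B μ
  centered : ∀ t, ∫ ω, B t ω ∂μ = 0
  covariance_eq : ∀ s t : ℝ≥0, covariance (B s) (B t) μ =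
    ((s : ℝ) ^ (2 * H) + (t : ℝ) ^ (2 * H) - |(s : ℝ) - (t : ℝ)| ^ (2 * H)) / 2

/-- The fractional noise `ξ n = B (n + 1) - B n`. -/
def fracNoise {Ω : Type*} (B : ℝ≥0 → Ω → ℝ) (n : ℕ) (ω : Ω) : ℝ :=
  B ((n : ℝ≥0) + 1) ω - B (n : ℝ≥0) ω

/-- The covariance `E[ξ m * ξ n]` of the fractional noise. -/
def noiseCov (H : ℝ) (m n : ℕ) : ℝ :=
  (|(m : ℝ) - n + 1| ^ (2 * H) + |(m : ℝ) - n - 1| ^ (2 * H) - 2 * |(m : ℝ) - n| ^ (2 * H)) / 2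

/-- The lower triangular coefficients with positive diagonal (Cholesky factor of `noiseCov H`)
that express the fractional noise through a white noise: `ξ n = ∑ k ≤ n, β(n,k) η k`. -/
def noiseBeta (H : ℝ) (n k : ℕ) : ℝ :=
  if _h : k < n then
    (noiseCov H n k - ∑ j : Fin k, noiseBeta H n j * noiseBeta H k j) / noiseBeta H k k
  else if _h : k = n then
    Real.sqrt (noiseCov H n n - ∑ j : Fin n, noiseBeta H n j * noiseBeta H n j)
  else 0
termination_by (n, k)
decreasing_by
  · exact Prod.Lex.right _ (Fin.is_lt _)
  · exact Prod.Lex.left _ _ _h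
  · exact Prod.Lex.left _ _ _h
  · subst _h
    exact Prod.Lex.right _ (Fin.is_lt _)

/-- The inverse (lower triangular) matrix of `noiseBeta H`: `η n = ∑ k ≤ n, α(n,k) ξ k`. -/
def noiseAlpha (H : ℝ) (n k : ℕ) : ℝ :=
  if k < n then
    -(∑ l : Fin n, noiseBeta H n l * noiseAlpha H l k) / noiseBeta H n n
  else if k = n then 1 / noiseBeta H n n
  else 0
termination_by n
decreasing_by exact Fin.is_lt _

/-- `γ(n,k) = ∑_{l=0}^{n-1} β(n,l) α(l,k)`, the coefficients of the prediction
`E[ξ n | F n] = ∑ k < n, γ(n,k) ξ k`. -/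
def noiseGamma (H : ℝ) (n k : ℕ) : ℝ :=
  ∑ l ∈ Finset.range n, noiseBeta H n l * noiseAlpha H l k

/-- The white noise `η n = ∑ k ≤ n, α(n,k) ξ k`. -/
def whiteNoise {Ω : Type*} (H : ℝ) (ξ : ℕ → Ω → ℝ) (n : ℕ) (ω : Ω) : ℝ :=
  ∑ k ∈ Finset.range (n + 1), noiseAlpha H n k * ξ k ω

/-- `F n = F₀ ∨ σ(ξ 0, …, ξ (n-1))`. -/
@[reducible] def noiseFiltration {Ω : Type*} (F₀ : MeasurableSpace Ω) (ξ : ℕ → Ω → ℝ) (n : ℕ) :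
    MeasurableSpace Ω :=
  F₀ ⊔ ⨆ k : Fin n, MeasurableSpace.comap (ξ k) inferInstance

/-! ### Weighted spaces of adapted processes -/

/-- `δ_i = 1 - (i+2)^{-θ}`. -/
def deltaSeq (θ : ℝ) (i : ℕ) : ℝ := 1 - ((i : ℝ) + 2) ^ (-θ)

/-- `δ_1 ⋯ δ_n`. -/
def deltaProd (θ : ℝ) (n : ℕ) : ℝ := ∏ i ∈ Finset.Icc 1 n, deltaSeq θ i

/-- `|δ| = lim_n δ_1 ⋯ δ_n`. -/
def deltaLim (θ : ℝ) : ℝ := limUnder atTop (deltaProd θ)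

/-- The discount factor `exp(-λ n^γ)`. -/
def discount (lam gam : ℝ) (n : ℕ) : ℝ := Real.exp (-lam * (n : ℝ) ^ gam)

/-- `exp(-λ n^γ) E|X_n|^e`, as an extended nonnegative number. -/
def weightedMoment {Ω : Type*} [MeasurableSpace Ω] (μ : Measure Ω) (lam gam : ℝ) (n : ℕ) (e : ℝ)
    (X : Ω → ℝ) : ℝ≥0∞ :=
  ENNReal.ofReal (discount lam gam n) * ∫⁻ ω, ‖X ω‖ₑ ^ e ∂μ

/-- The space `L^{β,δ,λ,γ}_F(0,∞)`: adapted processes with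
`∑ exp(-λ n^γ) E|X_n|^{β δ_1 ⋯ δ_n} < ∞`. -/
structure MemL {Ω : Type*} [MeasurableSpace Ω] (μ : Measure Ω) (F : ℕ → MeasurableSpace Ω)
    (β θ lam gam : ℝ) (X : ℕ → Ω → ℝ) : Prop where
  adapted : ∀ n, Measurable[F n] (X n)
  finite : ∑' n, weightedMoment μ lam gam n (β * deltaProd θ n) (X n) < ∞

/-- The space `L̂^{β,δ,λ,γ}_F(0,∞)`: adapted processes with
`∑ exp(-λ n^γ) E|X_n|^{β δ_1⁻¹ ⋯ δ_n⁻¹} < ∞`. -/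
structure MemLHat {Ω : Type*} [MeasurableSpace Ω] (μ : Measure Ω) (F : ℕ → MeasurableSpace Ω)
    (β θ lam gam : ℝ) (X : ℕ → Ω → ℝ) : Prop where
  adapted : ∀ n, Measurable[F n] (X n)
  finite : ∑' n, weightedMoment μ lam gam n (β / deltaProd θ n) (X n) < ∞

/-! ### Infinite horizon backward stochastic difference equations -/

/-- The discounted driver term
`exp(-λ (n+1)^γ) (Y_{n+1} + g(n+1, Y_{n+1}, Z_{n+1}))`. -/
def backwardTerm {Ω : Type*} (lam gam : ℝ) (g : ℕ → Ω → ℝ → ℝ → ℝ) (Y Z : ℕ → Ω → ℝ) (n : ℕ)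
    (ω : Ω) : ℝ :=
  discount lam gam (n + 1) * (Y (n + 1) ω + g (n + 1) ω (Y (n + 1) ω) (Z (n + 1) ω))

/-- Solution `(Y, Z)` in `L̂^{2b} × L̂^{2b}` of the infinite horizon equation
`exp(-λ n^γ) (Y_n + Z_n η_n) = exp(-λ (n+1)^γ) (Y_{n+1} + g(n+1, Y_{n+1}, Z_{n+1}))`,
`lim_N E[exp(-λ N^γ) |Y_N|^{2b δ_1⁻¹ ⋯ δ_N⁻¹}] = 0`.
`Y_n` and `Z_n` are the conditional expectations given `F n` of the right-hand side and of its
product with `η_n`; that is, the equation is understood modulo martingale differences that are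
conditionally orthogonal to `η_n` (with a Gaussian `η_n` the right-hand side is in general not
affine in `η_n`, so that the two sides cannot be equal outright). -/
structure IsBackwardSolution {Ω : Type*} [MeasurableSpace Ω] (μ : Measure Ω)
    (F : ℕ → MeasurableSpace Ω) (η : ℕ → Ω → ℝ) (b θ lam gam : ℝ) (g : ℕ → Ω → ℝ → ℝ → ℝ)
    (Y Z : ℕ → Ω → ℝ) : Prop where
  memY : MemLHat μ F (2 * b) θ lam gam Y
  memZ : MemLHat μ F (2 * b) θ lam gam Z
  eqY : ∀ n, (fun ω => discount lam gam n * Y n ω) =ᵐ[μ] μ[backwardTerm lam gam g Y Z n | F n]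
  eqZ : ∀ n, (fun ω => discount lam gam n * Z n ω) =ᵐ[μ]
    μ[fun ω => η n ω * backwardTerm lam gam g Y Z n ω | F n]
  terminal : Tendsto (fun N => weightedMoment μ lam gam N (2 * b / deltaProd θ N) (Y N))
    atTop (𝓝 0)

/-! ### The control problem -/

/-- The data of the control problem (the conditions on them are stated below). -/
structure ControlSystem (Ω : Type*) where
  /-- Hurst parameter -/
  H : ℝ
  /-- fractional Brownian motion -/
  B : ℝ≥0 → Ω → ℝ
  /-- initial σ-algebra -/
  F₀ : MeasurableSpace Ω
  /-- discount rate `λ` -/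
  lam : ℝ
  /-- discount exponent `γ` -/
  gam : ℝ
  /-- parameter `θ` of the sequence `δ` -/
  theta : ℝ
  /-- integrability exponent `a` of the forward equation -/
  a : ℝ
  /-- integrability exponent `b` of the backward equation -/
  b : ℝ
  /-- control domain -/
  U : Set ℝ
  /-- initial state -/
  x₀ : Ω → ℝ
  /-- drift coefficient `b(n,x,u)` -/
  drift : ℕ → Ω → ℝ → ℝ → ℝ
  /-- diffusion coefficient `σ(n,x,u)` -/
  diff : ℕ → Ω → ℝ → ℝ → ℝ
  /-- generator `f(n,x,y,z,u)` of the cost equation -/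
  gen : ℕ → Ω → ℝ → ℝ → ℝ → ℝ → ℝ

namespace ControlSystem

variable {Ω : Type*} (S : ControlSystem Ω)

/-- The noise `ξ^H`. -/
def xi : ℕ → Ω → ℝ := fracNoise S.B

/-- The white noise `η` generated by `ξ^H`. -/
def eta : ℕ → Ω → ℝ := whiteNoise S.H S.xi

/-- The filtration. -/
@[reducible] def filt : ℕ → MeasurableSpace Ω := noiseFiltration S.F₀ S.xi

/-- `X_{n+1} = X_n + b(n,X_n,u_n) + σ(n,X_n,u_n) ξ_n`, `X_0 = x`. -/
def state (u : ℕ → Ω → ℝ) : ℕ → Ω → ℝ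
  | 0 => S.x₀
  | n + 1 => fun ω => state u n ω + S.drift n ω (state u n ω) (u n ω)
      + S.diff n ω (state u n ω) (u n ω) * S.xi n ω

/-- Setting: `ξ^H` is fractional noise with `H ∈ (0,1)`, independent of `F₀`; the initial state is
in `L^{2a}(F₀)`; the control domain is closed and convex; the coefficients are differentiable. -/
structure Standing [MeasurableSpace Ω] (μ : Measure Ω) : Prop where
  hurst_pos : 0 < S.H
  hurst_lt_one : S.H < 1
  fbm : IsFractionalBrownianMotion S.H S.B μ
  F₀_le : S.F₀ ≤ ‹MeasurableSpace Ω›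
  indep : Indep S.F₀ (⨆ n : ℕ, MeasurableSpace.comap (S.xi n) inferInstance) μ
  x₀_measurable : Measurable[S.F₀] S.x₀
  x₀_moment : ∫⁻ ω, ‖S.x₀ ω‖ₑ ^ (2 * S.a) ∂μ < ∞
  U_closed : IsClosed S.U
  U_convex : Convex ℝ S.U
  drift_differentiable : ∀ n ω, Differentiable ℝ (fun v : ℝ × ℝ => S.drift n ω v.1 v.2)
  diff_differentiable : ∀ n ω, Differentiable ℝ (fun v : ℝ × ℝ => S.diff n ω v.1 v.2)
  gen_differentiable : ∀ n ω, Differentiable ℝ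
    (fun v : ℝ × ℝ × ℝ × ℝ => S.gen n ω v.1 v.2.1 v.2.2.1 v.2.2.2)

/-- Adaptedness and integrability of the coefficients, and the range of the parameters. -/
structure IntegrabilityCondition [MeasurableSpace Ω] (μ : Measure Ω) : Prop where
  lam_pos : 0 < S.lam
  one_lt_gam : 1 < S.gam
  one_lt_theta : 1 < S.theta
  one_le_b : 1 ≤ S.b
  b_le : S.b ≤ S.a * deltaLim S.theta ^ 2
  drift_mem : ∀ x u : ℝ, MemL μ S.filt (2 * S.a) S.theta S.lam S.gam (fun n ω => S.drift n ω x u)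
  diff_mem : ∀ x u : ℝ, MemL μ S.filt (2 * S.a) S.theta S.lam S.gam (fun n ω => S.diff n ω x u)
  gen_mem : ∀ x y z u : ℝ, MemLHat μ S.filt (2 * S.b) S.theta S.lam S.gam
    (fun n ω => S.gen n ω x y z u)

/-- Uniform Lipschitz continuity of the coefficients. -/
def LipschitzCondition : Prop :=
  ∃ L : ℝ, 0 < L ∧
    (∀ n ω x₁ x₂ u₁ u₂, |S.drift n ω x₁ u₁ - S.drift n ω x₂ u₂|
      + |S.diff n ω x₁ u₁ - S.diff n ω x₂ u₂| ≤ L * (|x₁ - x₂| + |u₁ - u₂|)) ∧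
    (∀ n ω x₁ x₂ y₁ y₂ z₁ z₂ u₁ u₂, |S.gen n ω x₁ y₁ z₁ u₁ - S.gen n ω x₂ y₂ z₂ u₂|
      ≤ L * (|x₁ - x₂| + |y₁ - y₂| + |z₁ - z₂| + |u₁ - u₂|))

/-- Asymptotic independence of `z`: there is `f₁(n,x,y,u)` with values in `L̂^{2b}` such that
`lim_N E[exp(-λ N^γ) |f(N,x,y,z,u) - f₁(N,x,y,u)|^{2b δ_1⁻¹ ⋯ δ_N⁻¹}] = 0`. -/
def AsymptoticCondition [MeasurableSpace Ω] (μ : Measure Ω) : Prop :=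
  ∃ f₁ : ℕ → Ω → ℝ → ℝ → ℝ → ℝ,
    (∀ x y u : ℝ, MemLHat μ S.filt (2 * S.b) S.theta S.lam S.gam (fun n ω => f₁ n ω x y u)) ∧
    (∀ x y z u : ℝ, Tendsto
      (fun N => weightedMoment μ S.lam S.gam N (2 * S.b / deltaProd S.theta N)
        (fun ω => S.gen N ω x y z u - f₁ N ω x y u)) atTop (𝓝 0))

/-- The set of admissible controls. -/
structure Admissible [MeasurableSpace Ω] (μ : Measure Ω) (u : ℕ → Ω → ℝ) : Prop where
  mem : MemL μ S.filt (2 * S.a) S.theta S.lam S.gam u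
  values : ∀ n ω, u n ω ∈ S.U

/-- `(Y, Z)` solves the cost equation, whose generator is `f(n, X_n, y, z, u_n)` with `X` the state
of the control `u`. -/
def IsCostSolution [MeasurableSpace Ω] (μ : Measure Ω) (u Y Z : ℕ → Ω → ℝ) : Prop :=
  IsBackwardSolution μ S.filt S.eta S.b S.theta S.lam S.gam
    (fun n ω y z => S.gen n ω (S.state u n ω) y z (u n ω)) Y Z

/-- `J(u) = c`. The value is `E[Y_0]`, which is `Y_0` itself if `F₀` is trivial. -/
def IsCost [MeasurableSpace Ω] (μ : Measure Ω) (u : ℕ → Ω → ℝ) (c : ℝ) : Prop :=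
  ∃ Y Z : ℕ → Ω → ℝ, S.IsCostSolution μ u Y Z ∧ c = ∫ ω, Y 0 ω ∂μ

/-- `u` is admissible and `J(u) ≤ J(v)` for every admissible `v`. -/
def IsOptimal [MeasurableSpace Ω] (μ : Measure Ω) (u : ℕ → Ω → ℝ) : Prop :=
  S.Admissible μ u ∧ ∀ v, S.Admissible μ v → ∀ c d, S.IsCost μ u c → S.IsCost μ v d → c ≤ d

/-! ### Derivatives of the coefficients along a trajectory -/

/-- `b_x(n, X_n, u_n)`. -/
def driftX (u : ℕ → Ω → ℝ) (n : ℕ) (ω : Ω) : ℝ :=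
  deriv (fun x => S.drift n ω x (u n ω)) (S.state u n ω)

/-- `b_u(n, X_n, u_n)`. -/
def driftU (u : ℕ → Ω → ℝ) (n : ℕ) (ω : Ω) : ℝ :=
  deriv (fun r => S.drift n ω (S.state u n ω) r) (u n ω)

/-- `σ_x(n, X_n, u_n)`. -/
def diffX (u : ℕ → Ω → ℝ) (n : ℕ) (ω : Ω) : ℝ :=
  deriv (fun x => S.diff n ω x (u n ω)) (S.state u n ω)

/-- `σ_u(n, X_n, u_n)`. -/
def diffU (u : ℕ → Ω → ℝ) (n : ℕ) (ω : Ω) : ℝ :=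
  deriv (fun r => S.diff n ω (S.state u n ω) r) (u n ω)

/-- `f_x(n, X_n, Y_n, Z_n, u_n)`. -/
def genX (u Y Z : ℕ → Ω → ℝ) (n : ℕ) (ω : Ω) : ℝ :=
  deriv (fun x => S.gen n ω x (Y n ω) (Z n ω) (u n ω)) (S.state u n ω)

/-- `f_y(n, X_n, Y_n, Z_n, u_n)`. -/
def genY (u Y Z : ℕ → Ω → ℝ) (n : ℕ) (ω : Ω) : ℝ :=
  deriv (fun y => S.gen n ω (S.state u n ω) y (Z n ω) (u n ω)) (Y n ω)

/-- `f_z(n, X_n, Y_n, Z_n, u_n)`. -/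
def genZ (u Y Z : ℕ → Ω → ℝ) (n : ℕ) (ω : Ω) : ℝ :=
  deriv (fun z => S.gen n ω (S.state u n ω) (Y n ω) z (u n ω)) (Z n ω)

/-- `f_u(n, X_n, Y_n, Z_n, u_n)`. -/
def genU (u Y Z : ℕ → Ω → ℝ) (n : ℕ) (ω : Ω) : ℝ :=
  deriv (fun r => S.gen n ω (S.state u n ω) (Y n ω) (Z n ω) r) (u n ω)

/-! ### Adjoint processes and Hamiltonian -/

/-- `k_0 = 0`, `k_1 = -1`, `k_{n+1} = k_n + f_y(n) k_n + f_z(n) k_n η_n` for `n ≥ 1`. -/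
def adjK (u Y Z : ℕ → Ω → ℝ) : ℕ → Ω → ℝ
  | 0 => fun _ => 0
  | 1 => fun _ => -1
  | n + 2 => fun ω => adjK u Y Z (n + 1) ω
      + S.genY u Y Z (n + 1) ω * adjK u Y Z (n + 1) ω
      + S.genZ u Y Z (n + 1) ω * adjK u Y Z (n + 1) ω * S.eta (n + 1) ω

/-- `(p, q)` solves the adjoint equation, whose generator is
`b_x(n) p + β(n,n) σ_x(n) q - f_x(n) k_n + σ_x(n) p E[ξ_n | F n]`. -/
def IsAdjointSolution [MeasurableSpace Ω] (μ : Measure Ω) (u Y Z p q : ℕ → Ω → ℝ) : Prop :=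
  IsBackwardSolution μ S.filt S.eta S.b S.theta S.lam S.gam
    (fun n ω r s => S.driftX u n ω * r + noiseBeta S.H n n * S.diffX u n ω * s
      - S.genX u Y Z n ω * S.adjK u Y Z n ω
      + S.diffX u n ω * r * (μ[S.xi n | S.filt n]) ω) p q

/-- The Hamiltonian
`b(n,x,u) p + σ(n,x,u) p E[ξ_n | F n] + β(n,n) σ(n,x,u) q - f(n,x,y,z,u) k`. -/
def hamiltonian [MeasurableSpace Ω] (μ : Measure Ω) (n : ℕ) (ω : Ω) (x y z u p q k : ℝ) : ℝ :=
  S.drift n ω x u * p + S.diff n ω x u * p * (μ[S.xi n | S.filt n]) ω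
    + noiseBeta S.H n n * S.diff n ω x u * q - S.gen n ω x y z u * k

end ControlSystem

end FracControl

end

open MeasureTheory ProbabilityTheory Filter Topology
open scoped NNReal ENNReal

set_option linter.unusedSectionVars false

noncomputable section

namespace FracControl

/-! ### The discount factor -/

section Discount

variable {lam gam : ℝ}

lemma discount_pos (lam gam : ℝ) (n : ℕ) : 0 < discount lam gam n := Real.exp_pos _

lemma discount_le_one (hlam : 0 ≤ lam) (gam : ℝ) (n : ℕ) : discount lam gam n ≤ 1 := by
  have : 0 ≤ lam * (n : ℝ) ^ gam := by positivity
  exact Real.exp_le_one_iff.2 (by linarith)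

lemma discount_antitone (hlam : 0 ≤ lam) (hgam : 0 ≤ gam) : Antitone (discount lam gam) := by
  intro m n h
  refine Real.exp_le_exp.2 ?_
  have : (m : ℝ) ^ gam ≤ (n : ℝ) ^ gam := by gcongr
  nlinarith

lemma discount_mul (s lam gam : ℝ) (n : ℕ) :
    discount (s * lam) gam n = discount lam gam n ^ s := by
  rw [discount, discount, ← Real.exp_mul]
  congr 1
  ring

lemma discount_add (s t gam : ℝ) (n : ℕ) :
    discount (s + t) gam n = discount s gam n * discount t gam n := by
  rw [discount, discount, discount, ← Real.exp_add]
  congr 1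
  ring

lemma summable_discount_mul_pow (hlam : 0 < lam) (hgam : 1 < gam) (C : ℝ) (κ : ℕ) :
    Summable fun n : ℕ => discount lam gam n * (C * (n : ℝ) ^ κ) ^ n := by
  have h1 : Tendsto (fun n : ℕ => ((n : ℝ) ^ (gam - 1))) atTop atTop :=
    (tendsto_rpow_atTop (by linarith)).comp tendsto_natCast_atTop_atTop
  have h2 := ((tendsto_rpow_mul_exp_neg_mul_atTop_nhds_zero ((κ : ℝ) / (gam - 1)) lam hlam).comp
    h1).const_mul |C|
  rw [mul_zero] at h2
  have h3 := (h2.eventually (gt_mem_nhds (show (0 : ℝ) < 1 / 2 by norm_num))).and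
    (eventually_ge_atTop 1)
  refine Summable.of_norm_bounded_eventually_nat (g := fun n : ℕ => (1 / 2 : ℝ) ^ n)
    (summable_geometric_of_lt_one (by norm_num) (by norm_num)) ?_
  filter_upwards [h3] with n hn
  obtain ⟨hn, hn1⟩ := hn
  have hn0 : (0 : ℝ) < n := by exact_mod_cast hn1
  have e1 : discount lam gam n = Real.exp (-lam * (n : ℝ) ^ (gam - 1)) ^ n := by
    rw [discount, ← Real.exp_nat_mul]
    congr 1
    have : (n : ℝ) ^ gam = (n : ℝ) ^ (gam - 1) * n := by
      rw [← Real.rpow_add_one hn0.ne']; congr 1; ring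
    rw [this]; ring
  have e2 : ((n : ℝ) ^ (gam - 1)) ^ ((κ : ℝ) / (gam - 1)) = (n : ℝ) ^ κ := by
    rw [← Real.rpow_mul hn0.le, mul_div_cancel₀ _ (by linarith), Real.rpow_natCast]
  simp only [Function.comp_apply, e2] at hn
  rw [e1, ← mul_pow, norm_pow]
  refine pow_le_pow_left₀ (norm_nonneg _) ?_ n
  rw [norm_mul, norm_mul, Real.norm_eq_abs, Real.norm_eq_abs, Real.norm_eq_abs, Real.abs_exp,
    abs_of_nonneg (by positivity : (0 : ℝ) ≤ (n : ℝ) ^ κ)]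
  linarith

lemma summable_discount (hlam : 0 < lam) (hgam : 1 < gam) :
    Summable fun n : ℕ => discount lam gam n := by
  simpa using summable_discount_mul_pow hlam hgam 1 0

end Discount

/-! ### Products of Lebesgue norms -/

section Holder

variable {Ω : Type*} [MeasurableSpace Ω] {μ : Measure Ω}

lemma eLpNorm_mul_le_holder {f g : Ω → ℝ} (p q r : ℝ≥0∞) [ENNReal.HolderTriple p q r]
    (hf : AEStronglyMeasurable f μ) (hg : AEStronglyMeasurable g μ) :
    eLpNorm (fun ω => f ω * g ω) r μ ≤ eLpNorm f p μ * eLpNorm g q μ :=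
  eLpNorm_smul_le_mul_eLpNorm (𝕜 := ℝ) hg hf

lemma holderTriple_double (p : ℝ≥0∞) : ENNReal.HolderTriple (2 * p) (2 * p) p := by
  constructor
  rw [ENNReal.mul_inv (by simp) (by simp), ← add_mul, ENNReal.inv_two_add_inv_two, one_mul]

lemma eLpNorm_mul_le_double {f g : Ω → ℝ} (p : ℝ≥0∞)
    (hf : AEStronglyMeasurable f μ) (hg : AEStronglyMeasurable g μ) :
    eLpNorm (fun ω => f ω * g ω) p μ ≤ eLpNorm f (2 * p) μ * eLpNorm g (2 * p) μ :=
  have := holderTriple_double p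
  eLpNorm_mul_le_holder (2 * p) (2 * p) p hf hg

lemma eLpNorm_prod_range_le [IsProbabilityMeasure μ] {V : ℕ → Ω → ℝ}
    (hV : ∀ j, AEStronglyMeasurable (V j) μ) {q : ℝ≥0∞} (hq : q ≠ 0) (n : ℕ) :
    eLpNorm (fun ω => ∏ j ∈ Finset.range n, V j ω) (q / n) μ
      ≤ ∏ j ∈ Finset.range n, eLpNorm (V j) q μ := by
  induction n with
  | zero =>
    have h := eLpNormEssSup_le_of_ae_bound (μ := μ) (f := fun _ : Ω => (1 : ℝ)) (C := 1) (by simp)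
    simpa [ENNReal.div_zero hq] using h
  | succ n ih =>
    have : ENNReal.HolderTriple (q / n) q (q / (n + 1 : ℕ)) := by
      constructor
      have key : ∀ k : ℕ, (q / k)⁻¹ = k * q⁻¹ := by
        intro k
        rw [ENNReal.inv_div (by simp) (Or.inr hq), ENNReal.div_eq_inv_mul, mul_comm]
      rw [key, key]
      push_cast
      ring
    simp only [Finset.prod_range_succ]
    refine (eLpNorm_mul_le_holder (q / n) q _
      (Finset.aestronglyMeasurable_fun_prod _ fun j _ => hV j) (hV n)).trans ?_
    gcongr

end Holder

/-! ### Running products -/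

section CumWeight

variable {Ω : Type*}

/-- The running products `∏_{j<n} V j`. -/
def cumWeight (V : ℕ → Ω → ℝ) (n : ℕ) (ω : Ω) : ℝ := ∏ j ∈ Finset.range n, V j ω

lemma cumWeight_mul (V W : ℕ → Ω → ℝ) (n : ℕ) :
    cumWeight (fun j ω => V j ω * W j ω) n = fun ω => cumWeight V n ω * cumWeight W n ω := by
  ext ω
  simp [cumWeight, Finset.prod_mul_distrib]

@[simp] lemma cumWeight_zero (V : ℕ → Ω → ℝ) (ω : Ω) : cumWeight V 0 ω = 1 := by simp [cumWeight]

lemma cumWeight_succ (V : ℕ → Ω → ℝ) (n : ℕ) (ω : Ω) :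
    cumWeight V (n + 1) ω = cumWeight V n ω * V n ω := by simp [cumWeight, Finset.prod_range_succ]

lemma one_le_cumWeight {V : ℕ → Ω → ℝ} (hV : ∀ j ω, 1 ≤ V j ω) (n : ℕ) (ω : Ω) :
    1 ≤ cumWeight V n ω := by
  induction n with
  | zero => simp
  | succ n ih => rw [cumWeight_succ]; nlinarith [hV n ω]

end CumWeight

/-! ### Uniform polynomial growth of moments -/

section PolyMoments

variable {Ω : Type*} [MeasurableSpace Ω] {μ : Measure Ω}

/-- The `L^N` norms of `V j` grow at most polynomially in `N`, uniformly in `j`. -/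
structure PolyMoments (μ : Measure Ω) (V : ℕ → Ω → ℝ) : Prop where
  aesm : ∀ j, AEStronglyMeasurable (V j) μ
  bound : ∃ C : ℝ≥0, ∃ κ : ℕ, ∀ j, ∀ N : ℕ, 1 ≤ N → eLpNorm (V j) N μ ≤ C * (N : ℝ≥0∞) ^ κ

lemma PolyMoments.mono {V W : ℕ → Ω → ℝ} (hV : PolyMoments μ V)
    (hW : ∀ j, AEStronglyMeasurable (W j) μ) (h : ∀ j, ∀ᵐ ω ∂μ, |W j ω| ≤ |V j ω|) :
    PolyMoments μ W := by
  obtain ⟨C, κ, hC⟩ := hV.bound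
  exact ⟨hW, C, κ, fun j N hN => (eLpNorm_mono_ae (h j)).trans (hC j N hN)⟩

lemma PolyMoments.abs {V : ℕ → Ω → ℝ} (hV : PolyMoments μ V) :
    PolyMoments μ (fun j ω => |V j ω|) :=
  hV.mono (fun j => (hV.aesm j).norm) fun j => by simp

lemma PolyMoments.shift {V : ℕ → Ω → ℝ} (hV : PolyMoments μ V) :
    PolyMoments μ (fun j => V (j + 1)) := by
  obtain ⟨C, κ, hC⟩ := hV.bound
  exact ⟨fun j => hV.aesm _, C, κ, fun j N hN => hC _ N hN⟩

lemma PolyMoments.const [IsProbabilityMeasure μ] (c : ℝ) :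
    PolyMoments μ (fun _ _ => c : ℕ → Ω → ℝ) := by
  refine ⟨fun j => aestronglyMeasurable_const, ‖c‖₊, 0, fun j N hN => ?_⟩
  rw [eLpNorm_const _ (by positivity) (IsProbabilityMeasure.ne_zero μ)]
  simp [enorm]

lemma PolyMoments.add {V W : ℕ → Ω → ℝ} (hV : PolyMoments μ V) (hW : PolyMoments μ W) :
    PolyMoments μ (fun j ω => V j ω + W j ω) := by
  obtain ⟨C, κ, hC⟩ := hV.bound
  obtain ⟨C', κ', hC'⟩ := hW.bound
  refine ⟨fun j => (hV.aesm j).add (hW.aesm j), C + C', κ + κ', fun j N hN => ?_⟩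
  have h1 : (1 : ℝ≥0∞) ≤ N := by exact_mod_cast hN
  refine (eLpNorm_add_le (hV.aesm j) (hW.aesm j) h1).trans ?_
  push_cast
  rw [add_mul]
  gcongr
  · exact (hC j N hN).trans (by gcongr; simp)
  · exact (hC' j N hN).trans (by gcongr; simp)

lemma PolyMoments.mul {V W : ℕ → Ω → ℝ} (hV : PolyMoments μ V) (hW : PolyMoments μ W) :
    PolyMoments μ (fun j ω => V j ω * W j ω) := by
  obtain ⟨C, κ, hC⟩ := hV.bound
  obtain ⟨C', κ', hC'⟩ := hW.bound
  refine ⟨fun j => (hV.aesm j).mul (hW.aesm j), C * 2 ^ κ * (C' * 2 ^ κ'), κ + κ',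
    fun j N hN => ?_⟩
  refine (eLpNorm_mul_le_double N (hV.aesm j) (hW.aesm j)).trans ?_
  have h1 := hC j (2 * N) (by omega)
  have h2 := hC' j (2 * N) (by omega)
  push_cast at h1 h2 ⊢
  refine (mul_le_mul' h1 h2).trans (le_of_eq ?_)
  rw [mul_pow, mul_pow, pow_add]
  ring

lemma PolyMoments.memLp [IsProbabilityMeasure μ] {V : ℕ → Ω → ℝ} (hV : PolyMoments μ V) (j : ℕ)
    {p : ℝ≥0∞} (hp : p ≠ ∞) : MemLp (V j) p μ := by
  obtain ⟨C, κ, hC⟩ := hV.bound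
  obtain ⟨N, hN⟩ := ENNReal.exists_nat_gt hp
  have : MemLp (V j) (N + 1 : ℕ) μ :=
    ⟨hV.aesm j, (hC j (N + 1) (by omega)).trans_lt
      (ENNReal.mul_lt_top (by simp) (ENNReal.pow_lt_top (by simp)))⟩
  exact this.mono_exponent (hN.le.trans (by simp))

/-- All Lebesgue norms of `T n` are summable against every positive power of the discount
factor. -/
structure Moderate (μ : Measure Ω) (lam gam : ℝ) (T : ℕ → Ω → ℝ) : Prop where
  aesm : ∀ j, AEStronglyMeasurable (T j) μ
  bound : ∀ N : ℕ, 1 ≤ N → ∀ s : ℝ, 0 < s →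
    ∑' n, ENNReal.ofReal (discount (s * lam) gam n) * eLpNorm (T n) N μ < ∞

lemma PolyMoments.moderate_cumWeight [IsProbabilityMeasure μ] {V : ℕ → Ω → ℝ}
    (hV : PolyMoments μ V) {lam gam : ℝ} (hlam : 0 < lam) (hgam : 1 < gam) :
    Moderate μ lam gam (cumWeight V) := by
  obtain ⟨C, κ, hC⟩ := hV.bound
  refine ⟨fun n => Finset.aestronglyMeasurable_fun_prod _ fun j _ => hV.aesm j,
    fun N hN s hs => ?_⟩
  have key : ∀ n : ℕ, eLpNorm (cumWeight V n) N μ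
      ≤ ENNReal.ofReal ((C * (N : ℝ) ^ κ * (n : ℝ) ^ κ) ^ n) := by
    intro n
    rcases Nat.eq_zero_or_pos n with rfl | hn
    · have : cumWeight V 0 = fun _ => (1 : ℝ) := by ext; simp [cumWeight]
      rw [this, eLpNorm_const _ (by positivity) (IsProbabilityMeasure.ne_zero μ)]
      simp
    have hn0 : (n : ℝ≥0∞) ≠ 0 := by simpa using hn.ne'
    have hN0 : (N : ℝ≥0∞) ≠ 0 := by simp; omega
    have h1 := eLpNorm_prod_range_le hV.aesm (q := (n * N : ℕ)) (by push_cast; positivity) n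
    have h2 : ((n * N : ℕ) : ℝ≥0∞) / n = N := by
      push_cast
      rw [mul_comm, ENNReal.mul_div_cancel_right hn0 (by simp)]
    rw [h2] at h1
    refine h1.trans ?_
    refine (Finset.prod_le_prod' (g := fun _ => (C : ℝ≥0∞) * ((n * N : ℕ) : ℝ≥0∞) ^ κ)
      fun j _ => hC j (n * N) (Nat.mul_pos hn hN)).trans (le_of_eq ?_)
    rw [Finset.prod_const, Finset.card_range, ENNReal.ofReal_pow (by positivity),
      ENNReal.ofReal_mul (by positivity), ENNReal.ofReal_mul (by positivity),
      ENNReal.ofReal_pow (by positivity), ENNReal.ofReal_pow (by positivity)]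
    simp only [ENNReal.ofReal_coe_nnreal, ENNReal.ofReal_natCast]
    push_cast
    rw [mul_pow]
    ring
  have hsum := summable_discount_mul_pow (mul_pos hs hlam) hgam (C * (N : ℝ) ^ κ) κ
  refine lt_of_le_of_lt (ENNReal.tsum_le_tsum fun n => ?_) hsum.tsum_ofReal_lt_top
  rw [ENNReal.ofReal_mul (discount_pos _ _ _).le]
  gcongr
  exact key n

lemma Moderate.mono {lam gam : ℝ} {T S : ℕ → Ω → ℝ} (hT : Moderate μ lam gam T)
    (hS : ∀ j, AEStronglyMeasurable (S j) μ) (h : ∀ j, ∀ᵐ ω ∂μ, |S j ω| ≤ |T j ω|) :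
    Moderate μ lam gam S :=
  ⟨hS, fun N hN s hs => (ENNReal.tsum_le_tsum fun n => by
    gcongr 1; exact eLpNorm_mono_ae (h n)).trans_lt (hT.bound N hN s hs)⟩

lemma Moderate.memLp [IsProbabilityMeasure μ] {lam gam : ℝ} {T : ℕ → Ω → ℝ}
    (hT : Moderate μ lam gam T) (n : ℕ) {p : ℝ≥0∞} (hp : p ≠ ∞) : MemLp (T n) p μ := by
  obtain ⟨N, hN⟩ := ENNReal.exists_nat_gt hp
  have h1 := (ENNReal.le_tsum n).trans_lt (hT.bound (N + 1) (by omega) 1 one_pos)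
  have : MemLp (T n) (N + 1 : ℕ) μ := by
    refine ⟨hT.aesm n, ?_⟩
    by_contra h
    rw [not_lt, top_le_iff] at h
    rw [h, ENNReal.mul_top (by simp [discount_pos])] at h1
    exact lt_irrefl _ h1
  exact this.mono_exponent (hN.le.trans (by simp))

end PolyMoments

/-! ### Gaussian moments and independence -/

section Gaussian

variable {Ω : Type*} [mΩ : MeasurableSpace Ω] {μ : Measure Ω}

lemma eLpNorm_gaussian_le {X : Ω → ℝ} (hX : HasGaussianLaw X μ) (h0 : ∫ ω, X ω ∂μ = 0)
    (h1 : Var[X; μ] ≤ 1) {N : ℕ} (hN : 1 ≤ N) : eLpNorm X N μ ≤ 4 * N := by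
  have hlaw := hX.map_eq_gaussianReal
  rw [h0] at hlaw
  have hmgf : ∀ t : ℝ, |t| = 1 → Integrable (fun ω => Real.exp (t * X ω)) μ ∧
      ∫ ω, Real.exp (t * X ω) ∂μ ≤ 2 := by
    intro t ht
    constructor
    · have := integrable_exp_mul_gaussianReal (μ := 0) (v := Var[X; μ].toNNReal) t
      rw [← hlaw] at this
      exact this.comp_aemeasurable hX.aemeasurable
    · have := mgf_gaussianReal hlaw t
      rw [mgf] at this
      rw [this, ← sq_abs, ht]
      have h2 : (Var[X; μ].toNNReal : ℝ) ≤ 1 := by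
        rw [Real.coe_toNNReal']; exact max_le h1 zero_le_one
      calc _ ≤ Real.exp (1 / 2) := Real.exp_le_exp.2 (by linarith)
        _ ≤ 2 := by
          have h3 := Real.exp_one_lt_d9
          have h4 : Real.exp (1 / 2) ^ 2 = Real.exp 1 := by rw [← Real.exp_nat_mul]; norm_num
          nlinarith [Real.exp_pos (1 / 2)]
  obtain ⟨i1, b1⟩ := hmgf 1 (by simp)
  obtain ⟨i2, b2⟩ := hmgf (-1) (by simp)
  have hpt : ∀ ω, |X ω| ^ N
      ≤ N.factorial * (Real.exp (1 * X ω) + Real.exp (-1 * X ω)) := by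
    intro ω
    have h := Real.pow_div_factorial_le_exp (|X ω|) (abs_nonneg _) N
    rw [div_le_iff₀ (by positivity)] at h
    refine h.trans ?_
    rw [mul_comm]
    gcongr
    rcases abs_cases (X ω) with ⟨h, _⟩ | ⟨h, _⟩ <;> rw [h] <;>
      simp only [one_mul, neg_one_mul] <;> linarith [Real.exp_pos (X ω), Real.exp_pos (-X ω)]
  have hN0 : (N : ℝ≥0) ≠ 0 := by simp; omega
  have hkey := eLpNorm_nnreal_pow_eq_lintegral (f := X) (μ := μ) hN0
  rw [← ENNReal.rpow_le_rpow_iff (z := (N : ℝ)) (by positivity)]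
  simp only [NNReal.coe_natCast, ENNReal.coe_natCast] at hkey
  rw [hkey]
  calc ∫⁻ ω, ‖X ω‖ₑ ^ (N : ℝ) ∂μ
      ≤ ∫⁻ ω, ENNReal.ofReal (N.factorial * (Real.exp (1 * X ω) + Real.exp (-1 * X ω))) ∂μ := by
        refine lintegral_mono fun ω => ?_
        rw [ENNReal.rpow_natCast, ← ofReal_norm, ← ENNReal.ofReal_pow (norm_nonneg _)]
        exact ENNReal.ofReal_le_ofReal (hpt ω)
    _ = ENNReal.ofReal (∫ ω, N.factorial * (Real.exp (1 * X ω) + Real.exp (-1 * X ω)) ∂μ) := by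
        exact (ofReal_integral_eq_lintegral_ofReal ((i1.add i2).const_mul _)
          (ae_of_all _ fun ω => by simp only [Pi.add_apply]; positivity)).symm
    _ ≤ ENNReal.ofReal ((4 * N) ^ N) := by
        refine ENNReal.ofReal_le_ofReal ?_
        rw [integral_const_mul, integral_add i1 i2, mul_pow, mul_comm]
        have hf : (N.factorial : ℝ) ≤ (N : ℝ) ^ N := by exact_mod_cast Nat.factorial_le_pow N
        have h4 : (4 : ℝ) ≤ 4 ^ N := le_self_pow₀ (by norm_num) (by omega)
        have := integral_nonneg (μ := μ) (f := fun ω => Real.exp (1 * X ω))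
          fun ω => (Real.exp_pos _).le
        gcongr
        linarith
    _ = (4 * N) ^ (N : ℝ) := by
        rw [ENNReal.ofReal_pow (by positivity), ENNReal.rpow_natCast,
          ENNReal.ofReal_mul (by positivity)]
        simp

lemma indep_sup_left [IsProbabilityMeasure μ] {A B C : MeasurableSpace Ω} (hA : A ≤ mΩ)
    (hB : B ≤ mΩ) (hC : C ≤ mΩ) (hABC : Indep A (B ⊔ C) μ) (hBC : Indep B C μ) :
    Indep (A ⊔ B) C μ := by
  let p : Set (Set Ω) :=
    {u | ∃ s t, MeasurableSet[A] s ∧ MeasurableSet[B] t ∧ u = s ∩ t}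
  have hgen : A ⊔ B = MeasurableSpace.generateFrom p := by
    refine le_antisymm (sup_le ?_ ?_) (MeasurableSpace.generateFrom_le ?_)
    · exact fun s hs => MeasurableSpace.measurableSet_generateFrom
        ⟨s, Set.univ, hs, @MeasurableSet.univ _ B, by simp⟩
    · exact fun s hs => MeasurableSpace.measurableSet_generateFrom
        ⟨Set.univ, s, @MeasurableSet.univ _ A, hs, by simp⟩
    · rintro _ ⟨s, t, hs, ht, rfl⟩
      exact @MeasurableSet.inter _ (A ⊔ B) _ _ (le_sup_left (a := A) _ hs)
        (le_sup_right (b := B) _ ht)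
  refine IndepSets.indep (sup_le hA hB) hC (p1 := p) (p2 := {s | MeasurableSet[C] s}) ?_
    (@MeasurableSpace.isPiSystem_measurableSet _ C) hgen
    (@MeasurableSpace.generateFrom_measurableSet _ C).symm ?_
  · rintro _ ⟨s, t, hs, ht, rfl⟩ _ ⟨s', t', hs', ht', rfl⟩ _
    exact ⟨s ∩ s', t ∩ t', hs.inter hs', ht.inter ht', Set.inter_inter_inter_comm _ _ _ _⟩
  · rw [IndepSets_iff]
    rintro _ c ⟨s, t, hs, ht, rfl⟩ hc
    rw [Indep_iff] at hABC hBC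
    have ht' := le_sup_left (a := B) (b := C) _ ht
    have hc' := le_sup_right (a := B) (b := C) _ hc
    rw [Set.inter_assoc, hABC s _ hs (@MeasurableSet.inter _ (B ⊔ C) _ _ ht' hc'), hBC t c ht hc,
      hABC s t hs ht', mul_assoc]

end Gaussian

/-! ### The white noise -/

section NoiseAlgebra

variable {Ω : Type*} {H : ℝ} {ξ : ℕ → Ω → ℝ}

lemma noiseAlpha_of_lt {n k : ℕ} (h : n < k) : noiseAlpha H n k = 0 := by
  rw [noiseAlpha]; simp [h.not_gt, h.ne']

lemma noiseBeta_of_lt {n k : ℕ} (h : k < n) : noiseBeta H n k =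
    (noiseCov H n k - ∑ j ∈ Finset.range k, noiseBeta H n j * noiseBeta H k j)
      / noiseBeta H k k := by
  rw [noiseBeta]
  simp only [h, dif_pos]
  rw [Finset.sum_range (fun j => noiseBeta H n j * noiseBeta H k j)]

lemma noiseBeta_self (n : ℕ) : noiseBeta H n n =
    Real.sqrt (noiseCov H n n - ∑ j ∈ Finset.range n, noiseBeta H n j * noiseBeta H n j) := by
  rw [noiseBeta]
  simp only [lt_irrefl, dif_neg, not_false_eq_true, dif_pos]
  rw [Finset.sum_range (fun j => noiseBeta H n j * noiseBeta H n j)]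

lemma noiseBeta_self_nonneg (n : ℕ) : 0 ≤ noiseBeta H n n := by
  rw [noiseBeta_self]; exact Real.sqrt_nonneg _

lemma noiseCov_self (hH : 0 < H) (n : ℕ) : noiseCov H n n = 1 := by
  have : (0 : ℝ) ^ (2 * H) = 0 := Real.zero_rpow (by positivity)
  simp [noiseCov, this]

lemma noiseBeta_self_le_one (hH : 0 < H) (n : ℕ) : noiseBeta H n n ≤ 1 := by
  rw [noiseBeta_self, noiseCov_self hH]
  refine Real.sqrt_le_one.2 ?_
  have := Finset.sum_nonneg (s := Finset.range n)
    fun j _ => mul_self_nonneg (noiseBeta H n j)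
  linarith

/-- The predictable part `∑_{k<n} γ(n,k) ξ k` of the noise. -/
def noisePred (H : ℝ) (ξ : ℕ → Ω → ℝ) (n : ℕ) (ω : Ω) : ℝ :=
  ∑ k ∈ Finset.range n, noiseGamma H n k * ξ k ω

lemma noisePred_eq (n : ℕ) (ω : Ω) : noisePred H ξ n ω =
    ∑ l ∈ Finset.range n, noiseBeta H n l * whiteNoise H ξ l ω := by
  simp only [noisePred, noiseGamma, whiteNoise, Finset.sum_mul, Finset.mul_sum]
  rw [Finset.sum_comm]
  refine Finset.sum_congr rfl fun l hl => ?_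
  rw [← Finset.sum_subset (Finset.range_mono (Nat.succ_le_of_lt (Finset.mem_range.1 hl)))]
  · exact Finset.sum_congr rfl fun k _ => by ring
  · intro k _ hk
    rw [noiseAlpha_of_lt (by simpa using hk)]
    ring

lemma whiteNoise_eq (n : ℕ) (ω : Ω) : whiteNoise H ξ n ω =
    (ξ n ω - noisePred H ξ n ω) / noiseBeta H n n := by
  rw [whiteNoise, Finset.sum_range_succ]
  have h1 : noiseAlpha H n n = 1 / noiseBeta H n n := by rw [noiseAlpha]; simp
  have h2 : ∀ k ∈ Finset.range n, noiseAlpha H n k * ξ k ω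
      = -(noiseGamma H n k * ξ k ω) / noiseBeta H n n := by
    intro k hk
    rw [noiseAlpha, if_pos (Finset.mem_range.1 hk), noiseGamma, Finset.sum_range
      (fun l => noiseBeta H n l * noiseAlpha H l k)]
    ring
  rw [Finset.sum_congr rfl h2, h1, ← Finset.sum_div, Finset.sum_neg_distrib, noisePred]
  ring

lemma noisePred_add (n : ℕ) (ω : Ω) (h : noiseBeta H n n ≠ 0) :
    noisePred H ξ n ω + noiseBeta H n n * whiteNoise H ξ n ω = ξ n ω := by
  rw [whiteNoise_eq]; field_simp; ring

end NoiseAlgebra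

/-- A centred Gaussian sequence with the covariance of the fractional noise. -/
structure IsNoise {Ω : Type*} [MeasurableSpace Ω] (μ : Measure Ω) (H : ℝ) (ξ : ℕ → Ω → ℝ) :
    Prop where
  measurable : ∀ n, Measurable (ξ n)
  gaussian : IsGaussianProcess ξ μ
  centered : ∀ n, ∫ ω, ξ n ω ∂μ = 0
  cov : ∀ m n, cov[ξ m, ξ n; μ] = noiseCov H m n

section Noise

variable {Ω : Type*} [mΩ : MeasurableSpace Ω] {μ : Measure Ω} [IsProbabilityMeasure μ]
  {H : ℝ} {ξ : ℕ → Ω → ℝ}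

lemma IsFractionalBrownianMotion.isNoise {B : ℝ≥0 → Ω → ℝ}
    (hB : IsFractionalBrownianMotion H B μ) : IsNoise μ H (fracNoise B) where
  measurable n := (hB.measurable _).sub (hB.measurable _)
  gaussian := by
    classical
    exact hB.gaussian.of_isGaussianProcess fun n => ⟨{(n : ℝ≥0), (n : ℝ≥0) + 1},
      { toFun x := x ⟨(n : ℝ≥0) + 1, by simp⟩ - x ⟨(n : ℝ≥0), by simp⟩
        map_add' x y := by simp; abel
        map_smul' c x := by simp; ring },
      by simp [fracNoise]⟩
  centered n := by
    have h := fun t => (hB.gaussian.hasGaussianLaw_eval t).integrable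
    simp only [fracNoise]
    rw [integral_sub (h _) (h _), hB.centered, hB.centered, sub_zero]
  cov m n := by
    have h := fun t => (hB.gaussian.hasGaussianLaw_eval t).memLp_two
    change cov[fun ω => B ((m : ℝ≥0) + 1) ω - B (m : ℝ≥0) ω,
      fun ω => B ((n : ℝ≥0) + 1) ω - B (n : ℝ≥0) ω; μ] = _
    rw [covariance_fun_sub_fun_sub (h _) (h _) (h _) (h _)]
    simp only [hB.covariance_eq]
    push_cast
    rw [noiseCov]
    have e1 : (m : ℝ) + 1 - (n + 1) = m - n := by ring
    have e2 : (m : ℝ) + 1 - n = m - n + 1 := by ring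
    have e3 : (m : ℝ) - (n + 1) = m - n - 1 := by ring
    rw [e1, e2, e3]
    ring

namespace IsNoise

variable (hξ : IsNoise μ H ξ)
include hξ

lemma memLp (n : ℕ) : MemLp (ξ n) 2 μ := (hξ.gaussian.hasGaussianLaw_eval n).memLp_two

lemma measurable_whiteNoise (n : ℕ) : Measurable (whiteNoise H ξ n) :=
  Finset.measurable_fun_sum _ fun k _ => (hξ.measurable k).const_mul _

lemma measurable_noisePred (n : ℕ) : Measurable (noisePred H ξ n) :=
  Finset.measurable_fun_sum _ fun k _ => (hξ.measurable k).const_mul _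

lemma memLp_whiteNoise (n : ℕ) : MemLp (whiteNoise H ξ n) 2 μ :=
  memLp_finsetSum _ fun k _ => (hξ.memLp k).const_mul _

lemma memLp_noisePred (n : ℕ) : MemLp (noisePred H ξ n) 2 μ :=
  memLp_finsetSum _ fun k _ => (hξ.memLp k).const_mul _

lemma integral_whiteNoise (n : ℕ) : ∫ ω, whiteNoise H ξ n ω ∂μ = 0 := by
  simp only [whiteNoise]
  rw [integral_finsetSum _ fun k _ => ((hξ.memLp k).integrable one_le_two).const_mul _]
  simp [integral_const_mul, hξ.centered]

lemma integral_noisePred (n : ℕ) : ∫ ω, noisePred H ξ n ω ∂μ = 0 := by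
  simp only [noisePred]
  rw [integral_finsetSum _ fun k _ => ((hξ.memLp k).integrable one_le_two).const_mul _]
  simp [integral_const_mul, hξ.centered]

lemma cov_noisePred {X : Ω → ℝ} (hX : MemLp X 2 μ) (n : ℕ) : cov[X, noisePred H ξ n; μ] =
    ∑ l ∈ Finset.range n, noiseBeta H n l * cov[X, whiteNoise H ξ l; μ] := by
  have : noisePred H ξ n = fun ω => ∑ l ∈ Finset.range n,
      noiseBeta H n l * whiteNoise H ξ l ω := funext fun ω => noisePred_eq n ω
  rw [this, covariance_fun_sum_right' (fun l _ => (hξ.memLp_whiteNoise l).const_mul _) hX]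
  simp [covariance_const_mul_right]

lemma cov_whiteNoise {X : Ω → ℝ} (hX : MemLp X 2 μ) (n : ℕ) : cov[X, whiteNoise H ξ n; μ] =
    (cov[X, ξ n; μ] - ∑ l ∈ Finset.range n, noiseBeta H n l * cov[X, whiteNoise H ξ l; μ])
      / noiseBeta H n n := by
  have : whiteNoise H ξ n = fun ω => (ξ n ω - noisePred H ξ n ω) / noiseBeta H n n :=
    funext fun ω => whiteNoise_eq n ω
  rw [← hξ.cov_noisePred hX, this, covariance_fun_div_right,
    covariance_fun_sub_right hX (hξ.memLp n) (hξ.memLp_noisePred n)]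

lemma cov_noise_whiteNoise (k : ℕ) : ∀ n, k ≤ n →
    cov[ξ n, whiteNoise H ξ k; μ] = noiseBeta H n k := by
  induction k using Nat.strong_induction_on with
  | _ k ih =>
    intro n hn
    rw [hξ.cov_whiteNoise (hξ.memLp n), hξ.cov]
    have h : ∑ l ∈ Finset.range k, noiseBeta H k l * cov[ξ n, whiteNoise H ξ l; μ]
        = ∑ l ∈ Finset.range k, noiseBeta H n l * noiseBeta H k l :=
      Finset.sum_congr rfl fun l hl => by
        have hl := Finset.mem_range.1 hl
        rw [ih l hl n (by omega), mul_comm]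
    rw [h]
    rcases hn.lt_or_eq with hlt | rfl
    · rw [noiseBeta_of_lt hlt]
    · rw [noiseBeta_self, Real.div_sqrt]

lemma cov_whiteNoise_of_lt (n : ℕ) : (∀ k < n,
    cov[whiteNoise H ξ n, whiteNoise H ξ k; μ] = 0) ∧
    (noiseBeta H n n ≠ 0 → cov[whiteNoise H ξ n, whiteNoise H ξ n; μ] = 1) := by
  induction n using Nat.strong_induction_on with
  | _ n ih =>
    have h1 : ∀ k < n, cov[whiteNoise H ξ n, whiteNoise H ξ k; μ] = 0 := by
      intro k hk
      rw [covariance_comm, hξ.cov_whiteNoise (hξ.memLp_whiteNoise k), covariance_comm,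
        hξ.cov_noise_whiteNoise k n hk.le, Finset.sum_eq_single_of_mem k (Finset.mem_range.2 hk)]
      · by_cases h0 : noiseBeta H k k = 0
        · rw [noiseBeta_of_lt hk, h0]; simp
        · rw [(ih k hk).2 h0]; simp
      · intro l hl hlk
        have hl := Finset.mem_range.1 hl
        rcases lt_or_gt_of_ne hlk with h | h
        · rw [(ih k hk).1 l h, mul_zero]
        · rw [covariance_comm, (ih l hl).1 k h, mul_zero]
    refine ⟨h1, fun h0 => ?_⟩
    rw [hξ.cov_whiteNoise (hξ.memLp_whiteNoise n), covariance_comm,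
      hξ.cov_noise_whiteNoise n n le_rfl,
      Finset.sum_eq_zero fun l hl => by rw [h1 l (Finset.mem_range.1 hl), mul_zero], sub_zero,
      div_self h0]

lemma cov_noisePred_self (n : ℕ) : cov[noisePred H ξ n, noisePred H ξ n; μ] =
    ∑ l ∈ Finset.range n, noiseBeta H n l * noiseBeta H n l := by
  rw [hξ.cov_noisePred (hξ.memLp_noisePred n)]
  refine Finset.sum_congr rfl fun l hl => ?_
  have hl := Finset.mem_range.1 hl
  congr 1
  rw [covariance_comm, hξ.cov_noisePred (hξ.memLp_whiteNoise l),
    Finset.sum_eq_single_of_mem l (Finset.mem_range.2 hl)]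
  · by_cases h0 : noiseBeta H l l = 0
    · rw [noiseBeta_of_lt hl, h0]; simp
    · rw [(hξ.cov_whiteNoise_of_lt l).2 h0, mul_one]
  · intro k _ hkl
    rcases lt_or_gt_of_ne hkl with h | h
    · rw [(hξ.cov_whiteNoise_of_lt l).1 k h, mul_zero]
    · rw [covariance_comm, (hξ.cov_whiteNoise_of_lt k).1 l h, mul_zero]

lemma variance_residual (n : ℕ) : Var[fun ω => ξ n ω - noisePred H ξ n ω; μ] =
    noiseCov H n n - ∑ l ∈ Finset.range n, noiseBeta H n l * noiseBeta H n l := by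
  have m1 := hξ.memLp n
  have m2 := hξ.memLp_noisePred n
  have hc : cov[ξ n, noisePred H ξ n; μ]
      = ∑ l ∈ Finset.range n, noiseBeta H n l * noiseBeta H n l := by
    rw [hξ.cov_noisePred m1]
    exact Finset.sum_congr rfl fun l hl => by
      rw [hξ.cov_noise_whiteNoise l n (Finset.mem_range.1 hl).le]
  have m3 : AEMeasurable (fun ω => ξ n ω - noisePred H ξ n ω) μ := (m1.sub m2).1.aemeasurable
  rw [← covariance_self m3, covariance_fun_sub_fun_sub m1 m2 m1 m2,
    hξ.cov, covariance_comm (noisePred H ξ n), hc, hξ.cov_noisePred_self]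
  ring

/-- The innovation decomposition of the noise. -/
lemma noise_eq (n : ℕ) : ∀ᵐ ω ∂μ,
    ξ n ω = noisePred H ξ n ω + noiseBeta H n n * whiteNoise H ξ n ω := by
  by_cases h0 : noiseBeta H n n = 0
  · have hv := hξ.variance_residual n
    have h1 := variance_nonneg (fun ω => ξ n ω - noisePred H ξ n ω) μ
    rw [noiseBeta_self, ← hv, Real.sqrt_eq_zero h1] at h0
    have m := (hξ.memLp n).sub (hξ.memLp_noisePred n)
    have h2 : ∫ ω, (ξ n ω - noisePred H ξ n ω) ∂μ = 0 := by
      rw [integral_sub ((hξ.memLp n).integrable one_le_two)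
        ((hξ.memLp_noisePred n).integrable one_le_two), hξ.centered, hξ.integral_noisePred,
        sub_zero]
    filter_upwards [ae_eq_integral_of_variance_eq_zero m h0] with ω hω
    have hω' : ξ n ω - noisePred H ξ n ω = 0 := hω.trans h2
    have h4 := noiseBeta_self (H := H) n
    rw [← hv, h0, Real.sqrt_zero] at h4
    rw [h4]
    linarith
  · exact ae_of_all _ fun ω => (noisePred_add n ω h0).symm

lemma cov_noise_whiteNoise_of_lt {k n : ℕ} (h : k < n) : cov[ξ k, whiteNoise H ξ n; μ] = 0 := by
  have h1 : ξ k =ᵐ[μ] fun ω => noisePred H ξ k ω + noiseBeta H k k * whiteNoise H ξ k ω :=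
    hξ.noise_eq k
  have hz : ∀ l < n, cov[whiteNoise H ξ n, whiteNoise H ξ l; μ] = 0 :=
    fun l hl => (hξ.cov_whiteNoise_of_lt n).1 l hl
  have h2 : cov[ξ k, whiteNoise H ξ n; μ] = cov[fun ω => noisePred H ξ k ω
      + noiseBeta H k k * whiteNoise H ξ k ω, whiteNoise H ξ n; μ] := by
    simp only [covariance]
    rw [integral_congr_ae h1]
    exact integral_congr_ae (by filter_upwards [h1] with ω h using by rw [h])
  rw [h2, covariance_comm, show (fun ω => noisePred H ξ k ω + noiseBeta H k k * whiteNoise H ξ k ω)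
    = noisePred H ξ k + fun ω => noiseBeta H k k * whiteNoise H ξ k ω from rfl,
    covariance_add_right (hξ.memLp_whiteNoise n) (hξ.memLp_noisePred k)
      ((hξ.memLp_whiteNoise k).const_mul _), covariance_const_mul_right, hz k h,
    hξ.cov_noisePred (hξ.memLp_whiteNoise n),
    Finset.sum_eq_zero fun l hl => by rw [hz l ((Finset.mem_range.1 hl).trans h), mul_zero]]
  simp

lemma isGaussianProcess_sum {T : Type*} (c : T → ℕ → ℝ) (N : T → ℕ) :
    IsGaussianProcess (fun t ω => ∑ k ∈ Finset.range (N t), c t k * ξ k ω) μ :=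
  hξ.gaussian.of_isGaussianProcess fun t => ⟨Finset.range (N t),
    { toFun x := ∑ k : Finset.range (N t), c t k * x k
      map_add' x y := by simp [mul_add, Finset.sum_add_distrib]
      map_smul' a x := by simp only [Pi.smul_apply, smul_eq_mul, RingHom.id_apply, Finset.mul_sum]
                          exact Finset.sum_congr rfl fun k _ => by ring
      cont := by fun_prop },
    fun ω => by
      simp [← Finset.sum_coe_sort (Finset.range (N t))]⟩

lemma hasGaussianLaw_whiteNoise (n : ℕ) : HasGaussianLaw (whiteNoise H ξ n) μ :=
  (hξ.isGaussianProcess_sum (fun _ : Unit => noiseAlpha H n) (fun _ => n + 1)).hasGaussianLaw_eval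
    ()

lemma variance_whiteNoise_le (n : ℕ) : Var[whiteNoise H ξ n; μ] ≤ 1 := by
  by_cases h0 : noiseBeta H n n = 0
  · have : whiteNoise H ξ n = fun _ => 0 := by
      funext ω; rw [whiteNoise_eq, h0, div_zero]
    rw [this, ← covariance_self aemeasurable_const, covariance_const_left]
    exact zero_le_one
  · rw [← covariance_self (hξ.measurable_whiteNoise n).aemeasurable,
      (hξ.cov_whiteNoise_of_lt n).2 h0]

lemma polyMoments_noise (hH : 0 < H) : PolyMoments μ ξ :=
  ⟨fun n => (hξ.measurable n).aestronglyMeasurable, 4, 1, fun n N hN => by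
    have hv : Var[ξ n; μ] ≤ 1 := by
      rw [← covariance_self (hξ.measurable n).aemeasurable, hξ.cov, noiseCov_self hH]
    simpa using eLpNorm_gaussian_le (hξ.gaussian.hasGaussianLaw_eval n) (hξ.centered n) hv hN⟩

lemma polyMoments_whiteNoise : PolyMoments μ (whiteNoise H ξ) :=
  ⟨fun n => (hξ.measurable_whiteNoise n).aestronglyMeasurable, 4, 1, fun n N hN => by
    simpa using eLpNorm_gaussian_le (hξ.hasGaussianLaw_whiteNoise n) (hξ.integral_whiteNoise n)
      (hξ.variance_whiteNoise_le n) hN⟩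

lemma polyMoments_noisePred (hH : 0 < H) : PolyMoments μ (noisePred H ξ) := by
  refine ((hξ.polyMoments_noise hH).abs.add hξ.polyMoments_whiteNoise.abs).mono
    (fun n => (hξ.measurable_noisePred n).aestronglyMeasurable) fun n => ?_
  filter_upwards [hξ.noise_eq n] with ω hω
  have h1 : noisePred H ξ n ω = ξ n ω - noiseBeta H n n * whiteNoise H ξ n ω := by linarith
  have h2 : |noiseBeta H n n * whiteNoise H ξ n ω| ≤ |whiteNoise H ξ n ω| := by
    rw [abs_mul, abs_of_nonneg (noiseBeta_self_nonneg n)]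
    exact mul_le_of_le_one_left (abs_nonneg _) (noiseBeta_self_le_one hH n)
  rw [h1, abs_of_nonneg (by positivity : 0 ≤ |ξ n ω| + |whiteNoise H ξ n ω|)]
  exact (abs_sub _ _).trans (by linarith)

lemma indep_past_whiteNoise (n : ℕ) :
    Indep (⨆ k : Fin n, MeasurableSpace.comap (ξ k) inferInstance)
      (MeasurableSpace.comap (whiteNoise H ξ n) inferInstance) μ := by
  let X : Fin n → Ω → ℝ := fun k => ξ k
  let Y : Unit → Ω → ℝ := fun _ => whiteNoise H ξ n
  have hG : IsGaussianProcess (Sum.elim X Y) μ := by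
    have := hξ.isGaussianProcess_sum
      (Sum.elim (fun (k : Fin n) (j : ℕ) => if j = k then 1 else 0)
        (fun (_ : Unit) j => noiseAlpha H n j)) (fun _ => n + 1)
    convert this using 1
    funext t ω
    rcases t with k | _
    · simp only [Sum.elim_inl, X, ite_mul, one_mul, zero_mul, Finset.sum_ite_eq',
        Finset.mem_range]
      rw [if_pos (by omega)]
    · rfl
  have h := hG.indepFun_of_covariance_eq_zero (fun k => (hξ.measurable k).aemeasurable)
    (fun _ => (hξ.measurable_whiteNoise n).aemeasurable)
    (fun k _ => hξ.cov_noise_whiteNoise_of_lt k.2)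
  have h' := (IndepFun_iff_Indep _ _ _).1 h
  refine indep_of_indep_of_le_left (indep_of_indep_of_le_right h' ?_) ?_
  · refine Measurable.comap_le (m₁ := MeasurableSpace.comap _ _) ?_
    have h1 := comap_measurable (m := MeasurableSpace.pi) (fun ω (t : Unit) => Y t ω)
    exact (measurable_pi_apply ()).comp h1
  · refine iSup_le fun k => ?_
    refine Measurable.comap_le (m₁ := MeasurableSpace.comap _ _) ?_
    have h1 := comap_measurable (m := MeasurableSpace.pi) (fun ω (t : Fin n) => X t ω)
    exact (measurable_pi_apply k).comp h1

end IsNoise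

end Noise

section Filtration

variable {Ω : Type*} {F₀ : MeasurableSpace Ω} {H : ℝ} {ξ : ℕ → Ω → ℝ}

lemma noiseFiltration_mono : Monotone (noiseFiltration F₀ ξ) := fun _ n h =>
  sup_le_sup_left (iSup_le fun k => le_iSup (fun k : Fin n => MeasurableSpace.comap (ξ k) _)
    (k.castLE h)) _

lemma measurable_noise_noiseFiltration {k n : ℕ} (h : k < n) :
    Measurable[noiseFiltration F₀ ξ n] (ξ k) :=
  (comap_measurable (ξ k)).mono (le_sup_of_le_right
    (le_iSup (fun k : Fin n => MeasurableSpace.comap (ξ k) inferInstance) ⟨k, h⟩)) le_rfl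

lemma measurable_noisePred_noiseFiltration (n : ℕ) :
    Measurable[noiseFiltration F₀ ξ n] (noisePred H ξ n) :=
  Finset.measurable_fun_sum _ fun _ hk =>
    (measurable_noise_noiseFiltration (Finset.mem_range.1 hk)).const_mul _

lemma measurable_whiteNoise_noiseFiltration (n : ℕ) :
    Measurable[noiseFiltration F₀ ξ (n + 1)] (whiteNoise H ξ n) :=
  Finset.measurable_fun_sum _ fun _ hk =>
    (measurable_noise_noiseFiltration (Finset.mem_range.1 hk)).const_mul _

end Filtration

section Filtration

variable {Ω : Type*} {F₀ : MeasurableSpace Ω} [mΩ : MeasurableSpace Ω] {μ : Measure Ω}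
  {H : ℝ} {ξ : ℕ → Ω → ℝ}

lemma noiseFiltration_le (hF₀ : F₀ ≤ mΩ) (hξ : ∀ n, Measurable (ξ n))
    (n : ℕ) : noiseFiltration F₀ ξ n ≤ mΩ :=
  sup_le hF₀ (iSup_le fun k => (hξ k).comap_le)

variable [IsProbabilityMeasure μ]

lemma IsNoise.indep_filtration_whiteNoise (hξ : IsNoise μ H ξ) (hF₀ : F₀ ≤ mΩ)
    (hind : Indep F₀ (⨆ n : ℕ, MeasurableSpace.comap (ξ n) inferInstance) μ) (n : ℕ) :
    Indep (noiseFiltration F₀ ξ n) (MeasurableSpace.comap (whiteNoise H ξ n) inferInstance) μ := by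
  refine indep_sup_left hF₀ (iSup_le fun k => (hξ.measurable k).comap_le)
    (hξ.measurable_whiteNoise n).comap_le (indep_of_indep_of_le_right hind ?_)
    (hξ.indep_past_whiteNoise n)
  refine sup_le (iSup_le fun k => le_iSup (fun n : ℕ => MeasurableSpace.comap (ξ n) _) k) ?_
  refine Measurable.comap_le (m₁ := ⨆ n : ℕ, MeasurableSpace.comap (ξ n) _) ?_
  refine Finset.measurable_fun_sum _ fun k _ => Measurable.const_mul ?_ _
  exact (comap_measurable (ξ k)).mono
    (le_iSup (fun n : ℕ => MeasurableSpace.comap (ξ n) inferInstance) k) le_rfl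

lemma IsNoise.condExp_noise (hξ : IsNoise μ H ξ) (hF₀ : F₀ ≤ mΩ)
    (hind : Indep F₀ (⨆ n : ℕ, MeasurableSpace.comap (ξ n) inferInstance) μ) (n : ℕ) :
    μ[ξ n | noiseFiltration F₀ ξ n] =ᵐ[μ] noisePred H ξ n := by
  have hle := noiseFiltration_le hF₀ hξ.measurable n
  have i1 : Integrable (noisePred H ξ n) μ := (hξ.memLp_noisePred n).integrable one_le_two
  have i2 : Integrable (whiteNoise H ξ n) μ := (hξ.memLp_whiteNoise n).integrable one_le_two
  have h0 : μ[whiteNoise H ξ n | noiseFiltration F₀ ξ n] =ᵐ[μ] fun _ => 0 := by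
    have := condExp_indep_eq (hξ.measurable_whiteNoise n).comap_le hle
      (comap_measurable (whiteNoise H ξ n)).stronglyMeasurable
      (hξ.indep_filtration_whiteNoise hF₀ hind n).symm
    rwa [hξ.integral_whiteNoise] at this
  have h1 : ξ n =ᵐ[μ] noisePred H ξ n + noiseBeta H n n • whiteNoise H ξ n := hξ.noise_eq n
  have h2 : μ[noisePred H ξ n | noiseFiltration F₀ ξ n] = noisePred H ξ n :=
    condExp_of_stronglyMeasurable hle (measurable_noisePred_noiseFiltration n).stronglyMeasurable
      i1
  filter_upwards [condExp_congr_ae (m := noiseFiltration F₀ ξ n) h1,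
    condExp_add i1 (i2.smul (noiseBeta H n n)) (noiseFiltration F₀ ξ n),
    condExp_smul (noiseBeta H n n) (whiteNoise H ξ n) (noiseFiltration F₀ ξ n) (μ := μ), h0]
    with ω a1 a2 a3 a4
  rw [a1, a2, Pi.add_apply, a3, h2, Pi.smul_apply, a4]
  simp

end Filtration

/-! ### The exponents -/

section Exponents

variable {θ : ℝ}

lemma deltaSeq_pos (hθ : 0 < θ) (i : ℕ) : 0 < deltaSeq θ i := by
  have : ((i : ℝ) + 2) ^ (-θ) < 1 :=
    Real.rpow_lt_one_of_one_lt_of_neg (by linarith [i.cast_nonneg (α := ℝ)]) (by linarith)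
  rw [deltaSeq]; linarith

lemma deltaSeq_lt_one (θ : ℝ) (i : ℕ) : deltaSeq θ i < 1 := by
  have : 0 < ((i : ℝ) + 2) ^ (-θ) := by positivity
  rw [deltaSeq]; linarith

lemma deltaProd_pos (hθ : 0 < θ) (n : ℕ) : 0 < deltaProd θ n :=
  Finset.prod_pos fun i _ => deltaSeq_pos hθ i

lemma deltaProd_succ (θ : ℝ) (n : ℕ) :
    deltaProd θ (n + 1) = deltaProd θ n * deltaSeq θ (n + 1) := by
  rw [deltaProd, deltaProd, Finset.prod_Icc_succ_top (by omega)]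

lemma deltaProd_strictAnti (hθ : 0 < θ) : StrictAnti (deltaProd θ) :=
  strictAnti_nat_of_succ_lt fun n => by
    rw [deltaProd_succ]
    exact mul_lt_of_lt_one_right (deltaProd_pos hθ n) (deltaSeq_lt_one θ _)

lemma deltaProd_le_one (hθ : 0 < θ) (n : ℕ) : deltaProd θ n ≤ 1 := by
  simpa [deltaProd] using (deltaProd_strictAnti hθ).antitone (Nat.zero_le n)

lemma tendsto_deltaProd (hθ : 0 < θ) : Tendsto (deltaProd θ) atTop (𝓝 (deltaLim θ)) := by
  have h := tendsto_atTop_ciInf (deltaProd_strictAnti hθ).antitone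
    ⟨0, by rintro _ ⟨n, rfl⟩; exact (deltaProd_pos hθ n).le⟩
  exact tendsto_nhds_limUnder ⟨_, h⟩

lemma deltaLim_lt_deltaProd (hθ : 0 < θ) (n : ℕ) : deltaLim θ < deltaProd θ n :=
  ((deltaProd_strictAnti hθ).antitone.le_of_tendsto (tendsto_deltaProd hθ) (n + 1)).trans_lt
    (deltaProd_strictAnti hθ (Nat.lt_succ_self n))

lemma deltaLim_nonneg (hθ : 0 < θ) : 0 ≤ deltaLim θ :=
  ge_of_tendsto' (tendsto_deltaProd hθ) fun n => (deltaProd_pos hθ n).le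

end Exponents

/-! ### Membership in the weighted spaces -/

section WeightedSpaces

variable {Ω : Type*} [mΩ : MeasurableSpace Ω] {μ : Measure Ω} [IsProbabilityMeasure μ]
  {F : ℕ → MeasurableSpace Ω} {β θ lam gam : ℝ} {Y : ℕ → Ω → ℝ}

lemma enorm_rpow_le_one_add {x : ℝ} {p q : ℝ} (hp : 0 ≤ p) (hpq : p ≤ q) :
    ‖x‖ₑ ^ p ≤ 1 + ‖x‖ₑ ^ q := by
  rcases le_total ‖x‖ₑ 1 with h | h
  · exact (ENNReal.rpow_le_one h hp).trans le_self_add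
  · exact (ENNReal.rpow_le_rpow_of_exponent_le h hpq).trans le_add_self

lemma lintegral_rpow_le_one_add {X : Ω → ℝ} {p q : ℝ} (hp : 0 ≤ p) (hpq : p ≤ q) :
    ∫⁻ ω, ‖X ω‖ₑ ^ p ∂μ ≤ 1 + ∫⁻ ω, ‖X ω‖ₑ ^ q ∂μ := by
  refine (lintegral_mono fun ω => enorm_rpow_le_one_add hp hpq).trans ?_
  rw [lintegral_add_left measurable_const]
  simp

lemma eLpNorm_rpow_eq {X : Ω → ℝ} {p : ℝ} (hp : 0 < p) :
    eLpNorm X (ENNReal.ofReal p) μ ^ p = ∫⁻ ω, ‖X ω‖ₑ ^ p ∂μ := by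
  have h := eLpNorm_nnreal_pow_eq_lintegral (f := X) (μ := μ) (p := p.toNNReal)
    (by simpa using hp)
  rw [Real.coe_toNNReal _ hp.le] at h
  exact h

lemma memLp_of_lintegral_rpow {X : Ω → ℝ} (hX : AEStronglyMeasurable X μ) {p : ℝ} (hp : 0 < p)
    (h : ∫⁻ ω, ‖X ω‖ₑ ^ p ∂μ < ∞) : MemLp X (ENNReal.ofReal p) μ := by
  refine ⟨hX, ?_⟩
  rw [← eLpNorm_rpow_eq hp] at h
  exact (ENNReal.rpow_lt_top_iff_of_pos hp).1 h

lemma lintegral_rpow_lt_top_of_weightedMoment {X : Ω → ℝ} {n : ℕ} {p : ℝ}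
    (h : weightedMoment μ lam gam n p X < ∞) : ∫⁻ ω, ‖X ω‖ₑ ^ p ∂μ < ∞ := by
  by_contra hc
  rw [not_lt, top_le_iff] at hc
  rw [weightedMoment, hc, ENNReal.mul_top (by simp [discount_pos])] at h
  exact lt_irrefl _ h

/-- A process in `L̂^β`, `β ≥ 2`, grows in `L²` at most as the inverse square root of the discount
factor. -/
lemma MemLHat.eLpNorm_two_le (hY : MemLHat μ F β θ lam gam Y) (hθ : 0 < θ)
    (hβ : 2 ≤ β) (hlam : 0 < lam) : ∃ K : ℝ≥0∞, K ≠ ∞ ∧ ∀ n,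
      eLpNorm (Y n) 2 μ ≤ K * ENNReal.ofReal (discount (-(1 / 2) * lam) gam n) := by
  set S := ∑' n, weightedMoment μ lam gam n (β / deltaProd θ n) (Y n) with hS
  refine ⟨(1 + S) ^ (1 / 2 : ℝ), ?_, fun n => ?_⟩
  · exact ENNReal.rpow_ne_top_of_nonneg (by norm_num) (ENNReal.add_ne_top.2 ⟨ENNReal.one_ne_top, hY.finite.ne⟩)
  have hD : 0 < discount lam gam n := discount_pos _ _ _
  have hexp : (2 : ℝ) ≤ β / deltaProd θ n := by
    rw [le_div_iff₀ (deltaProd_pos hθ n)]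
    nlinarith [deltaProd_le_one hθ n]
  have h1 : ENNReal.ofReal (discount lam gam n) * ∫⁻ ω, ‖Y n ω‖ₑ ^ (2 : ℝ) ∂μ ≤ 1 + S := by
    calc _ ≤ ENNReal.ofReal (discount lam gam n) *
          (1 + ∫⁻ ω, ‖Y n ω‖ₑ ^ (β / deltaProd θ n) ∂μ) := by
          gcongr; exact lintegral_rpow_le_one_add (by norm_num) hexp
      _ ≤ 1 + S := by
          rw [mul_add, mul_one]
          refine add_le_add ?_ (ENNReal.le_tsum (f := fun n =>
            weightedMoment μ lam gam n (β / deltaProd θ n) (Y n)) n)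
          exact ENNReal.ofReal_le_one.2 (discount_le_one hlam.le _ _)
  have h2 : eLpNorm (Y n) 2 μ ^ (2 : ℝ) = ∫⁻ ω, ‖Y n ω‖ₑ ^ (2 : ℝ) ∂μ := by
    simpa using eLpNorm_rpow_eq (μ := μ) (X := Y n) (p := 2) (by norm_num)
  rw [← h2] at h1
  rw [← ENNReal.rpow_le_rpow_iff (z := 2) (by norm_num), ENNReal.mul_rpow_of_nonneg _ _
    (by norm_num), ← ENNReal.rpow_mul, ENNReal.ofReal_rpow_of_pos (discount_pos _ _ _),
    discount_mul, ← Real.rpow_mul hD.le]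
  norm_num
  rw [Real.rpow_neg_one, ENNReal.ofReal_inv_of_pos hD, ← div_eq_mul_inv,
    ENNReal.le_div_iff_mul_le (by simp [hD]) (by simp), mul_comm]
  simpa using h1

lemma MemLHat.memLp_two (hY : MemLHat μ F β θ lam gam Y) (hF : ∀ n, F n ≤ mΩ) (hθ : 0 < θ)
    (hβ : 2 ≤ β) (hlam : 0 < lam) (n : ℕ) : MemLp (Y n) 2 μ := by
  obtain ⟨K, hK, h⟩ := hY.eLpNorm_two_le hθ hβ hlam
  exact ⟨((hY.adapted n).mono (hF n) le_rfl).aestronglyMeasurable,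
    (h n).trans_lt (ENNReal.mul_lt_top hK.lt_top ENNReal.ofReal_lt_top)⟩

lemma memLHat_of_eLpNorm_le (hYm : ∀ n, Measurable[F n] (Y n)) (hθ : 0 < θ)
    (hθ' : 0 < deltaLim θ) (hβ : 0 ≤ β) (hlam : 0 < lam) (hgam : 1 < gam)
    (h : ∀ N : ℕ, 1 ≤ N → ∀ s : ℝ, 0 < s → s < 1 → ∃ K : ℝ≥0∞, K ≠ ∞ ∧ ∀ n,
      eLpNorm (Y n) N μ ≤ K * ENNReal.ofReal (discount (-s * lam) gam n)) :
    MemLHat μ F β θ lam gam Y := by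
  refine ⟨hYm, ?_⟩
  obtain ⟨P, hP⟩ := exists_nat_ge (max 1 (β / deltaLim θ))
  have hP1 : 1 ≤ P := by exact_mod_cast (le_max_left _ _).trans hP
  have hP0 : (0 : ℝ) < P := by exact_mod_cast hP1
  obtain ⟨K, hK, hb⟩ := h P hP1 (1 / (2 * P)) (by positivity) (by
    rw [div_lt_one (by positivity)]
    have : (1 : ℝ) ≤ P := by exact_mod_cast hP1
    linarith)
  have key : ∀ n, weightedMoment μ lam gam n (β / deltaProd θ n) (Y n)
      ≤ ENNReal.ofReal (discount lam gam n)
        + K ^ (P : ℝ) * ENNReal.ofReal (discount (1 / 2 * lam) gam n) := by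
    intro n
    have hD : 0 < discount lam gam n := discount_pos _ _ _
    have hd := deltaProd_pos hθ n
    have hexp : β / deltaProd θ n ≤ P := by
      refine le_trans ?_ ((le_max_right _ _).trans hP)
      exact div_le_div_of_nonneg_left hβ hθ' (deltaLim_lt_deltaProd hθ n).le
    have h1 : ∫⁻ ω, ‖Y n ω‖ₑ ^ (P : ℝ) ∂μ
        ≤ K ^ (P : ℝ) * ENNReal.ofReal (discount lam gam n ^ (-(1 / 2) : ℝ)) := by
      rw [← eLpNorm_rpow_eq hP0]
      calc eLpNorm (Y n) (ENNReal.ofReal P) μ ^ (P : ℝ)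
          ≤ (K * ENNReal.ofReal (discount (-(1 / (2 * P)) * lam) gam n)) ^ (P : ℝ) := by
            gcongr; simpa using hb n
        _ = _ := by
            rw [ENNReal.mul_rpow_of_nonneg _ _ hP0.le,
              ENNReal.ofReal_rpow_of_pos (discount_pos _ _ _), discount_mul,
              ← Real.rpow_mul hD.le]
            congr 4
            field_simp
    calc weightedMoment μ lam gam n (β / deltaProd θ n) (Y n)
        ≤ ENNReal.ofReal (discount lam gam n) *
          (1 + K ^ (P : ℝ) * ENNReal.ofReal (discount lam gam n ^ (-(1 / 2) : ℝ))) := by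
          rw [weightedMoment]
          gcongr
          exact (lintegral_rpow_le_one_add (by positivity) hexp).trans (by gcongr)
      _ = _ := by
          rw [mul_add, mul_one, mul_left_comm, ← ENNReal.ofReal_mul hD.le, discount_mul]
          congr 3
          nth_rewrite 1 [← Real.rpow_one (discount lam gam n)]
          rw [← Real.rpow_add hD]
          norm_num
  refine (ENNReal.tsum_le_tsum key).trans_lt ?_
  rw [ENNReal.tsum_add, ENNReal.tsum_mul_left]
  refine ENNReal.add_lt_top.2 ⟨(summable_discount hlam hgam).tsum_ofReal_lt_top,
    ENNReal.mul_lt_top (ENNReal.rpow_lt_top_of_nonneg hP0.le hK) ?_⟩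
  exact (summable_discount (by positivity) hgam).tsum_ofReal_lt_top

/-- Moderate weights are integrable against discounted processes of `L̂^β`, with summable
integrals. -/
lemma Moderate.summable_integral_mul {T : ℕ → Ω → ℝ} (hT : Moderate μ lam gam T)
    (hY : MemLHat μ F β θ lam gam Y) (hF : ∀ n, F n ≤ mΩ) (hθ : 0 < θ)
    (hβ : 2 ≤ β) (hlam : 0 < lam) :
    (∀ n, Integrable (fun ω => T n ω * Y n ω) μ) ∧
      Summable fun n => discount lam gam n * ∫ ω, |T n ω * Y n ω| ∂μ := by
  have hY2 := hY.memLp_two hF hθ hβ hlam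
  have hint : ∀ n, Integrable (fun ω => T n ω * Y n ω) μ := fun n =>
    (hT.memLp n (p := 2) ENNReal.ofNat_ne_top).integrable_mul (hY2 n)
  refine ⟨hint, ?_⟩
  obtain ⟨K, hK, hb⟩ := hY.eLpNorm_two_le hθ hβ hlam
  have hsum : ∑' n, ENNReal.ofReal (discount lam gam n * ∫ ω, |T n ω * Y n ω| ∂μ) < ∞ := by
    have hfin := ENNReal.mul_lt_top hK.lt_top
      (hT.bound 2 (by norm_num) (1 / 2) (by norm_num))
    rw [← ENNReal.tsum_mul_left] at hfin
    refine (ENNReal.tsum_le_tsum fun n => ?_).trans_lt hfin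
    have h1 : ENNReal.ofReal (∫ ω, |T n ω * Y n ω| ∂μ) ≤ eLpNorm (T n) 2 μ * eLpNorm (Y n) 2 μ := by
      have h2 := eLpNorm_mul_le_double (μ := μ) 1 (hT.aesm n) (hY2 n).1
      rw [mul_one] at h2
      refine le_trans (le_of_eq ?_) h2
      rw [eLpNorm_one_eq_lintegral_enorm, ← ofReal_integral_norm_eq_lintegral_enorm (hint n)]
      rfl
    rw [ENNReal.ofReal_mul (discount_pos _ _ _).le]
    calc _ ≤ ENNReal.ofReal (discount lam gam n) * (eLpNorm (T n) 2 μ *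
          (K * ENNReal.ofReal (discount (-(1 / 2) * lam) gam n))) := by
          gcongr; exact h1.trans (by gcongr; exact hb n)
      _ = K * (ENNReal.ofReal (discount (1 / 2 * lam) gam n) * eLpNorm (T n) (2 : ℕ) μ) := by
          have : discount (1 / 2 * lam) gam n
              = discount lam gam n * discount (-(1 / 2) * lam) gam n := by
            rw [← discount_add]; congr 1; ring
          rw [this, ENNReal.ofReal_mul (discount_pos _ _ _).le, Nat.cast_ofNat]
          ring
  refine (ENNReal.summable_toReal hsum.ne).congr fun n => ENNReal.toReal_ofReal ?_
  exact mul_nonneg (discount_pos _ _ _).le (integral_nonneg fun ω => abs_nonneg _)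

end WeightedSpaces

/-! ### Backward equations dominated by multiplicative weights -/

/-- Multiplicative weights `V` that dominate the driving noise `η` and whose running products are
moderate. -/
structure BackwardWeights {Ω : Type*} [mΩ : MeasurableSpace Ω] (μ : Measure Ω)
    (F : ℕ → MeasurableSpace Ω) (η : ℕ → Ω → ℝ) (lam gam : ℝ) (V : ℕ → Ω → ℝ) : Prop where
  lam_pos : 0 < lam
  one_lt_gam : 1 < gam
  le : ∀ n, F n ≤ mΩ
  mono : Monotone F
  measurable_eta : ∀ n, Measurable (η n)
  measurable : ∀ n, Measurable[F (n + 1)] (V n)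
  eta_le : ∀ n ω, 1 + |η n ω| ≤ V n ω
  moderate : Moderate μ lam gam fun n ω => cumWeight V n ω ^ 4

/-- Generators whose increments are dominated by the weights. -/
structure DominatedGenerator {Ω : Type*} (F : ℕ → MeasurableSpace Ω) (η : ℕ → Ω → ℝ)
    (V : ℕ → Ω → ℝ) (c : ℝ) (g : ℕ → Ω → ℝ → ℝ → ℝ) : Prop where
  nonneg : 0 ≤ c
  measurable : ∀ n (y z : Ω → ℝ), Measurable[F n] y → Measurable[F n] z →
    Measurable[F n] fun ω => g n ω (y ω) (z ω)
  lipschitz : ∀ n ω y z y' z', (1 + |η n ω|) *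
    |y + g (n + 1) ω y z - (y' + g (n + 1) ω y' z')| ≤ V n ω * (|y - y'| + |z - z'|)
  zero_le : ∀ n ω, |g n ω 0 0| ≤ c * cumWeight V n ω

/-- The discounted tail of the squared running products. -/
def tailWeight {Ω : Type*} (lam gam : ℝ) (V : ℕ → Ω → ℝ) (n : ℕ) (ω : Ω) : ℝ :=
  ∑' k, discount lam gam (n + 1 + k) * cumWeight V (n + 1 + k) ω ^ 2

section Weights

variable {Ω : Type*} [mΩ : MeasurableSpace Ω] {μ : Measure Ω} [IsProbabilityMeasure μ]
  {F : ℕ → MeasurableSpace Ω} {η V : ℕ → Ω → ℝ} {lam gam : ℝ}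

namespace BackwardWeights

variable (hV : BackwardWeights μ F η lam gam V)
include hV

lemma one_le (n : ℕ) (ω : Ω) : 1 ≤ V n ω := by
  linarith [hV.eta_le n ω, abs_nonneg (η n ω)]

lemma one_le_cum (n : ℕ) (ω : Ω) : 1 ≤ cumWeight V n ω := one_le_cumWeight hV.one_le n ω

lemma cum_pos (n : ℕ) (ω : Ω) : 0 < cumWeight V n ω := one_pos.trans_le (hV.one_le_cum n ω)

lemma measurable_cum (n : ℕ) : Measurable[F n] (cumWeight V n) :=
  Finset.measurable_fun_prod _ fun k hk =>
    (hV.measurable k).mono (hV.mono (Finset.mem_range.1 hk)) le_rfl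

lemma measurable_cum' (n : ℕ) : Measurable (cumWeight V n) :=
  (hV.measurable_cum n).mono (hV.le n) le_rfl

lemma moderate_pow {k : ℕ} (hk : k ≤ 4) :
    Moderate μ lam gam fun n ω => cumWeight V n ω ^ k :=
  hV.moderate.mono (fun n => ((hV.measurable_cum' n).pow_const k).aestronglyMeasurable)
    fun n => ae_of_all _ fun ω => by
      have := hV.cum_pos n ω
      rw [abs_of_pos (by positivity), abs_of_pos (by positivity)]
      exact pow_le_pow_right₀ (hV.one_le_cum n ω) hk

lemma moderate_cum : Moderate μ lam gam (cumWeight V) := by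
  simpa using hV.moderate_pow (k := 1) (by norm_num)

lemma memLp_cum_pow {k : ℕ} (hk : k ≤ 4) (n : ℕ) {p : ℝ≥0∞} (hp : p ≠ ∞) :
    MemLp (fun ω => cumWeight V n ω ^ k) p μ := (hV.moderate_pow hk).memLp n hp

lemma integrable_cum_pow {k : ℕ} (hk : k ≤ 4) (n : ℕ) :
    Integrable (fun ω => cumWeight V n ω ^ k) μ :=
  memLp_one_iff_integrable.1 (hV.memLp_cum_pow hk n ENNReal.one_ne_top)

lemma sum_eLpNorm_le {s : ℝ} (hs : s < 1) {N : ℕ} (n : ℕ) :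
    ∑' k, eLpNorm (fun ω => discount lam gam (n + 1 + k) * cumWeight V (n + 1 + k) ω ^ 2) N μ
      ≤ ENNReal.ofReal (discount ((1 - s) * lam) gam n) *
        ∑' k, ENNReal.ofReal (discount (s * lam) gam k) *
          eLpNorm (fun ω => cumWeight V k ω ^ 2) N μ := by
  have h1 : ∀ k, eLpNorm (fun ω => discount lam gam (n + 1 + k)
      * cumWeight V (n + 1 + k) ω ^ 2) N μ
      ≤ ENNReal.ofReal (discount ((1 - s) * lam) gam n) *
        (ENNReal.ofReal (discount (s * lam) gam (n + 1 + k)) *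
          eLpNorm (fun ω => cumWeight V (n + 1 + k) ω ^ 2) N μ) := by
    intro k
    have e : (fun ω => discount lam gam (n + 1 + k) * cumWeight V (n + 1 + k) ω ^ 2)
        = discount lam gam (n + 1 + k) • fun ω => cumWeight V (n + 1 + k) ω ^ 2 := rfl
    rw [e, eLpNorm_const_smul, ← mul_assoc, ← ENNReal.ofReal_mul (discount_pos _ _ _).le,
      Real.enorm_of_nonneg (discount_pos _ _ _).le]
    gcongr
    have e2 : discount lam gam (n + 1 + k) = discount ((1 - s) * lam) gam (n + 1 + k)
        * discount (s * lam) gam (n + 1 + k) := by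
      rw [← discount_add]; congr 1; ring
    rw [e2]
    refine mul_le_mul_of_nonneg_right ?_ (discount_pos _ _ _).le
    exact discount_antitone (mul_nonneg (by linarith) hV.lam_pos.le)
      (by linarith [hV.one_lt_gam]) (by omega)
  refine (ENNReal.tsum_le_tsum h1).trans ?_
  rw [ENNReal.tsum_mul_left]
  refine mul_le_mul' le_rfl ?_
  exact ENNReal.tsum_comp_le_tsum_of_injective (f := fun k => n + 1 + k)
    (fun a b h => by simpa using h) (fun k => ENNReal.ofReal (discount (s * lam) gam k) *
          eLpNorm (fun ω => cumWeight V k ω ^ 2) N μ)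

lemma ae_summable_tail (n : ℕ) : ∀ᵐ ω ∂μ,
    Summable fun k => discount lam gam (n + 1 + k) * cumWeight V (n + 1 + k) ω ^ 2 := by
  have h1 := hV.sum_eLpNorm_le (s := 1 / 2) (by norm_num) (N := 1) n
  have h2 := ENNReal.mul_lt_top (ENNReal.ofReal_lt_top (r := discount ((1 - 1 / 2) * lam) gam n))
    ((hV.moderate_pow (k := 2) (by norm_num)).bound 1 le_rfl (1 / 2) (by norm_num))
  have h3 := h1.trans_lt h2
  have hm : ∀ k, Measurable fun ω => discount lam gam (n + 1 + k)
      * cumWeight V (n + 1 + k) ω ^ 2 := fun k => ((hV.measurable_cum' _).pow_const 2).const_mul _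
  simp only [Nat.cast_one, eLpNorm_one_eq_lintegral_enorm] at h3
  rw [← lintegral_tsum fun k => (hm k).enorm.aemeasurable] at h3
  filter_upwards [ae_lt_top (Measurable.tsum fun k => (hm k).enorm) h3.ne] with ω hω
  refine (ENNReal.summable_toReal hω.ne).congr fun k => ?_
  have := discount_pos lam gam (n + 1 + k)
  rw [Real.enorm_of_nonneg (by positivity), ENNReal.toReal_ofReal (by positivity)]

lemma measurable_tailWeight (n : ℕ) : AEStronglyMeasurable (tailWeight lam gam V n) μ := by
  have hm : ∀ k, Measurable fun ω => discount lam gam (n + 1 + k)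
      * cumWeight V (n + 1 + k) ω ^ 2 := fun k => ((hV.measurable_cum' _).pow_const 2).const_mul _
  refine aestronglyMeasurable_of_tendsto_ae atTop (f := fun j ω => ∑ k ∈ Finset.range j,
    discount lam gam (n + 1 + k) * cumWeight V (n + 1 + k) ω ^ 2)
    (fun j => (Finset.measurable_fun_sum _ fun k _ => hm k).aestronglyMeasurable) ?_
  filter_upwards [hV.ae_summable_tail n] with ω hω using hω.hasSum.tendsto_sum_nat

lemma eLpNorm_tailWeight_le {s : ℝ} (hs : s < 1) {N : ℕ} (hN : 1 ≤ N) (n : ℕ) :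
    eLpNorm (tailWeight lam gam V n) N μ
      ≤ ENNReal.ofReal (discount ((1 - s) * lam) gam n) *
        ∑' k, ENNReal.ofReal (discount (s * lam) gam k) *
          eLpNorm (fun ω => cumWeight V k ω ^ 2) N μ := by
  have hm : ∀ k, Measurable fun ω => discount lam gam (n + 1 + k)
      * cumWeight V (n + 1 + k) ω ^ 2 := fun k => ((hV.measurable_cum' _).pow_const 2).const_mul _
  refine Lp.eLpNorm_le_of_ae_tendsto (u := atTop) (f := fun j ω => ∑ k ∈ Finset.range j,
    discount lam gam (n + 1 + k) * cumWeight V (n + 1 + k) ω ^ 2) (Eventually.of_forall fun j => ?_)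
    (fun j => (Finset.measurable_fun_sum _ fun k _ => hm k).aestronglyMeasurable) ?_
  · have h := eLpNorm_sum_le (s := Finset.range j) (μ := μ) (p := N)
      (fun k _ => (hm k).aestronglyMeasurable) (by exact_mod_cast hN)
    have e : (fun ω => ∑ k ∈ Finset.range j,
        discount lam gam (n + 1 + k) * cumWeight V (n + 1 + k) ω ^ 2) = ∑ k ∈ Finset.range j,
        fun ω => discount lam gam (n + 1 + k) * cumWeight V (n + 1 + k) ω ^ 2 := by
      ext ω; simp
    rw [e]
    exact h.trans ((ENNReal.sum_le_tsum _).trans (hV.sum_eLpNorm_le hs n))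
  · filter_upwards [hV.ae_summable_tail n] with ω hω using hω.hasSum.tendsto_sum_nat

lemma memLp_tailWeight {N : ℕ} (hN : 1 ≤ N) (n : ℕ) : MemLp (tailWeight lam gam V n) N μ :=
  ⟨hV.measurable_tailWeight n, (hV.eLpNorm_tailWeight_le (s := 1 / 2) (by norm_num) hN n).trans_lt
    (ENNReal.mul_lt_top ENNReal.ofReal_lt_top
      ((hV.moderate_pow (k := 2) (by norm_num)).bound N hN (1 / 2) (by norm_num)))⟩

lemma integrable_tailWeight (n : ℕ) : Integrable (tailWeight lam gam V n) μ := by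
  simpa using memLp_one_iff_integrable.1 (by simpa using hV.memLp_tailWeight le_rfl n)

lemma tailWeight_nonneg (n : ℕ) (ω : Ω) : 0 ≤ tailWeight lam gam V n ω :=
  tsum_nonneg fun _ => mul_nonneg (discount_pos _ _ _).le (sq_nonneg _)

lemma summable_integral_tailWeight : Summable fun n => ∫ ω, tailWeight lam gam V n ω ∂μ := by
  set K := ∑' k, ENNReal.ofReal (discount (1 / 2 * lam) gam k) *
    eLpNorm (fun ω => cumWeight V k ω ^ 2) (1 : ℕ) μ with hK
  have hKt : K < ∞ :=
    (hV.moderate_pow (k := 2) (by norm_num)).bound 1 le_rfl (1 / 2) (by norm_num)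
  have h : ∀ n, ∫ ω, tailWeight lam gam V n ω ∂μ ≤ discount (1 / 2 * lam) gam n * K.toReal := by
    intro n
    have h1 := hV.eLpNorm_tailWeight_le (s := 1 / 2) (by norm_num) le_rfl n
    rw [← hK, Nat.cast_one, eLpNorm_one_eq_lintegral_enorm,
      ← ofReal_integral_norm_eq_lintegral_enorm (hV.integrable_tailWeight n)] at h1
    have h2 := ENNReal.toReal_mono (ENNReal.mul_lt_top ENNReal.ofReal_lt_top hKt).ne h1
    rw [ENNReal.toReal_mul, ENNReal.toReal_ofReal (discount_pos _ _ _).le,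
      ENNReal.toReal_ofReal (integral_nonneg fun ω => norm_nonneg _)] at h2
    refine le_trans (le_of_eq ?_) (h2.trans_eq (by norm_num))
    exact integral_congr_ae (ae_of_all _ fun ω =>
      (Real.norm_of_nonneg (hV.tailWeight_nonneg n ω)).symm)
  exact Summable.of_nonneg_of_le (fun n => integral_nonneg (hV.tailWeight_nonneg n)) h
    ((summable_discount (by have := hV.lam_pos; positivity) hV.one_lt_gam).mul_right _)

/-- The basic estimate for one backward step. -/
lemma condExp_step {Γ S : Ω → ℝ} {n : ℕ} (hΓ : AEStronglyMeasurable Γ μ) (hS : Integrable S μ)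
    (hle : ∀ᵐ ω ∂μ, cumWeight V n ω * ((1 + |η n ω|) * |Γ ω|) ≤ S ω) :
    Integrable Γ μ ∧ Integrable (fun ω => η n ω * Γ ω) μ ∧ ∀ᵐ ω ∂μ,
      cumWeight V n ω * (|(μ[Γ | F n]) ω| + |(μ[fun ω => η n ω * Γ ω | F n]) ω|)
        ≤ (μ[S | F n]) ω := by
  have hη := (hV.measurable_eta n).aestronglyMeasurable (μ := μ)
  have hpt : ∀ ω, (1 + |η n ω|) * |Γ ω| ≤ cumWeight V n ω * ((1 + |η n ω|) * |Γ ω|) := fun ω =>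
    le_mul_of_one_le_left (by positivity) (hV.one_le_cum n ω)
  have i1 : Integrable Γ μ := hS.mono' hΓ (by
    filter_upwards [hle] with ω h
    refine le_trans ?_ ((hpt ω).trans h)
    rw [Real.norm_eq_abs, add_mul, one_mul]
    exact le_add_of_nonneg_right (by positivity))
  have i2 : Integrable (fun ω => η n ω * Γ ω) μ := hS.mono' (hη.mul hΓ) (by
    filter_upwards [hle] with ω h
    refine le_trans ?_ ((hpt ω).trans h)
    rw [Real.norm_eq_abs, abs_mul, add_mul, one_mul]
    exact le_add_of_nonneg_left (by positivity))
  refine ⟨i1, i2, ?_⟩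
  set R : Ω → ℝ := fun ω => |Γ ω| + |η n ω * Γ ω| with hR
  have iR : Integrable R μ := i1.abs.add i2.abs
  have i3 : Integrable (cumWeight V n * R) μ := hS.mono'
    ((hV.measurable_cum' n).aestronglyMeasurable.mul iR.1) (by
      filter_upwards [hle] with ω h
      rw [Pi.mul_apply, Real.norm_of_nonneg (mul_nonneg (hV.cum_pos n ω).le (by positivity))]
      refine le_trans (le_of_eq ?_) h
      simp only [hR, abs_mul]; ring)
  have hsum := condExp_add i1.abs i2.abs (F n)
  have hmul := condExp_mul_of_stronglyMeasurable_left (m := F n) (μ := μ)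
    (hV.measurable_cum n).stronglyMeasurable i3 iR
  have hmono := condExp_mono (m := F n) i3 hS (by
    filter_upwards [hle] with ω h
    refine le_trans (le_of_eq ?_) h
    simp only [hR, abs_mul, Pi.mul_apply]; ring)
  filter_upwards [hsum, hmul, hmono, norm_condExp_le (m := F n) (μ := μ) Γ,
    norm_condExp_le (m := F n) (μ := μ) (fun ω => η n ω * Γ ω)] with ω h1 h2 h3 h4 h5
  rw [h2, Pi.mul_apply] at h3
  refine le_trans (mul_le_mul_of_nonneg_left ?_ (hV.cum_pos n ω).le) h3
  have h1' : (μ[R | F n]) ω = (μ[fun ω => |Γ ω| | F n] + μ[fun ω => |η n ω * Γ ω| | F n]) ω := h1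
  rw [h1', Pi.add_apply]
  exact add_le_add h4 h5

end BackwardWeights

end Weights

/-! ### Existence and uniqueness for dominated backward equations -/

/-- Adapted pairs of processes that are integrable against the running products. -/
structure WeightIntegrable {Ω : Type*} [MeasurableSpace Ω] (μ : Measure Ω)
    (F : ℕ → MeasurableSpace Ω) (V : ℕ → Ω → ℝ) (Y Z : ℕ → Ω → ℝ) : Prop where
  measurable_fst : ∀ n, Measurable[F n] (Y n)
  measurable_snd : ∀ n, Measurable[F n] (Z n)
  integrable : ∀ n, Integrable (fun ω => cumWeight V n ω * (|Y n ω| + |Z n ω|)) μ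

section Backward

variable {Ω : Type*} [mΩ : MeasurableSpace Ω] {μ : Measure Ω} [IsProbabilityMeasure μ]
  {F : ℕ → MeasurableSpace Ω} {η V : ℕ → Ω → ℝ} {lam gam c : ℝ} {g : ℕ → Ω → ℝ → ℝ → ℝ}
  {Y Z Y' Z' : ℕ → Ω → ℝ}

lemma WeightIntegrable.sub (hV : BackwardWeights μ F η lam gam V)
    (h : WeightIntegrable μ F V Y Z) (h' : WeightIntegrable μ F V Y' Z') (n : ℕ) :
    Integrable (fun ω => cumWeight V n ω * (|Y n ω - Y' n ω| + |Z n ω - Z' n ω|)) μ := by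
  refine ((h.integrable n).add (h'.integrable n)).mono' ?_ (ae_of_all _ fun ω => ?_)
  · have m1 := ((h.measurable_fst n).sub (h'.measurable_fst n)).mono (hV.le n) le_rfl
    have m2 := ((h.measurable_snd n).sub (h'.measurable_snd n)).mono (hV.le n) le_rfl
    exact ((hV.measurable_cum' n).mul (m1.norm.add m2.norm)).aestronglyMeasurable
  · have := hV.cum_pos n ω
    rw [Real.norm_of_nonneg (by positivity), Pi.add_apply, ← mul_add]
    refine mul_le_mul_of_nonneg_left ?_ this.le
    linarith [abs_sub (Y n ω) (Y' n ω), abs_sub (Z n ω) (Z' n ω)]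

lemma measurable_backwardTerm (hg : DominatedGenerator F η V c g)
    (hY : ∀ n, Measurable[F n] (Y n)) (hZ : ∀ n, Measurable[F n] (Z n)) (n : ℕ) :
    Measurable[F (n + 1)] (backwardTerm lam gam g Y Z n) :=
  ((hY _).add (hg.measurable _ _ _ (hY _) (hZ _))).const_mul _

lemma backwardTerm_sub_le (hV : BackwardWeights μ F η lam gam V)
    (hg : DominatedGenerator F η V c g) (Y Z Y' Z' : ℕ → Ω → ℝ) (n : ℕ) (ω : Ω) :
    cumWeight V n ω * ((1 + |η n ω|) * |backwardTerm lam gam g Y Z n ω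
      - backwardTerm lam gam g Y' Z' n ω|) ≤ discount lam gam (n + 1) *
      (cumWeight V (n + 1) ω * (|Y (n + 1) ω - Y' (n + 1) ω| + |Z (n + 1) ω - Z' (n + 1) ω|)) := by
  have h := hg.lipschitz n ω (Y (n + 1) ω) (Z (n + 1) ω) (Y' (n + 1) ω) (Z' (n + 1) ω)
  have hD := discount_pos lam gam (n + 1)
  have hP := hV.cum_pos n ω
  rw [backwardTerm, backwardTerm, ← mul_sub, abs_mul, abs_of_pos hD, cumWeight_succ]
  calc _ = cumWeight V n ω * discount lam gam (n + 1) * ((1 + |η n ω|) *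
        |Y (n + 1) ω + g (n + 1) ω (Y (n + 1) ω) (Z (n + 1) ω)
          - (Y' (n + 1) ω + g (n + 1) ω (Y' (n + 1) ω) (Z' (n + 1) ω))|) := by ring
    _ ≤ cumWeight V n ω * discount lam gam (n + 1) * (V n ω *
        (|Y (n + 1) ω - Y' (n + 1) ω| + |Z (n + 1) ω - Z' (n + 1) ω|)) := by gcongr
    _ = _ := by ring

lemma backwardTerm_zero_le (hV : BackwardWeights μ F η lam gam V)
    (hg : DominatedGenerator F η V c g) (n : ℕ) (ω : Ω) :
    cumWeight V n ω * ((1 + |η n ω|) * |backwardTerm lam gam g 0 0 n ω|)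
      ≤ c * (discount lam gam (n + 1) * cumWeight V (n + 1) ω ^ 2) := by
  have hD := discount_pos lam gam (n + 1)
  have hP := hV.cum_pos n ω
  simp only [backwardTerm, Pi.zero_apply, zero_add]
  rw [abs_mul, abs_of_pos hD]
  calc _ ≤ cumWeight V n ω * (V n ω * (discount lam gam (n + 1)
        * (c * cumWeight V (n + 1) ω))) := by
        gcongr
        · exact zero_le_one.trans (hV.one_le n ω)
        · exact hV.eta_le n ω
        · exact hg.zero_le (n + 1) ω
    _ = _ := by rw [cumWeight_succ]; ring

lemma backwardTerm_le (hV : BackwardWeights μ F η lam gam V)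
    (hg : DominatedGenerator F η V c g) (Y Z : ℕ → Ω → ℝ) (n : ℕ) (ω : Ω) :
    cumWeight V n ω * ((1 + |η n ω|) * |backwardTerm lam gam g Y Z n ω|)
      ≤ discount lam gam (n + 1) * (cumWeight V (n + 1) ω * (|Y (n + 1) ω| + |Z (n + 1) ω|))
        + c * (discount lam gam (n + 1) * cumWeight V (n + 1) ω ^ 2) := by
  have h1 := backwardTerm_sub_le hV hg Y Z 0 0 n ω
  have h2 := backwardTerm_zero_le hV hg n ω
  simp only [Pi.zero_apply, sub_zero] at h1
  refine le_trans ?_ (add_le_add h1 h2)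
  rw [← mul_add, ← mul_add]
  have := hV.cum_pos n ω
  gcongr
  linarith [abs_sub_abs_le_abs_sub (backwardTerm lam gam g Y Z n ω)
    (backwardTerm lam gam g 0 0 n ω)]

lemma WeightIntegrable.integrable_bound (hV : BackwardWeights μ F η lam gam V)
    (h : WeightIntegrable μ F V Y Z) (c : ℝ) (n : ℕ) : Integrable (fun ω =>
      discount lam gam (n + 1) * (cumWeight V (n + 1) ω * (|Y (n + 1) ω| + |Z (n + 1) ω|))
        + c * (discount lam gam (n + 1) * cumWeight V (n + 1) ω ^ 2)) μ :=
  ((h.integrable (n + 1)).const_mul _).add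
    (((hV.integrable_cum_pow (by norm_num) (n + 1)).const_mul _).const_mul _)

lemma WeightIntegrable.step (hV : BackwardWeights μ F η lam gam V)
    (hg : DominatedGenerator F η V c g) (h : WeightIntegrable μ F V Y Z) (n : ℕ) :
    Integrable (backwardTerm lam gam g Y Z n) μ ∧
    Integrable (fun ω => η n ω * backwardTerm lam gam g Y Z n ω) μ ∧
    Integrable (fun ω => cumWeight V n ω * (|(μ[backwardTerm lam gam g Y Z n | F n]) ω|
      + |(μ[fun ω => η n ω * backwardTerm lam gam g Y Z n ω | F n]) ω|)) μ := by
  have hΓ : AEStronglyMeasurable (backwardTerm lam gam g Y Z n) μ :=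
    ((measurable_backwardTerm hg h.measurable_fst h.measurable_snd n).mono (hV.le _)
      le_rfl).aestronglyMeasurable
  obtain ⟨i1, i2, i3⟩ := hV.condExp_step hΓ (h.integrable_bound hV c n)
    (ae_of_all _ fun ω => backwardTerm_le hV hg Y Z n ω)
  refine ⟨i1, i2, integrable_condExp.mono' (m := mΩ) (g := μ[fun ω =>
      discount lam gam (n + 1) * (cumWeight V (n + 1) ω * (|Y (n + 1) ω| + |Z (n + 1) ω|))
        + c * (discount lam gam (n + 1) * cumWeight V (n + 1) ω ^ 2) | F n]) ?_ ?_⟩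
  · exact (hV.measurable_cum' n).aestronglyMeasurable.mul
      (integrable_condExp.abs.add integrable_condExp.abs).1
  · filter_upwards [i3] with ω hω
    rwa [Real.norm_of_nonneg (mul_nonneg (hV.cum_pos n ω).le (by positivity))]

lemma WeightIntegrable.step_sub (hV : BackwardWeights μ F η lam gam V)
    (hg : DominatedGenerator F η V c g) (h : WeightIntegrable μ F V Y Z)
    (h' : WeightIntegrable μ F V Y' Z') (n : ℕ) : ∀ᵐ ω ∂μ,
    cumWeight V n ω * (|(μ[backwardTerm lam gam g Y Z n | F n]) ω
        - (μ[backwardTerm lam gam g Y' Z' n | F n]) ω|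
      + |(μ[fun ω => η n ω * backwardTerm lam gam g Y Z n ω | F n]) ω
        - (μ[fun ω => η n ω * backwardTerm lam gam g Y' Z' n ω | F n]) ω|)
      ≤ (μ[fun ω => discount lam gam (n + 1) * (cumWeight V (n + 1) ω *
        (|Y (n + 1) ω - Y' (n + 1) ω| + |Z (n + 1) ω - Z' (n + 1) ω|)) | F n]) ω := by
  obtain ⟨i1, i2, -⟩ := h.step hV hg n
  obtain ⟨i1', i2', -⟩ := h'.step hV hg n
  obtain ⟨-, -, i3⟩ := hV.condExp_step (i1.sub i1').1
    ((WeightIntegrable.sub hV h h' (n + 1)).const_mul (discount lam gam (n + 1)))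
    (ae_of_all _ fun ω => backwardTerm_sub_le hV hg Y Z Y' Z' n ω)
  have e : (fun ω => η n ω * (backwardTerm lam gam g Y Z n - backwardTerm lam gam g Y' Z' n) ω)
      = (fun ω => η n ω * backwardTerm lam gam g Y Z n ω)
        - fun ω => η n ω * backwardTerm lam gam g Y' Z' n ω := by
    ext ω; simp [mul_sub]
  rw [e] at i3
  filter_upwards [i3, condExp_sub i1 i1' (F n), condExp_sub i2 i2' (F n)] with ω h1 h2 h3
  rw [h2, h3] at h1
  exact h1

lemma weightIntegrable_zero : WeightIntegrable μ F V 0 0 :=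
  ⟨fun _ => measurable_const, fun _ => measurable_const, fun n => by simp⟩

section Solutions

variable {b θ : ℝ}

lemma IsBackwardSolution.weightIntegrable (hV : BackwardWeights μ F η lam gam V) (hθ : 0 < θ)
    (hb : 1 ≤ b) (h : IsBackwardSolution μ F η b θ lam gam g Y Z) :
    WeightIntegrable μ F V Y Z := by
  refine ⟨h.memY.adapted, h.memZ.adapted, fun n => ?_⟩
  have h1 := hV.moderate_cum.summable_integral_mul h.memY hV.le hθ (by linarith) hV.lam_pos
  have h2 := hV.moderate_cum.summable_integral_mul h.memZ hV.le hθ (by linarith) hV.lam_pos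
  refine ((h1.1 n).abs.add (h2.1 n).abs).congr (ae_of_all _ fun ω => ?_)
  simp only [Pi.add_apply]
  rw [abs_mul, abs_mul, abs_of_pos (hV.cum_pos n ω), mul_add]

/-- Two solutions of a dominated backward equation agree. -/
theorem IsBackwardSolution.ae_eq (hV : BackwardWeights μ F η lam gam V)
    (hg : DominatedGenerator F η V c g) (hθ : 0 < θ) (hb : 1 ≤ b)
    (h : IsBackwardSolution μ F η b θ lam gam g Y Z)
    (h' : IsBackwardSolution μ F η b θ lam gam g Y' Z') (n : ℕ) :
    Y n =ᵐ[μ] Y' n ∧ Z n =ᵐ[μ] Z' n := by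
  have w := h.weightIntegrable hV hθ hb
  have w' := h'.weightIntegrable hV hθ hb
  set A : ℕ → ℝ := fun n => discount lam gam n *
    ∫ ω, cumWeight V n ω * (|Y n ω - Y' n ω| + |Z n ω - Z' n ω|) ∂μ with hA
  have hint := WeightIntegrable.sub hV w w'
  have hmono : Monotone A := by
    refine monotone_nat_of_le_succ fun n => ?_
    have hD := discount_pos lam gam n
    simp only [hA]
    rw [← integral_const_mul, ← integral_const_mul, ← integral_condExp (hV.le n)
      (f := fun ω => discount lam gam (n + 1) * (cumWeight V (n + 1) ω *
        (|Y (n + 1) ω - Y' (n + 1) ω| + |Z (n + 1) ω - Z' (n + 1) ω|)))]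
    refine integral_mono_ae ((hint n).const_mul _) integrable_condExp ?_
    filter_upwards [WeightIntegrable.step_sub hV hg w w' n, h.eqY n, h'.eqY n, h.eqZ n, h'.eqZ n]
      with ω h1 h2 h3 h4 h5
    rw [← h2, ← h3, ← h4, ← h5, ← mul_sub, ← mul_sub, abs_mul, abs_mul, abs_of_pos hD] at h1
    refine le_trans (le_of_eq ?_) h1
    ring
  have hlim : Tendsto A atTop (𝓝 0) := by
    have s1 := (hV.moderate_cum.summable_integral_mul h.memY hV.le hθ (by linarith)
      hV.lam_pos)
    have s2 := (hV.moderate_cum.summable_integral_mul h.memZ hV.le hθ (by linarith)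
      hV.lam_pos)
    have s3 := (hV.moderate_cum.summable_integral_mul h'.memY hV.le hθ (by linarith)
      hV.lam_pos)
    have s4 := (hV.moderate_cum.summable_integral_mul h'.memZ hV.le hθ (by linarith)
      hV.lam_pos)
    have ht := ((s1.2.add s2.2).add (s3.2.add s4.2)).tendsto_atTop_zero
    refine squeeze_zero (fun n => mul_nonneg (discount_pos _ _ _).le
      (integral_nonneg fun ω => mul_nonneg (hV.cum_pos n ω).le (by positivity))) (fun n => ?_) ht
    simp only [hA]
    rw [← mul_add, ← mul_add, ← mul_add]
    refine mul_le_mul_of_nonneg_left ?_ (discount_pos _ _ _).le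
    rw [← integral_add (s1.1 n).abs (s2.1 n).abs, ← integral_add (s3.1 n).abs (s4.1 n).abs]
    refine le_trans ?_
      (integral_add ((s1.1 n).abs.add (s2.1 n).abs) ((s3.1 n).abs.add (s4.1 n).abs)).le
    refine integral_mono (hint n) (((s1.1 n).abs.add (s2.1 n).abs).add
      ((s3.1 n).abs.add (s4.1 n).abs)) fun ω => ?_
    have hP := hV.cum_pos n ω
    simp only [Pi.add_apply, abs_mul, abs_of_pos hP]
    rw [← mul_add, ← mul_add, ← mul_add]
    refine mul_le_mul_of_nonneg_left ?_ hP.le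
    linarith [abs_sub (Y n ω) (Y' n ω), abs_sub (Z n ω) (Z' n ω)]
  have h0 : A n ≤ 0 := hmono.ge_of_tendsto hlim n
  have hnn : ∀ ω, 0 ≤ cumWeight V n ω * (|Y n ω - Y' n ω| + |Z n ω - Z' n ω|) :=
    fun ω => mul_nonneg (hV.cum_pos n ω).le (by positivity)
  have h1 : ∫ ω, cumWeight V n ω * (|Y n ω - Y' n ω| + |Z n ω - Z' n ω|) ∂μ = 0 := by
    refine le_antisymm ?_ (integral_nonneg hnn)
    simp only [hA] at h0
    exact le_of_mul_le_mul_left (by simpa using h0) (discount_pos lam gam n)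
  have h2 := (integral_eq_zero_iff_of_nonneg hnn (hint n)).1 h1
  have h3 : ∀ᵐ ω ∂μ, |Y n ω - Y' n ω| + |Z n ω - Z' n ω| = 0 := by
    filter_upwards [h2] with ω hω
    exact (mul_eq_zero.1 hω).resolve_left (hV.cum_pos n ω).ne'
  constructor <;> filter_upwards [h3] with ω hω
  · have : |Y n ω - Y' n ω| = 0 := by
      linarith [abs_nonneg (Y n ω - Y' n ω), abs_nonneg (Z n ω - Z' n ω)]
    linarith [abs_eq_zero.1 this]
  · have : |Z n ω - Z' n ω| = 0 := by
      linarith [abs_nonneg (Y n ω - Y' n ω), abs_nonneg (Z n ω - Z' n ω)]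
    linarith [abs_eq_zero.1 this]

end Solutions

end Backward

section Picard

variable {Ω : Type*} [mΩ : MeasurableSpace Ω] {μ : Measure Ω} [IsProbabilityMeasure μ]
  {F : ℕ → MeasurableSpace Ω} {η V : ℕ → Ω → ℝ} {lam gam c : ℝ} {g : ℕ → Ω → ℝ → ℝ → ℝ}

/-- Picard iterates of the backward equation, started from zero. -/
def picard {Ω : Type*} [MeasurableSpace Ω] (μ : Measure Ω) (F : ℕ → MeasurableSpace Ω)
    (η : ℕ → Ω → ℝ) (lam gam : ℝ) (g : ℕ → Ω → ℝ → ℝ → ℝ) :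
    ℕ → (ℕ → Ω → ℝ) × (ℕ → Ω → ℝ)
  | 0 => (0, 0)
  | j + 1 =>
    (fun n ω => (μ[backwardTerm lam gam g (picard μ F η lam gam g j).1
        (picard μ F η lam gam g j).2 n | F n]) ω / discount lam gam n,
      fun n ω => (μ[fun ω => η n ω * backwardTerm lam gam g (picard μ F η lam gam g j).1
        (picard μ F η lam gam g j).2 n ω | F n]) ω / discount lam gam n)

lemma picard_succ_fst (j n : ℕ) (ω : Ω) : (picard μ F η lam gam g (j + 1)).1 n ω =
    (μ[backwardTerm lam gam g (picard μ F η lam gam g j).1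
        (picard μ F η lam gam g j).2 n | F n]) ω / discount lam gam n := rfl

lemma picard_succ_snd (j n : ℕ) (ω : Ω) : (picard μ F η lam gam g (j + 1)).2 n ω =
    (μ[fun ω => η n ω * backwardTerm lam gam g (picard μ F η lam gam g j).1
        (picard μ F η lam gam g j).2 n ω | F n]) ω / discount lam gam n := rfl

lemma weightIntegrable_picard (hV : BackwardWeights μ F η lam gam V)
    (hg : DominatedGenerator F η V c g) (j : ℕ) :
    WeightIntegrable μ F V (picard μ F η lam gam g j).1 (picard μ F η lam gam g j).2 := by
  induction j with
  | zero => exact weightIntegrable_zero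
  | succ j ih =>
    refine ⟨fun n => stronglyMeasurable_condExp.measurable.div_const _,
      fun n => stronglyMeasurable_condExp.measurable.div_const _, fun n => ?_⟩
    refine (((ih.step hV hg n).2.2).div_const (discount lam gam n)).congr
      (ae_of_all _ fun ω => ?_)
    simp only [picard]
    rw [abs_div, abs_div, abs_of_pos (discount_pos lam gam n)]
    ring

lemma picard_succ_sub_le (hV : BackwardWeights μ F η lam gam V)
    (hg : DominatedGenerator F η V c g) (j : ℕ) : ∀ n, ∀ᵐ ω ∂μ,
    discount lam gam n * (cumWeight V n ω *
      (|(picard μ F η lam gam g (j + 1)).1 n ω - (picard μ F η lam gam g j).1 n ω|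
        + |(picard μ F η lam gam g (j + 1)).2 n ω - (picard μ F η lam gam g j).2 n ω|))
      ≤ (μ[fun ω => c * (discount lam gam (n + 1 + j) * cumWeight V (n + 1 + j) ω ^ 2) | F n])
        ω := by
  have hU : ∀ n, Integrable
      (fun ω => c * (discount lam gam n * cumWeight V n ω ^ 2)) μ := fun n =>
    ((hV.integrable_cum_pow (by norm_num) n).const_mul _).const_mul _
  induction j with
  | zero =>
    intro n
    have hΓ : AEStronglyMeasurable (backwardTerm lam gam g 0 0 n) μ :=
      ((measurable_backwardTerm hg (fun _ => measurable_const) (fun _ => measurable_const)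
        n).mono (hV.le _) le_rfl).aestronglyMeasurable
    obtain ⟨-, -, h⟩ := hV.condExp_step hΓ (hU (n + 1))
      (ae_of_all _ fun ω => backwardTerm_zero_le hV hg n ω)
    filter_upwards [h] with ω hω
    refine le_trans (le_of_eq ?_) hω
    have hD := discount_pos lam gam n
    simp only [picard, Pi.zero_apply, sub_zero, abs_div, abs_of_pos hD]
    field_simp
  | succ j ih =>
    intro n
    have w := weightIntegrable_picard hV hg j
    have w' := weightIntegrable_picard hV hg (j + 1)
    have hmono := condExp_mono (m := F n)
      ((WeightIntegrable.sub hV w' w (n + 1)).const_mul (discount lam gam (n + 1)))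
      integrable_condExp (ih (n + 1))
    have htower := condExp_condExp_of_le (μ := μ) (hV.mono (Nat.le_succ n)) (hV.le (n + 1))
      (f := fun ω => c * (discount lam gam (n + 1 + 1 + j) * cumWeight V (n + 1 + 1 + j) ω ^ 2))
    filter_upwards [WeightIntegrable.step_sub hV hg w' w n, hmono, htower] with ω h1 h2 h3
    have e : n + 1 + 1 + j = n + 1 + (j + 1) := by omega
    rw [h3] at h2
    simp only [e] at h2
    refine le_trans (le_of_eq ?_) (h1.trans h2)
    have hD := discount_pos lam gam n
    rw [picard_succ_fst (j + 1), picard_succ_fst j, picard_succ_snd (j + 1), picard_succ_snd j]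
    simp only [← sub_div, abs_div, abs_of_pos hD]
    field_simp

lemma ae_summable_picard (hV : BackwardWeights μ F η lam gam V)
    (hg : DominatedGenerator F η V c g) (n : ℕ) : ∀ᵐ ω ∂μ,
    (∀ j, discount lam gam n * (cumWeight V n ω *
      (|(picard μ F η lam gam g j).1 n ω| + |(picard μ F η lam gam g j).2 n ω|))
        ≤ c * (μ[tailWeight lam gam V n | F n]) ω) ∧
    (∃ y, Tendsto (fun j => (picard μ F η lam gam g j).1 n ω) atTop (𝓝 y)) ∧
    (∃ z, Tendsto (fun j => (picard μ F η lam gam g j).2 n ω) atTop (𝓝 z)) := by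
  have hU : ∀ n, Integrable
      (fun ω => c * (discount lam gam n * cumWeight V n ω ^ 2)) μ := fun n =>
    ((hV.integrable_cum_pow (by norm_num) n).const_mul _).const_mul _
  have hmono : ∀ j, ∀ᵐ ω ∂μ, ∑ i ∈ Finset.range j,
      (μ[fun ω => c * (discount lam gam (n + 1 + i) * cumWeight V (n + 1 + i) ω ^ 2) | F n]) ω
        ≤ c * (μ[tailWeight lam gam V n | F n]) ω := by
    intro j
    have h1 := condExp_finsetSum (s := Finset.range j) (fun i _ => hU (n + 1 + i)) (F n)
    have h2 := condExp_mono (m := F n) (μ := μ)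
      (f := ∑ i ∈ Finset.range j,
        fun ω => c * (discount lam gam (n + 1 + i) * cumWeight V (n + 1 + i) ω ^ 2))
      (g := c • tailWeight lam gam V n)
      (integrable_finsetSum' _ fun i _ => hU (n + 1 + i)) ((hV.integrable_tailWeight n).smul c) (by
        filter_upwards [hV.ae_summable_tail n] with ω hω
        simp only [Finset.sum_apply, Pi.smul_apply, smul_eq_mul, ← Finset.mul_sum]
        refine mul_le_mul_of_nonneg_left ?_ hg.nonneg
        exact hω.sum_le_tsum _ fun k _ => mul_nonneg (discount_pos _ _ _).le (sq_nonneg _))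
    have h3 := condExp_smul (μ := μ) c (tailWeight lam gam V n) (F n)
    filter_upwards [h1, h2, h3] with ω a1 a2 a3
    rw [a1, a3] at a2
    simpa using a2
  filter_upwards [ae_all_iff.2 hmono, ae_all_iff.2 fun j => picard_succ_sub_le hV hg j n]
    with ω h1 h2
  set y := fun j => (picard μ F η lam gam g j).1 n ω with hy
  set z := fun j => (picard μ F η lam gam g j).2 n ω with hz
  set d := fun j => |y (j + 1) - y j| + |z (j + 1) - z j| with hd
  have hy0 : y 0 = 0 := rfl
  have hz0 : z 0 = 0 := rfl
  have hD := discount_pos lam gam n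
  have hP := hV.cum_pos n ω
  have hpart : ∀ j, discount lam gam n * (cumWeight V n ω * ∑ i ∈ Finset.range j, d i)
      ≤ c * (μ[tailWeight lam gam V n | F n]) ω := fun j => by
    rw [Finset.mul_sum, Finset.mul_sum]
    exact (Finset.sum_le_sum fun i _ => h2 i).trans (h1 j)
  have hdn : ∀ j, 0 ≤ d j := fun j => by positivity
  have hsum : Summable d := by
    refine summable_of_sum_range_le (c := c * (μ[tailWeight lam gam V n | F n]) ω
      / (discount lam gam n * cumWeight V n ω)) hdn fun j => ?_
    rw [le_div_iff₀ (by positivity), mul_comm, mul_assoc]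
    exact hpart j
  have htel : ∀ x : ℕ → ℝ, x 0 = 0 → ∀ j, x j = ∑ i ∈ Finset.range j, (x (i + 1) - x i) :=
    fun x hx j => by rw [Finset.sum_range_sub, hx, sub_zero]
  have hconv : ∀ x : ℕ → ℝ, x 0 = 0 → (∀ j, |x (j + 1) - x j| ≤ d j) →
      ∃ l, Tendsto x atTop (𝓝 l) := by
    intro x hx hxd
    have hs : Summable fun j => x (j + 1) - x j := Summable.of_norm_bounded hsum hxd
    refine ⟨_, hs.hasSum.tendsto_sum_nat.congr fun j => (htel x hx j).symm⟩
  refine ⟨fun j => ?_, hconv y hy0 fun j => le_add_of_nonneg_right (abs_nonneg _),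
    hconv z hz0 fun j => le_add_of_nonneg_left (abs_nonneg _)⟩
  refine le_trans ?_ (hpart j)
  refine mul_le_mul_of_nonneg_left (mul_le_mul_of_nonneg_left ?_ hP.le) hD.le
  change |y j| + |z j| ≤ _
  rw [htel y hy0 j, htel z hz0 j, hd, Finset.sum_add_distrib]
  exact add_le_add (Finset.abs_sum_le_sum_abs _ _) (Finset.abs_sum_le_sum_abs _ _)

lemma memLHat_of_le_tailWeight (hV : BackwardWeights μ F η lam gam V) {θ β : ℝ} (hθ : 0 < θ)
    (hθ' : 0 < deltaLim θ) (hβ : 0 ≤ β) {Y : ℕ → Ω → ℝ} (hY : ∀ n, Measurable[F n] (Y n))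
    (hb : ∀ n, ∀ᵐ ω ∂μ, discount lam gam n * |Y n ω| ≤ c * (μ[tailWeight lam gam V n | F n]) ω) :
    MemLHat μ F β θ lam gam Y := by
  refine memLHat_of_eLpNorm_le hY hθ hθ' hβ hV.lam_pos hV.one_lt_gam fun N hN s hs0 hs1 => ?_
  set K := ∑' k, ENNReal.ofReal (discount (s * lam) gam k) *
    eLpNorm (fun ω => cumWeight V k ω ^ 2) N μ with hK
  have hKt : K < ∞ := (hV.moderate_pow (k := 2) (by norm_num)).bound N hN s hs0
  refine ⟨ENNReal.ofReal |c| * K, ENNReal.mul_ne_top ENNReal.ofReal_ne_top hKt.ne, fun n => ?_⟩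
  have hD := discount_pos lam gam n
  have h1 : eLpNorm (Y n) N μ ≤ eLpNorm
      ((c / discount lam gam n) • μ[tailWeight lam gam V n | F n]) N μ := by
    refine eLpNorm_mono_ae ?_
    filter_upwards [hb n] with ω hω
    rw [Pi.smul_apply, smul_eq_mul, Real.norm_eq_abs, Real.norm_eq_abs, abs_mul, abs_div,
      abs_of_pos hD]
    rw [mul_comm, ← le_div_iff₀ hD] at hω
    refine hω.trans (le_of_abs_le (le_of_eq ?_))
    rw [abs_div, abs_mul, abs_of_pos hD]
    ring
  refine h1.trans ?_
  rw [eLpNorm_const_smul]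
  have h2 := (eLpNorm_condExp_le_eLpNorm (m := F n) (μ := μ) (tailWeight lam gam V n)
    (p := N) (by exact_mod_cast hN)).trans (hV.eLpNorm_tailWeight_le hs1 hN n)
  calc _ ≤ ‖c / discount lam gam n‖ₑ * (ENNReal.ofReal (discount ((1 - s) * lam) gam n) * K) := by
        gcongr
    _ = _ := by
        have e1 : ‖c / discount lam gam n‖ₑ
            = ENNReal.ofReal |c| * ENNReal.ofReal (discount (-lam) gam n) := by
          rw [← ENNReal.ofReal_mul (abs_nonneg _), ← ofReal_norm, Real.norm_eq_abs, abs_div,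
            abs_of_pos hD, div_eq_mul_inv, discount, discount, ← Real.exp_neg]
          congr 3; ring
        have e2 : discount (-s * lam) gam n
            = discount (-lam) gam n * discount ((1 - s) * lam) gam n := by
          rw [← discount_add]; congr 1; ring
        rw [e1, e2, ENNReal.ofReal_mul (discount_pos _ _ _).le]
        ring

end Picard

section Existence

variable {Ω : Type*} [mΩ : MeasurableSpace Ω] {μ : Measure Ω} [IsProbabilityMeasure μ]
  {F : ℕ → MeasurableSpace Ω} {η V : ℕ → Ω → ℝ} {lam gam c : ℝ} {g : ℕ → Ω → ℝ → ℝ → ℝ}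

/-- A limit of conditional expectations under domination. -/
lemma condExp_limit {m : MeasurableSpace Ω} (hm : m ≤ mΩ) {y : ℕ → Ω → ℝ} {Γ : ℕ → Ω → ℝ}
    {y' Γ' A B : Ω → ℝ} (hy' : Measurable[m] y') (hA : Integrable A μ) (hB : Integrable B μ)
    (hΓm : ∀ j, Integrable (Γ j) μ) (hy : ∀ j, y j =ᵐ[μ] μ[Γ j | m])
    (hyA : ∀ j, ∀ᵐ ω ∂μ, |y j ω| ≤ A ω) (hΓB : ∀ j, ∀ᵐ ω ∂μ, |Γ j ω| ≤ B ω)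
    (hyl : ∀ᵐ ω ∂μ, Tendsto (fun j => y j ω) atTop (𝓝 (y' ω)))
    (hΓl : ∀ᵐ ω ∂μ, Tendsto (fun j => Γ j ω) atTop (𝓝 (Γ' ω))) : y' =ᵐ[μ] μ[Γ' | m] := by
  have hyi : ∀ j, Integrable (y j) μ := fun j => integrable_condExp.congr (hy j).symm
  have h := tendsto_condExp_unique (m := m) y Γ y' Γ' hyi hΓm hyl hΓl A hA B hB hyA hΓB
    (fun j => (condExp_congr_ae (hy j)).trans (condExp_condExp_of_le le_rfl hm))
  have hb : ∀ᵐ ω ∂μ, ‖y' ω‖ ≤ A ω := by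
    filter_upwards [hyl, ae_all_iff.2 hyA] with ω h1 h2
    exact le_of_tendsto' h1.abs h2
  have hi : Integrable y' μ := hA.mono' (hy'.mono hm le_rfl).aestronglyMeasurable hb
  rwa [condExp_of_stronglyMeasurable hm hy'.stronglyMeasurable hi] at h

/-- A dominated backward equation has a solution, which obeys the a priori bound. -/
theorem exists_isBackwardSolution (hV : BackwardWeights μ F η lam gam V)
    (hg : DominatedGenerator F η V c g) {b θ : ℝ} (hθ : 0 < θ) (hθ' : 0 < deltaLim θ)
    (hb : 0 ≤ b) : ∃ Y Z : ℕ → Ω → ℝ, IsBackwardSolution μ F η b θ lam gam g Y Z ∧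
      ∀ n, ∀ᵐ ω ∂μ, discount lam gam n * (cumWeight V n ω * (|Y n ω| + |Z n ω|))
        ≤ c * (μ[tailWeight lam gam V n | F n]) ω := by
  set P := picard μ F η lam gam g with hP
  let Y : ℕ → Ω → ℝ := fun n ω => limsup (fun j => (P j).1 n ω) atTop
  let Z : ℕ → Ω → ℝ := fun n ω => limsup (fun j => (P j).2 n ω) atTop
  have hw := weightIntegrable_picard hV hg
  have hYm : ∀ n, Measurable[F n] (Y n) := fun n =>
    Measurable.limsup fun j => (hw j).measurable_fst n
  have hZm : ∀ n, Measurable[F n] (Z n) := fun n =>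
    Measurable.limsup fun j => (hw j).measurable_snd n
  have hYl : ∀ n, ∀ᵐ ω ∂μ, Tendsto (fun j => (P j).1 n ω) atTop (𝓝 (Y n ω)) := fun n => by
    filter_upwards [ae_summable_picard hV hg n] with ω ⟨_, ⟨y, hy⟩, _⟩
    change Tendsto _ _ (𝓝 (limsup _ _))
    rwa [hy.limsup_eq]
  have hZl : ∀ n, ∀ᵐ ω ∂μ, Tendsto (fun j => (P j).2 n ω) atTop (𝓝 (Z n ω)) := fun n => by
    filter_upwards [ae_summable_picard hV hg n] with ω ⟨_, _, ⟨y, hy⟩⟩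
    change Tendsto _ _ (𝓝 (limsup _ _))
    rwa [hy.limsup_eq]
  have hbd : ∀ n, ∀ᵐ ω ∂μ, discount lam gam n * (cumWeight V n ω * (|Y n ω| + |Z n ω|))
        ≤ c * (μ[tailWeight lam gam V n | F n]) ω := fun n => by
    filter_upwards [ae_summable_picard hV hg n, hYl n, hZl n] with ω ⟨h1, _, _⟩ h2 h3
    exact le_of_tendsto' (((h2.abs.add h3.abs).const_mul _).const_mul _) h1
  have hweak : ∀ n ω (y z : ℝ), |y| ≤ cumWeight V n ω * (|y| + |z|) ∧
      |z| ≤ cumWeight V n ω * (|y| + |z|) := fun n ω y z => by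
    have := hV.one_le_cum n ω
    constructor <;> nlinarith [abs_nonneg y, abs_nonneg z]
  have hYL : MemLHat μ F (2 * b) θ lam gam Y :=
    memLHat_of_le_tailWeight hV hθ hθ' (by positivity) hYm fun n => by
      filter_upwards [hbd n] with ω h
      exact (mul_le_mul_of_nonneg_left (hweak n ω (Y n ω) (Z n ω)).1
        (discount_pos _ _ _).le).trans h
  have hZL : MemLHat μ F (2 * b) θ lam gam Z :=
    memLHat_of_le_tailWeight hV hθ hθ' (by positivity) hZm fun n => by
      filter_upwards [hbd n] with ω h
      exact (mul_le_mul_of_nonneg_left (hweak n ω (Y n ω) (Z n ω)).2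
        (discount_pos _ _ _).le).trans h
  have hBi : ∀ n, Integrable (fun ω => c * (μ[tailWeight lam gam V n | F n]) ω) μ := fun n =>
    integrable_condExp.const_mul c
  have hGi : ∀ n, Integrable (fun ω => c * (μ[tailWeight lam gam V (n + 1) | F (n + 1)]) ω
      + c * (discount lam gam (n + 1) * cumWeight V (n + 1) ω ^ 2)) μ := fun n =>
    (hBi (n + 1)).add
      (((hV.integrable_cum_pow (by norm_num) (n + 1)).const_mul _).const_mul _)
  have hΓb : ∀ n j, ∀ᵐ ω ∂μ,
      (1 + |η n ω|) * |backwardTerm lam gam g (P j).1 (P j).2 n ω|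
        ≤ c * (μ[tailWeight lam gam V (n + 1) | F (n + 1)]) ω
          + c * (discount lam gam (n + 1) * cumWeight V (n + 1) ω ^ 2) := fun n j => by
    filter_upwards [ae_summable_picard hV hg (n + 1)] with ω ⟨h1, _, _⟩
    refine le_trans ?_ ((backwardTerm_le hV hg (P j).1 (P j).2 n ω).trans
      (add_le_add_left (h1 j) _))
    exact le_mul_of_one_le_left (by positivity) (hV.one_le_cum n ω)
  have hΓl : ∀ n, ∀ᵐ ω ∂μ, Tendsto (fun j => backwardTerm lam gam g (P j).1 (P j).2 n ω) atTop
      (𝓝 (backwardTerm lam gam g Y Z n ω)) := fun n => by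
    filter_upwards [hYl (n + 1), hZl (n + 1)] with ω h1 h2
    rw [tendsto_iff_norm_sub_tendsto_zero]
    have h3 : Tendsto (fun j => discount lam gam (n + 1) * (cumWeight V (n + 1) ω *
        (|(P j).1 (n + 1) ω - Y (n + 1) ω| + |(P j).2 (n + 1) ω - Z (n + 1) ω|))) atTop
        (𝓝 0) := by
      have := ((((h1.sub_const (Y (n + 1) ω)).abs.add (h2.sub_const (Z (n + 1) ω)).abs).const_mul
        (cumWeight V (n + 1) ω)).const_mul (discount lam gam (n + 1)))
      simpa using this
    refine squeeze_zero (fun j => norm_nonneg _) (fun j => ?_) h3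
    refine le_trans ?_ (backwardTerm_sub_le hV hg (P j).1 (P j).2 Y Z n ω)
    rw [Real.norm_eq_abs]
    refine le_trans ?_ (le_mul_of_one_le_left (by positivity) (hV.one_le_cum n ω))
    exact le_mul_of_one_le_left (abs_nonneg _) (le_add_of_nonneg_right (abs_nonneg _))
  refine ⟨Y, Z, ⟨hYL, hZL, fun n => ?_, fun n => ?_, ?_⟩, hbd⟩
  · refine condExp_limit (hV.le n) (y := fun j ω => discount lam gam n * (P (j + 1)).1 n ω)
      (Γ := fun j => backwardTerm lam gam g (P j).1 (P j).2 n) ((hYm n).const_mul _) (hBi n)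
      (hGi n) (fun j => ((hw j).step hV hg n).1) (fun j => ae_of_all _ fun ω => ?_) (fun j => ?_)
      (fun j => ?_) ?_ (hΓl n)
    · have := (discount_pos lam gam n).ne'
      simp only [hP, picard_succ_fst]
      field_simp
    · filter_upwards [ae_summable_picard hV hg n] with ω ⟨h1, _, _⟩
      refine le_trans ?_ (h1 (j + 1))
      rw [abs_mul, abs_of_pos (discount_pos _ _ _)]
      exact mul_le_mul_of_nonneg_left (hweak n ω _ _).1 (discount_pos _ _ _).le
    · filter_upwards [hΓb n j] with ω h
      exact (le_mul_of_one_le_left (abs_nonneg _)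
        (le_add_of_nonneg_right (abs_nonneg _))).trans h
    · filter_upwards [hYl n] with ω h
      exact ((tendsto_add_atTop_iff_nat 1).2 h).const_mul _
  · refine condExp_limit (hV.le n) (y := fun j ω => discount lam gam n * (P (j + 1)).2 n ω)
      (Γ := fun j ω => η n ω * backwardTerm lam gam g (P j).1 (P j).2 n ω)
      ((hZm n).const_mul _) (hBi n)
      (hGi n) (fun j => ((hw j).step hV hg n).2.1) (fun j => ae_of_all _ fun ω => ?_)
      (fun j => ?_) (fun j => ?_) ?_ ?_
    · have := (discount_pos lam gam n).ne'
      simp only [hP, picard_succ_snd]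
      field_simp
    · filter_upwards [ae_summable_picard hV hg n] with ω ⟨h1, _, _⟩
      refine le_trans ?_ (h1 (j + 1))
      rw [abs_mul, abs_of_pos (discount_pos _ _ _)]
      exact mul_le_mul_of_nonneg_left (hweak n ω _ _).2 (discount_pos _ _ _).le
    · filter_upwards [hΓb n j] with ω h
      rw [abs_mul]
      refine le_trans (mul_le_mul_of_nonneg_right ?_ (abs_nonneg _)) h
      exact le_add_of_nonneg_left zero_le_one
    · filter_upwards [hZl n] with ω h
      exact ((tendsto_add_atTop_iff_nat 1).2 h).const_mul _
    · filter_upwards [hΓl n] with ω h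
      exact h.const_mul _
  · exact ENNReal.tendsto_atTop_zero_of_tsum_ne_top hYL.finite.ne

end Existence

/-! ### Measurability and differentiability of random coefficients -/

section Caratheodory

variable {Ω : Type*} [MeasurableSpace Ω]

lemma measurable_comp_of_continuous {E : Type*} [TopologicalSpace E] [MeasurableSpace E]
    [BorelSpace E] [SecondCountableTopology E] [TopologicalSpace.MetrizableSpace E]
    {φ : E → Ω → ℝ} (hc : ∀ ω, Continuous fun e => φ e ω) (hm : ∀ e, Measurable (φ e))
    {e : Ω → E} (he : Measurable e) : Measurable fun ω => φ (e ω) ω :=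
  (measurable_uncurry_of_continuous_of_measurable hc hm).comp (he.prodMk measurable_id)

lemma measurable_deriv_of_measurable_comp {φ : Ω → ℝ → ℝ} {x : Ω → ℝ}
    (hd : ∀ ω, DifferentiableAt ℝ (φ ω) (x ω)) (hm : ∀ t : ℝ, Measurable fun ω => φ ω (x ω + t)) :
    Measurable fun ω => deriv (φ ω) (x ω) := by
  have ht : Tendsto (fun n : ℕ => 1 / ((n : ℝ) + 1)) atTop (𝓝[≠] 0) := by
    refine tendsto_nhdsWithin_iff.2 ⟨tendsto_one_div_add_atTop_nhds_zero_nat,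
      Eventually.of_forall fun n => ?_⟩
    have : (0 : ℝ) < 1 / ((n : ℝ) + 1) := by positivity
    exact this.ne'
  refine measurable_of_tendsto_metrizable (f := fun (n : ℕ) ω =>
    (1 / ((n : ℝ) + 1))⁻¹ • (φ ω (x ω + 1 / ((n : ℝ) + 1)) - φ ω (x ω))) (fun n => ?_) ?_
  · have h0 := hm 0
    simp only [add_zero] at h0
    exact ((hm _).sub h0).const_smul (1 / ((n : ℝ) + 1))⁻¹
  · rw [tendsto_pi_nhds]
    exact fun ω => (hasDerivAt_iff_tendsto_slope_zero.1 (hd ω).hasDerivAt).comp ht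

end Caratheodory

section Expansion

/-- First order expansion along a sequence approaching at rate `ε`. -/
lemma tendsto_expansion {E : Type*} [NormedAddCommGroup E] [NormedSpace ℝ E] {f : E → ℝ} {p : E}
    (hf : DifferentiableAt ℝ f p) {q : ℕ → E} {ε : ℕ → ℝ} (hε : ∀ j, 0 < ε j)
    (hε0 : Tendsto ε atTop (𝓝 0)) {C : ℝ} (hq : ∀ j, ‖q j‖ ≤ C * ε j) :
    Tendsto (fun j => (f (p + q j) - f p - fderiv ℝ f p (q j)) / ε j) atTop (𝓝 0) := by
  have hq0 : Tendsto (fun j => p + q j) atTop (𝓝 p) := by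
    have h1 : Tendsto q atTop (𝓝 0) :=
      squeeze_zero_norm hq (by simpa using hε0.const_mul C)
    simpa using h1.const_add p
  have h1 := hf.hasFDerivAt.isLittleO.comp_tendsto hq0
  have h2 : ((fun x' => x' - p) ∘ fun j => p + q j) =O[atTop] ε :=
    Asymptotics.IsBigO.of_bound C (Eventually.of_forall fun j => by
      simpa [abs_of_pos (hε j)] using hq j)
  have h3 := (h1.trans_isBigO h2).tendsto_div_nhds_zero
  simpa [Function.comp_def] using h3

lemma tendsto_expansion_two {f : ℝ → ℝ → ℝ} (hf : Differentiable ℝ fun v : ℝ × ℝ => f v.1 v.2)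
    {x u : ℝ} {dx du ε : ℕ → ℝ} {h : ℝ} (hε : ∀ j, 0 < ε j) (hε0 : Tendsto ε atTop (𝓝 0)) {C : ℝ}
    (hdx : ∀ j, |dx j| ≤ C * ε j) (hdu : ∀ j, du j = ε j * h) :
    Tendsto (fun j => (f (x + dx j) (u + du j) - f x u
      - deriv (fun x => f x u) x * dx j) / ε j) atTop (𝓝 (deriv (fun u => f x u) u * h)) := by
  have hd : DifferentiableAt ℝ (fun v : ℝ × ℝ => f v.1 v.2) (x, u) := hf (x, u)
  have h1 := tendsto_expansion hd (q := fun j => (dx j, du j)) hε hε0 (C := max C |h|) fun j => by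
    rw [Prod.norm_def]
    refine max_le ((hdx j).trans ?_) ?_
    · exact mul_le_mul_of_nonneg_right (le_max_left _ _) (hε j).le
    · simp only [hdu, norm_mul, Real.norm_eq_abs, abs_of_pos (hε j)]
      rw [mul_comm]
      exact mul_le_mul_of_nonneg_right (le_max_right _ _) (hε j).le
  have e1 : deriv (fun x => f x u) x = fderiv ℝ (fun v : ℝ × ℝ => f v.1 v.2) (x, u) (1, 0) :=
    (hd.hasFDerivAt.comp_hasDerivAt (f := fun x => (x, u)) x
      ((hasDerivAt_id' x).prodMk (hasDerivAt_const x u))).deriv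
  have e2 : deriv (fun u => f x u) u = fderiv ℝ (fun v : ℝ × ℝ => f v.1 v.2) (x, u) (0, 1) :=
    (hd.hasFDerivAt.comp_hasDerivAt (f := fun u => (x, u)) u
      ((hasDerivAt_const u x).prodMk (hasDerivAt_id' u))).deriv
  have e3 : ∀ j, fderiv ℝ (fun v : ℝ × ℝ => f v.1 v.2) (x, u) (dx j, du j)
      = deriv (fun x => f x u) x * dx j + deriv (fun u => f x u) u * du j := by
    intro j
    rw [e1, e2, show ((dx j, du j) : ℝ × ℝ) = dx j • ((1, 0) : ℝ × ℝ) + du j • ((0, 1) : ℝ × ℝ) by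
      simp, map_add, map_smul, map_smul, smul_eq_mul, smul_eq_mul]
    ring
  have h2 := h1.add_const (deriv (fun u => f x u) u * h)
  rw [zero_add] at h2
  refine h2.congr fun j => ?_
  rw [e3, hdu]
  have := (hε j).ne'
  simp only [Prod.mk_add_mk]
  field_simp
  ring

lemma tendsto_expansion_four {f : ℝ → ℝ → ℝ → ℝ → ℝ}
    (hf : Differentiable ℝ fun v : ℝ × ℝ × ℝ × ℝ => f v.1 v.2.1 v.2.2.1 v.2.2.2)
    {x y z u : ℝ} {dx dy dz du ε : ℕ → ℝ} {h : ℝ} (hε : ∀ j, 0 < ε j)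
    (hε0 : Tendsto ε atTop (𝓝 0)) {C : ℝ}
    (hdx : ∀ j, |dx j| ≤ C * ε j) (hdy : ∀ j, |dy j| ≤ C * ε j) (hdz : ∀ j, |dz j| ≤ C * ε j)
    (hdu : ∀ j, du j = ε j * h) :
    Tendsto (fun j => (f (x + dx j) (y + dy j) (z + dz j) (u + du j) - f x y z u
      - deriv (fun x => f x y z u) x * dx j - deriv (fun y => f x y z u) y * dy j
      - deriv (fun z => f x y z u) z * dz j) / ε j) atTop
      (𝓝 (deriv (fun u => f x y z u) u * h)) := by
  have hd : DifferentiableAt ℝ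
    (fun v : ℝ × ℝ × ℝ × ℝ => f v.1 v.2.1 v.2.2.1 v.2.2.2) (x, y, z, u) := hf _
  set D := fderiv ℝ (fun v : ℝ × ℝ × ℝ × ℝ => f v.1 v.2.1 v.2.2.1 v.2.2.2) (x, y, z, u) with hD
  have hCle : ∀ j, C * ε j ≤ max C |h| * ε j := fun j =>
    mul_le_mul_of_nonneg_right (le_max_left _ _) (hε j).le
  have h1 := tendsto_expansion hd (q := fun j => (dx j, dy j, dz j, du j)) hε hε0
    (C := max C |h|) fun j => by
    simp only [Prod.norm_def, Real.norm_eq_abs]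
    refine max_le ((hdx j).trans (hCle j)) (max_le ((hdy j).trans (hCle j))
      (max_le ((hdz j).trans (hCle j)) ?_))
    rw [hdu, abs_mul, abs_of_pos (hε j), mul_comm]
    exact mul_le_mul_of_nonneg_right (le_max_right _ _) (hε j).le
  have e1 : deriv (fun x => f x y z u) x = D (1, 0, 0, 0) :=
    (hd.hasFDerivAt.comp_hasDerivAt (f := fun x => (x, y, z, u)) x ((hasDerivAt_id' x).prodMk
      (hasDerivAt_const x (y, z, u)))).deriv
  have e2 : deriv (fun y => f x y z u) y = D (0, 1, 0, 0) :=
    (hd.hasFDerivAt.comp_hasDerivAt (f := fun y => (x, y, z, u)) y ((hasDerivAt_const y x).prodMk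
      ((hasDerivAt_id' y).prodMk (hasDerivAt_const y (z, u))))).deriv
  have e3 : deriv (fun z => f x y z u) z = D (0, 0, 1, 0) :=
    (hd.hasFDerivAt.comp_hasDerivAt (f := fun z => (x, y, z, u)) z ((hasDerivAt_const z x).prodMk
      ((hasDerivAt_const z y).prodMk ((hasDerivAt_id' z).prodMk (hasDerivAt_const z u))))).deriv
  have e4 : deriv (fun u => f x y z u) u = D (0, 0, 0, 1) :=
    (hd.hasFDerivAt.comp_hasDerivAt (f := fun u => (x, y, z, u)) u ((hasDerivAt_const u x).prodMk
      ((hasDerivAt_const u y).prodMk ((hasDerivAt_const u z).prodMk (hasDerivAt_id' u))))).deriv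
  have e5 : ∀ j, D (dx j, dy j, dz j, du j)
      = deriv (fun x => f x y z u) x * dx j + deriv (fun y => f x y z u) y * dy j
        + deriv (fun z => f x y z u) z * dz j + deriv (fun u => f x y z u) u * du j := by
    intro j
    rw [e1, e2, e3, e4, show ((dx j, dy j, dz j, du j) : ℝ × ℝ × ℝ × ℝ)
      = dx j • ((1, 0, 0, 0) : ℝ × ℝ × ℝ × ℝ) + dy j • ((0, 1, 0, 0) : ℝ × ℝ × ℝ × ℝ)
        + dz j • ((0, 0, 1, 0) : ℝ × ℝ × ℝ × ℝ) + du j • ((0, 0, 0, 1) : ℝ × ℝ × ℝ × ℝ) by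
      simp]
    simp only [map_add, map_smul, smul_eq_mul]
    ring
  have h2 := h1.add_const (deriv (fun u => f x y z u) u * h)
  rw [zero_add] at h2
  refine h2.congr fun j => ?_
  rw [← hD, e5, hdu]
  have := (hε j).ne'
  simp only [Prod.mk_add_mk]
  field_simp
  ring

end Expansion

/-! ### The control system: weights, measurability and bounds -/

namespace ControlSystem

/-- The coefficients are Lipschitz with constant `L`. -/
structure IsLipschitz {Ω : Type*} (S : ControlSystem Ω) (L : ℝ) : Prop where
  pos : 0 < L
  forward : ∀ n ω x₁ x₂ u₁ u₂, |S.drift n ω x₁ u₁ - S.drift n ω x₂ u₂|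
      + |S.diff n ω x₁ u₁ - S.diff n ω x₂ u₂| ≤ L * (|x₁ - x₂| + |u₁ - u₂|)
  gen : ∀ n ω x₁ x₂ y₁ y₂ z₁ z₂ u₁ u₂, |S.gen n ω x₁ y₁ z₁ u₁ - S.gen n ω x₂ y₂ z₂ u₂|
      ≤ L * (|x₁ - x₂| + |y₁ - y₂| + |z₁ - z₂| + |u₁ - u₂|)

/-- Weights that dominate one step of all the equations of the control problem. -/
def weight {Ω : Type*} (S : ControlSystem Ω) (L : ℝ) (n : ℕ) (ω : Ω) : ℝ :=
  (1 + 2 * L) * (1 + |S.eta n ω|) * (1 + |S.xi n ω|) * (1 + |noisePred S.H S.xi (n + 1) ω|)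

section Bounds

variable {Ω : Type*} {S : ControlSystem Ω} {L : ℝ}

lemma le_weight (hL : 0 < L) (n : ℕ) (ω : Ω) :
    (1 + 2 * L) * (1 + |S.eta n ω|) ≤ S.weight L n ω ∧
    (1 + 2 * L) * (1 + |S.xi n ω|) ≤ S.weight L n ω ∧
    (1 + 2 * L) * (1 + |S.eta n ω|) * (1 + |noisePred S.H S.xi (n + 1) ω|) ≤ S.weight L n ω := by
  have h1 : 1 ≤ 1 + |S.eta n ω| := le_add_of_nonneg_right (abs_nonneg _)
  have h2 : 1 ≤ 1 + |S.xi n ω| := le_add_of_nonneg_right (abs_nonneg _)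
  have h3 : 1 ≤ 1 + |noisePred S.H S.xi (n + 1) ω| := le_add_of_nonneg_right (abs_nonneg _)
  rw [weight]
  set A := 1 + |S.eta n ω|
  set B := 1 + |S.xi n ω|
  set C := 1 + |noisePred S.H S.xi (n + 1) ω|
  have hD : 0 < 1 + 2 * L := by positivity
  have hA : 0 < A := by linarith
  have hB : 0 < B := by linarith
  have hC : 0 < C := by linarith
  refine ⟨?_, ?_, ?_⟩
  · calc (1 + 2 * L) * A = (1 + 2 * L) * A * 1 * 1 := by ring
      _ ≤ _ := by gcongr
  · calc (1 + 2 * L) * B = (1 + 2 * L) * 1 * B * 1 := by ring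
      _ ≤ _ := by gcongr
  · calc (1 + 2 * L) * A * C = (1 + 2 * L) * A * 1 * C := by ring
      _ ≤ _ := by gcongr

lemma one_le_weight (hL : 0 < L) (n : ℕ) (ω : Ω) : 1 ≤ S.weight L n ω := by
  refine le_trans ?_ (le_weight hL n ω).1
  nlinarith [abs_nonneg (S.eta n ω)]

lemma abs_noisePred_le_cumWeight (hL : 0 < L) (n : ℕ) (ω : Ω) :
    1 + |noisePred S.H S.xi n ω| ≤ cumWeight (S.weight L) n ω := by
  rcases n with _ | n
  · simp [noisePred]
  · rw [cumWeight_succ]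
    have h1 := one_le_cumWeight (one_le_weight (S := S) hL) n ω
    have h2 := (le_weight (S := S) hL n ω).2.2
    have h3 : (1 : ℝ) ≤ (1 + 2 * L) * (1 + |S.eta n ω|) := by
      nlinarith [abs_nonneg (S.eta n ω)]
    have h4 : 1 + |noisePred S.H S.xi (n + 1) ω| ≤ S.weight L n ω :=
      (le_mul_of_one_le_left (by positivity) h3).trans h2
    exact h4.trans (le_mul_of_one_le_left (by linarith [one_le_weight (S := S) hL n ω]) h1)

lemma abs_deriv_le {f : ℝ → ℝ} {x C : ℝ} (hC : 0 ≤ C) (h : ∀ y, |f y - f x| ≤ C * |y - x|) :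
    |deriv f x| ≤ C := by
  rw [← Real.norm_eq_abs]
  exact norm_deriv_le_of_lip' hC (Eventually.of_forall h)

variable (hL : S.IsLipschitz L) (u Y Z : ℕ → Ω → ℝ) (n : ℕ) (ω : Ω)
include hL

lemma IsLipschitz.driftX_le : |S.driftX u n ω| ≤ L :=
  abs_deriv_le hL.pos.le fun y => by
    have := hL.forward n ω y (S.state u n ω) (u n ω) (u n ω)
    simp only [sub_self, abs_zero, add_zero] at this
    linarith [abs_nonneg (S.diff n ω y (u n ω) - S.diff n ω (S.state u n ω) (u n ω))]

lemma IsLipschitz.diffX_le : |S.diffX u n ω| ≤ L :=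
  abs_deriv_le hL.pos.le fun y => by
    have := hL.forward n ω y (S.state u n ω) (u n ω) (u n ω)
    simp only [sub_self, abs_zero, add_zero] at this
    linarith [abs_nonneg (S.drift n ω y (u n ω) - S.drift n ω (S.state u n ω) (u n ω))]

lemma IsLipschitz.driftU_le : |S.driftU u n ω| ≤ L :=
  abs_deriv_le hL.pos.le fun y => by
    have := hL.forward n ω (S.state u n ω) (S.state u n ω) y (u n ω)
    simp only [sub_self, abs_zero, zero_add] at this
    linarith [abs_nonneg (S.diff n ω (S.state u n ω) y - S.diff n ω (S.state u n ω) (u n ω))]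

lemma IsLipschitz.diffU_le : |S.diffU u n ω| ≤ L :=
  abs_deriv_le hL.pos.le fun y => by
    have := hL.forward n ω (S.state u n ω) (S.state u n ω) y (u n ω)
    simp only [sub_self, abs_zero, zero_add] at this
    linarith [abs_nonneg (S.drift n ω (S.state u n ω) y - S.drift n ω (S.state u n ω) (u n ω))]

lemma IsLipschitz.genX_le : |S.genX u Y Z n ω| ≤ L :=
  abs_deriv_le hL.pos.le fun y => by
    simpa using hL.gen n ω y (S.state u n ω) (Y n ω) (Y n ω) (Z n ω) (Z n ω) (u n ω) (u n ω)

lemma IsLipschitz.genY_le : |S.genY u Y Z n ω| ≤ L :=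
  abs_deriv_le hL.pos.le fun y => by
    simpa using hL.gen n ω (S.state u n ω) (S.state u n ω) y (Y n ω) (Z n ω) (Z n ω) (u n ω) (u n ω)

lemma IsLipschitz.genZ_le : |S.genZ u Y Z n ω| ≤ L :=
  abs_deriv_le hL.pos.le fun y => by
    simpa using hL.gen n ω (S.state u n ω) (S.state u n ω) (Y n ω) (Y n ω) y (Z n ω) (u n ω) (u n ω)

lemma IsLipschitz.genU_le : |S.genU u Y Z n ω| ≤ L :=
  abs_deriv_le hL.pos.le fun y => by
    simpa using hL.gen n ω (S.state u n ω) (S.state u n ω) (Y n ω) (Y n ω) (Z n ω) (Z n ω) y (u n ω)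

lemma IsLipschitz.adjK_le : |S.adjK u Y Z n ω| ≤ cumWeight (S.weight L) n ω := by
  have h1 := one_le_cumWeight (one_le_weight (S := S) hL.pos)
  rcases n with _ | n
  · simp [adjK]
  · induction n with
    | zero => simpa [adjK] using h1 1 ω
    | succ n ih =>
      rw [adjK, cumWeight_succ]
      beta_reduce
      set k := S.adjK u Y Z (n + 1) ω
      have e : k + S.genY u Y Z (n + 1) ω * k + S.genZ u Y Z (n + 1) ω * k * S.eta (n + 1) ω
          = k * (1 + S.genY u Y Z (n + 1) ω + S.genZ u Y Z (n + 1) ω * S.eta (n + 1) ω) := by ring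
      rw [e, abs_mul]
      refine mul_le_mul ih (le_trans ?_ (le_weight (S := S) hL.pos (n + 1) ω).1) (abs_nonneg _)
        (by linarith [h1 (n + 1) ω])
      refine (abs_add_three _ _ _).trans ?_
      rw [abs_one, abs_mul]
      have a1 := hL.genY_le u Y Z (n + 1) ω
      have a2 := mul_le_mul_of_nonneg_right (hL.genZ_le u Y Z (n + 1) ω)
        (abs_nonneg (S.eta (n + 1) ω))
      have := hL.pos
      nlinarith [abs_nonneg (S.eta (n + 1) ω)]

end Bounds

section Adapted

variable {Ω : Type*}

lemma filt_mono (S : ControlSystem Ω) : Monotone S.filt := noiseFiltration_mono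

lemma measurable_xi (S : ControlSystem Ω) (n : ℕ) : Measurable[S.filt (n + 1)] (S.xi n) :=
  measurable_noise_noiseFiltration n.lt_succ_self

lemma measurable_eta (S : ControlSystem Ω) (n : ℕ) : Measurable[S.filt (n + 1)] (S.eta n) :=
  measurable_whiteNoise_noiseFiltration n

lemma measurable_noisePred (S : ControlSystem Ω) (n : ℕ) :
    Measurable[S.filt n] (noisePred S.H S.xi n) :=
  measurable_noisePred_noiseFiltration n

lemma measurable_weight (S : ControlSystem Ω) (L : ℝ) (n : ℕ) :
    Measurable[S.filt (n + 1)] (S.weight L n) := by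
  let _ : MeasurableSpace Ω := S.filt (n + 1)
  have h1 : Measurable (S.eta n) := S.measurable_eta n
  have h2 : Measurable (S.xi n) := S.measurable_xi n
  have h3 : Measurable (noisePred S.H S.xi (n + 1)) := S.measurable_noisePred (n + 1)
  exact (((h1.norm.const_add 1).const_mul (1 + 2 * L)).mul (h2.norm.const_add 1)).mul
    (h3.norm.const_add 1)

end Adapted

section Setting

variable {Ω : Type*} [mΩ : MeasurableSpace Ω] {μ : Measure Ω} [IsProbabilityMeasure μ]
  {S : ControlSystem Ω} {L : ℝ} {u Y Z : ℕ → Ω → ℝ}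

lemma Standing.isNoise (hS : S.Standing μ) : IsNoise μ S.H S.xi := hS.fbm.isNoise

lemma Standing.filt_le (hS : S.Standing μ) (n : ℕ) : S.filt n ≤ mΩ :=
  noiseFiltration_le hS.F₀_le hS.isNoise.measurable n

lemma Standing.polyMoments_weight (hS : S.Standing μ) (L : ℝ) : PolyMoments μ (S.weight L) := by
  have h1 := hS.isNoise.polyMoments_whiteNoise.abs
  have h2 := (hS.isNoise.polyMoments_noise hS.hurst_pos).abs
  have h3 := (hS.isNoise.polyMoments_noisePred hS.hurst_pos).shift.abs
  have c := PolyMoments.const (μ := μ)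
  exact (((c (1 + 2 * L)).mul ((c 1).add h1)).mul ((c 1).add h2)).mul ((c 1).add h3)

lemma Standing.backwardWeights (hS : S.Standing μ) (h₁ : S.IntegrabilityCondition μ)
    (hL : 0 < L) : BackwardWeights μ S.filt S.eta S.lam S.gam (S.weight L) where
  lam_pos := h₁.lam_pos
  one_lt_gam := h₁.one_lt_gam
  le := hS.filt_le
  mono := S.filt_mono
  measurable_eta := hS.isNoise.measurable_whiteNoise
  measurable := S.measurable_weight L
  eta_le n ω := le_trans (by nlinarith [abs_nonneg (S.eta n ω)]) (le_weight hL n ω).1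
  moderate := by
    have hV := hS.polyMoments_weight L
    have h := ((hV.mul hV).mul (hV.mul hV)).moderate_cumWeight h₁.lam_pos h₁.one_lt_gam
    refine h.mono (fun n => ?_) fun n => ae_of_all _ fun ω => ?_
    · exact (Finset.aestronglyMeasurable_fun_prod _ fun j _ => hV.aesm j).pow 4
    · refine le_of_eq (congrArg _ ?_)
      rw [cumWeight_mul (fun j ω => S.weight L j ω * S.weight L j ω)
        (fun j ω => S.weight L j ω * S.weight L j ω), cumWeight_mul]
      ring

lemma measurable_drift (hS : S.Standing μ) (h₁ : S.IntegrabilityCondition μ) (n : ℕ)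
    {x r : Ω → ℝ} (hx : Measurable[S.filt n] x) (hr : Measurable[S.filt n] r) :
    Measurable[S.filt n] fun ω => S.drift n ω (x ω) (r ω) :=
  @measurable_comp_of_continuous Ω (S.filt n) (ℝ × ℝ) _ _ _ _ _
    (fun v ω => S.drift n ω v.1 v.2) (fun ω => (hS.drift_differentiable n ω).continuous)
    (fun v => (h₁.drift_mem v.1 v.2).adapted n) _ (hx.prodMk hr)

lemma measurable_diff (hS : S.Standing μ) (h₁ : S.IntegrabilityCondition μ) (n : ℕ)
    {x r : Ω → ℝ} (hx : Measurable[S.filt n] x) (hr : Measurable[S.filt n] r) :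
    Measurable[S.filt n] fun ω => S.diff n ω (x ω) (r ω) :=
  @measurable_comp_of_continuous Ω (S.filt n) (ℝ × ℝ) _ _ _ _ _
    (fun v ω => S.diff n ω v.1 v.2) (fun ω => (hS.diff_differentiable n ω).continuous)
    (fun v => (h₁.diff_mem v.1 v.2).adapted n) _ (hx.prodMk hr)

lemma measurable_gen (hS : S.Standing μ) (h₁ : S.IntegrabilityCondition μ) (n : ℕ)
    {x y z r : Ω → ℝ} (hx : Measurable[S.filt n] x) (hy : Measurable[S.filt n] y)
    (hz : Measurable[S.filt n] z) (hr : Measurable[S.filt n] r) :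
    Measurable[S.filt n] fun ω => S.gen n ω (x ω) (y ω) (z ω) (r ω) :=
  @measurable_comp_of_continuous Ω (S.filt n) (ℝ × ℝ × ℝ × ℝ) _ _ _ _ _
    (fun v ω => S.gen n ω v.1 v.2.1 v.2.2.1 v.2.2.2)
    (fun ω => (hS.gen_differentiable n ω).continuous)
    (fun v => (h₁.gen_mem v.1 v.2.1 v.2.2.1 v.2.2.2).adapted n) _
    (hx.prodMk (hy.prodMk (hz.prodMk hr)))

lemma measurable_state (hS : S.Standing μ) (h₁ : S.IntegrabilityCondition μ)
    (hu : ∀ n, Measurable[S.filt n] (u n)) (n : ℕ) : Measurable[S.filt n] (S.state u n) := by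
  induction n with
  | zero => exact hS.x₀_measurable.mono le_sup_left le_rfl
  | succ n ih =>
    have hm := S.filt_mono n.le_succ
    exact ((ih.mono hm le_rfl).add ((measurable_drift hS h₁ n ih (hu n)).mono hm le_rfl)).add
      (((measurable_diff hS h₁ n ih (hu n)).mono hm le_rfl).mul (S.measurable_xi n))

section Derivatives

variable (hS : S.Standing μ) (h₁ : S.IntegrabilityCondition μ)
  (hu : ∀ n, Measurable[S.filt n] (u n)) (hY : ∀ n, Measurable[S.filt n] (Y n))
  (hZ : ∀ n, Measurable[S.filt n] (Z n)) (n : ℕ)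
include hS h₁ hu

lemma measurable_driftX : Measurable[S.filt n] (S.driftX u n) :=
  have hX := measurable_state hS h₁ hu
  @measurable_deriv_of_measurable_comp Ω (S.filt n) (fun ω x => S.drift n ω x (u n ω)) _
    (fun ω => ((hS.drift_differentiable n ω).comp
      (differentiable_id.prodMk (differentiable_const (u n ω)))).differentiableAt)
    fun t => measurable_drift hS h₁ n ((hX n).add_const t) (hu n)

lemma measurable_driftU : Measurable[S.filt n] (S.driftU u n) :=
  have hX := measurable_state hS h₁ hu
  @measurable_deriv_of_measurable_comp Ω (S.filt n) (fun ω r => S.drift n ω (S.state u n ω) r) _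
    (fun ω => ((hS.drift_differentiable n ω).comp
      ((differentiable_const (S.state u n ω)).prodMk differentiable_id)).differentiableAt)
    fun t => measurable_drift hS h₁ n (hX n) ((hu n).add_const t)

lemma measurable_diffX : Measurable[S.filt n] (S.diffX u n) :=
  have hX := measurable_state hS h₁ hu
  @measurable_deriv_of_measurable_comp Ω (S.filt n) (fun ω x => S.diff n ω x (u n ω)) _
    (fun ω => ((hS.diff_differentiable n ω).comp
      (differentiable_id.prodMk (differentiable_const (u n ω)))).differentiableAt)
    fun t => measurable_diff hS h₁ n ((hX n).add_const t) (hu n)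

lemma measurable_diffU : Measurable[S.filt n] (S.diffU u n) :=
  have hX := measurable_state hS h₁ hu
  @measurable_deriv_of_measurable_comp Ω (S.filt n) (fun ω r => S.diff n ω (S.state u n ω) r) _
    (fun ω => ((hS.diff_differentiable n ω).comp
      ((differentiable_const (S.state u n ω)).prodMk differentiable_id)).differentiableAt)
    fun t => measurable_diff hS h₁ n (hX n) ((hu n).add_const t)

include hY hZ

lemma measurable_genX : Measurable[S.filt n] (S.genX u Y Z n) :=
  have hX := measurable_state hS h₁ hu
  @measurable_deriv_of_measurable_comp Ω (S.filt n)
    (fun ω x => S.gen n ω x (Y n ω) (Z n ω) (u n ω)) _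
    (fun ω => ((hS.gen_differentiable n ω).comp
      (differentiable_id.prodMk (differentiable_const (Y n ω, Z n ω, u n ω)))).differentiableAt)
    fun t => measurable_gen hS h₁ n ((hX n).add_const t) (hY n) (hZ n) (hu n)

lemma measurable_genY : Measurable[S.filt n] (S.genY u Y Z n) :=
  have hX := measurable_state hS h₁ hu
  @measurable_deriv_of_measurable_comp Ω (S.filt n)
    (fun ω y => S.gen n ω (S.state u n ω) y (Z n ω) (u n ω)) _
    (fun ω => ((hS.gen_differentiable n ω).comp
      ((differentiable_const (S.state u n ω)).prodMk (differentiable_id.prodMk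
        (differentiable_const (Z n ω, u n ω))))).differentiableAt)
    fun t => measurable_gen hS h₁ n (hX n) ((hY n).add_const t) (hZ n) (hu n)

lemma measurable_genZ : Measurable[S.filt n] (S.genZ u Y Z n) :=
  have hX := measurable_state hS h₁ hu
  @measurable_deriv_of_measurable_comp Ω (S.filt n)
    (fun ω z => S.gen n ω (S.state u n ω) (Y n ω) z (u n ω)) _
    (fun ω => ((hS.gen_differentiable n ω).comp
      ((differentiable_const (S.state u n ω)).prodMk ((differentiable_const (Y n ω)).prodMk
        (differentiable_id.prodMk (differentiable_const (u n ω)))))).differentiableAt)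
    fun t => measurable_gen hS h₁ n (hX n) (hY n) ((hZ n).add_const t) (hu n)

lemma measurable_genU : Measurable[S.filt n] (S.genU u Y Z n) :=
  have hX := measurable_state hS h₁ hu
  @measurable_deriv_of_measurable_comp Ω (S.filt n)
    (fun ω r => S.gen n ω (S.state u n ω) (Y n ω) (Z n ω) r) _
    (fun ω => ((hS.gen_differentiable n ω).comp
      ((differentiable_const (S.state u n ω)).prodMk ((differentiable_const (Y n ω)).prodMk
        ((differentiable_const (Z n ω)).prodMk differentiable_id)))).differentiableAt)
    fun t => measurable_gen hS h₁ n (hX n) (hY n) (hZ n) ((hu n).add_const t)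

lemma measurable_adjK : Measurable[S.filt n] (S.adjK u Y Z n) := by
  rcases n with _ | n
  · exact measurable_const
  · induction n with
    | zero => exact measurable_const
    | succ n ih =>
      have hm := S.filt_mono (n + 1).le_succ
      have hy := (measurable_genY hS h₁ hu hY hZ (n + 1)).mono hm le_rfl
      have hz := (measurable_genZ hS h₁ hu hY hZ (n + 1)).mono hm le_rfl
      have hk := ih.mono hm le_rfl
      exact (hk.add (hy.mul hk)).add ((hz.mul hk).mul (S.measurable_eta (n + 1)))

end Derivatives

end Setting

end ControlSystem

/-! ### Sums of backward solutions -/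

section Add

variable {Ω : Type*} [mΩ : MeasurableSpace Ω] {μ : Measure Ω} [IsProbabilityMeasure μ]
  {F : ℕ → MeasurableSpace Ω} {η : ℕ → Ω → ℝ} {b β θ lam gam : ℝ} {Y Z Y' Z' : ℕ → Ω → ℝ}

lemma enorm_add_rpow_le (x y : ℝ) {p : ℝ} (hp : 0 ≤ p) :
    ‖x + y‖ₑ ^ p ≤ 2 ^ p * (‖x‖ₑ ^ p + ‖y‖ₑ ^ p) := by
  have h1 : ‖x + y‖ₑ ≤ 2 * max ‖x‖ₑ ‖y‖ₑ := by
    rw [two_mul]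
    exact (enorm_add_le x y).trans (add_le_add (le_max_left _ _) (le_max_right _ _))
  calc ‖x + y‖ₑ ^ p ≤ (2 * max ‖x‖ₑ ‖y‖ₑ) ^ p := by gcongr
    _ = 2 ^ p * max ‖x‖ₑ ‖y‖ₑ ^ p := ENNReal.mul_rpow_of_nonneg _ _ hp
    _ ≤ _ := by
      gcongr
      rcases max_cases ‖x‖ₑ ‖y‖ₑ with ⟨h, _⟩ | ⟨h, _⟩ <;> rw [h]
      · exact le_self_add
      · exact le_add_self

lemma MemLHat.add (hF : ∀ n, F n ≤ mΩ) (hθ : 0 < θ) (hθ' : 0 < deltaLim θ) (hβ : 0 ≤ β)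
    (h : MemLHat μ F β θ lam gam Y) (h' : MemLHat μ F β θ lam gam Y') :
    MemLHat μ F β θ lam gam fun n ω => Y n ω + Y' n ω := by
  refine ⟨fun n => (h.adapted n).add (h'.adapted n), ?_⟩
  have key : ∀ n, weightedMoment μ lam gam n (β / deltaProd θ n) (fun ω => Y n ω + Y' n ω)
      ≤ 2 ^ (β / deltaLim θ) * (weightedMoment μ lam gam n (β / deltaProd θ n) (Y n)
        + weightedMoment μ lam gam n (β / deltaProd θ n) (Y' n)) := by
    intro n
    have hp : 0 ≤ β / deltaProd θ n := div_nonneg hβ (deltaProd_pos hθ n).le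
    have hpP : β / deltaProd θ n ≤ β / deltaLim θ :=
      div_le_div_of_nonneg_left hβ hθ' (deltaLim_lt_deltaProd hθ n).le
    have hm : Measurable fun ω => ‖Y n ω‖ₑ ^ (β / deltaProd θ n) :=
      ((h.adapted n).mono (hF n) le_rfl).enorm.pow_const _
    simp only [weightedMoment]
    rw [← mul_add, ← lintegral_add_left hm, mul_left_comm]
    gcongr
    rw [← lintegral_const_mul' _ _ (by finiteness)]
    refine lintegral_mono fun ω => (enorm_add_rpow_le _ _ hp).trans ?_
    gcongr
    norm_num
  refine (ENNReal.tsum_le_tsum key).trans_lt ?_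
  rw [ENNReal.tsum_mul_left, ENNReal.tsum_add]
  exact ENNReal.mul_lt_top (by finiteness) (ENNReal.add_lt_top.2 ⟨h.finite, h'.finite⟩)

/-- Adding to a solution a solution of the equation for the increments. -/
lemma IsBackwardSolution.add {g g' G : ℕ → Ω → ℝ → ℝ → ℝ} (hF : ∀ n, F n ≤ mΩ) (hθ : 0 < θ)
    (hθ' : 0 < deltaLim θ) (hb : 0 ≤ b)
    (h : IsBackwardSolution μ F η b θ lam gam g Y Z)
    (h' : IsBackwardSolution μ F η b θ lam gam G Y' Z')
    (hG : ∀ n ω y z, G n ω y z = g' n ω (Y n ω + y) (Z n ω + z) - g n ω (Y n ω) (Z n ω))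
    (hi : ∀ n, Integrable (backwardTerm lam gam g Y Z n) μ)
    (hi2 : ∀ n, Integrable (fun ω => η n ω * backwardTerm lam gam g Y Z n ω) μ)
    (hi' : ∀ n, Integrable (backwardTerm lam gam G Y' Z' n) μ)
    (hi2' : ∀ n, Integrable (fun ω => η n ω * backwardTerm lam gam G Y' Z' n ω) μ) :
    IsBackwardSolution μ F η b θ lam gam g' (fun n ω => Y n ω + Y' n ω)
      (fun n ω => Z n ω + Z' n ω) := by
  have e : ∀ n, backwardTerm lam gam g' (fun n ω => Y n ω + Y' n ω) (fun n ω => Z n ω + Z' n ω) n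
      = backwardTerm lam gam g Y Z n + backwardTerm lam gam G Y' Z' n := by
    intro n
    ext ω
    simp only [backwardTerm, Pi.add_apply, hG]
    ring
  have hY := h.memY.add hF hθ hθ' (by positivity) h'.memY
  refine ⟨hY, h.memZ.add hF hθ hθ' (by positivity) h'.memZ, fun n => ?_, fun n => ?_,
    ENNReal.tendsto_atTop_zero_of_tsum_ne_top hY.finite.ne⟩
  · rw [e]
    filter_upwards [condExp_add (hi n) (hi' n) (F n), h.eqY n, h'.eqY n] with ω h1 h2 h3
    rw [h1, Pi.add_apply, ← h2, ← h3]
    ring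
  · have e2 : (fun ω => η n ω * backwardTerm lam gam g' (fun n ω => Y n ω + Y' n ω)
        (fun n ω => Z n ω + Z' n ω) n ω) = (fun ω => η n ω * backwardTerm lam gam g Y Z n ω)
          + fun ω => η n ω * backwardTerm lam gam G Y' Z' n ω := by
      ext ω
      rw [e]
      simp only [Pi.add_apply]
      ring
    rw [e2]
    filter_upwards [condExp_add (hi2 n) (hi2' n) (F n), h.eqZ n, h'.eqZ n] with ω h1 h2 h3
    rw [h1, Pi.add_apply, ← h2, ← h3]
    ring

/-- Almost surely equal generators have the same solutions. -/
lemma IsBackwardSolution.congr {g g' : ℕ → Ω → ℝ → ℝ → ℝ}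
    (h : IsBackwardSolution μ F η b θ lam gam g Y Z)
    (hg : ∀ n, ∀ᵐ ω ∂μ, ∀ y z, g n ω y z = g' n ω y z) :
    IsBackwardSolution μ F η b θ lam gam g' Y Z := by
  have e : ∀ n, backwardTerm lam gam g Y Z n =ᵐ[μ] backwardTerm lam gam g' Y Z n := fun n => by
    filter_upwards [hg (n + 1)] with ω hω
    rw [backwardTerm, backwardTerm, hω]
  refine ⟨h.memY, h.memZ, fun n => (h.eqY n).trans (condExp_congr_ae (e n)),
    fun n => (h.eqZ n).trans (condExp_congr_ae ?_), h.terminal⟩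
  filter_upwards [e n] with ω hω
  rw [hω]

end Add

/-! ### Integrability along a trajectory -/

section Below

variable {Ω : Type*} [mΩ : MeasurableSpace Ω] {μ : Measure Ω} [IsProbabilityMeasure μ] {R : ℝ}

/-- Integrability to every power below `R`. -/
def MemLpBelow (μ : Measure Ω) (R : ℝ) (f : Ω → ℝ) : Prop :=
  ∀ r : ℝ, 0 < r → r < R → MemLp f (ENNReal.ofReal r) μ

lemma MemLpBelow.add {f g : Ω → ℝ} (hf : MemLpBelow μ R f) (hg : MemLpBelow μ R g) :
    MemLpBelow μ R fun ω => f ω + g ω := fun r h0 h1 => (hf r h0 h1).add (hg r h0 h1)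

lemma MemLpBelow.const_mul {f : Ω → ℝ} (hf : MemLpBelow μ R f) (c : ℝ) :
    MemLpBelow μ R fun ω => c * f ω := fun r h0 h1 => (hf r h0 h1).const_mul c

lemma MemLpBelow.abs {f : Ω → ℝ} (hf : MemLpBelow μ R f) :
    MemLpBelow μ R fun ω => |f ω| := fun r h0 h1 => (hf r h0 h1).abs

lemma MemLpBelow.mono {f g : Ω → ℝ} (hf : MemLpBelow μ R f) (hg : Measurable g)
    (h : ∀ ω, |g ω| ≤ |f ω|) : MemLpBelow μ R g := fun r h0 h1 =>
  (hf r h0 h1).mono hg.aestronglyMeasurable (ae_of_all _ h)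

lemma memLpBelow_of_le {f : Ω → ℝ} {p : ℝ} (hp : R ≤ p) (hf : MemLp f (ENNReal.ofReal p) μ) :
    MemLpBelow μ R f := fun _ _ h1 =>
  hf.mono_exponent (ENNReal.ofReal_le_ofReal (h1.le.trans hp))

lemma MemLpBelow.mul {f g : Ω → ℝ} (hf : MemLpBelow μ R f)
    (hg : ∀ p : ℝ≥0∞, p ≠ ∞ → MemLp g p μ) : MemLpBelow μ R fun ω => f ω * g ω := by
  intro r h0 h1
  obtain ⟨s, hs, hsR⟩ := exists_between h1
  have hs0 : 0 < s := h0.trans hs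
  have hd : 0 < r * s / (s - r) := div_pos (mul_pos h0 hs0) (by linarith)
  have : ENNReal.HolderTriple (ENNReal.ofReal s) (ENNReal.ofReal (r * s / (s - r)))
      (ENNReal.ofReal r) := by
    constructor
    rw [← ENNReal.ofReal_inv_of_pos hs0, ← ENNReal.ofReal_inv_of_pos hd,
      ← ENNReal.ofReal_inv_of_pos h0, ← ENNReal.ofReal_add (by positivity) (by positivity)]
    congr 1
    have : s - r ≠ 0 := by linarith
    field_simp
    ring
  exact (hg (ENNReal.ofReal (r * s / (s - r))) ENNReal.ofReal_ne_top).mul (hf s hs0 hsR)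

lemma MemLpBelow.memLp_two {f : Ω → ℝ} (hf : MemLpBelow μ R f) (hR : 2 < R) : MemLp f 2 μ := by
  simpa using hf 2 two_pos hR

end Below

namespace ControlSystem

section Trajectory

variable {Ω : Type*} [mΩ : MeasurableSpace Ω] {μ : Measure Ω} [IsProbabilityMeasure μ]
  {S : ControlSystem Ω} {L : ℝ} {u Y Z : ℕ → Ω → ℝ}

lemma IntegrabilityCondition.theta_pos (h₁ : S.IntegrabilityCondition μ) : 0 < S.theta :=
  one_pos.trans h₁.one_lt_theta

lemma IntegrabilityCondition.deltaLim_pos (h₁ : S.IntegrabilityCondition μ) :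
    0 < deltaLim S.theta := by
  refine lt_of_le_of_ne (deltaLim_nonneg h₁.theta_pos) fun h => ?_
  have h2 := h₁.one_le_b.trans h₁.b_le
  rw [← h] at h2
  norm_num at h2

lemma IntegrabilityCondition.a_pos (h₁ : S.IntegrabilityCondition μ) : 0 < S.a := by
  have h2 := h₁.one_le_b.trans h₁.b_le
  by_contra hc
  nlinarith [sq_nonneg (deltaLim S.theta)]

lemma IntegrabilityCondition.two_lt (h₁ : S.IntegrabilityCondition μ) :
    2 < 2 * S.a * deltaLim S.theta := by
  have h2 := h₁.one_le_b.trans h₁.b_le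
  have h3 : deltaLim S.theta < 1 :=
    (deltaLim_lt_deltaProd h₁.theta_pos 0).trans_le (deltaProd_le_one h₁.theta_pos 0)
  nlinarith [h₁.deltaLim_pos, h₁.a_pos, mul_pos h₁.a_pos h₁.deltaLim_pos]

lemma IntegrabilityCondition.memLpBelow (h₁ : S.IntegrabilityCondition μ) (hS : S.Standing μ)
    {X : ℕ → Ω → ℝ} (hX : MemL μ S.filt (2 * S.a) S.theta S.lam S.gam X) (n : ℕ) :
    MemLpBelow μ (2 * S.a * deltaLim S.theta) (X n) := by
  have ha := h₁.a_pos
  have hd := deltaProd_pos h₁.theta_pos n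
  have h := (ENNReal.le_tsum (f := fun n => weightedMoment μ S.lam S.gam n
    (2 * S.a * deltaProd S.theta n) (X n)) n).trans_lt hX.finite
  refine memLpBelow_of_le (p := 2 * S.a * deltaProd S.theta n) ?_
    (memLp_of_lintegral_rpow ((hX.adapted n).mono (hS.filt_le n) le_rfl).aestronglyMeasurable
      (by positivity) (lintegral_rpow_lt_top_of_weightedMoment h))
  exact mul_le_mul_of_nonneg_left (deltaLim_lt_deltaProd h₁.theta_pos n).le (by positivity)

lemma memLpBelow_state (hS : S.Standing μ) (h₁ : S.IntegrabilityCondition μ)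
    (hL : S.IsLipschitz L) (hu : S.Admissible μ u) (n : ℕ) :
    MemLpBelow μ (2 * S.a * deltaLim S.theta) (S.state u n) := by
  have hXm := fun n => (measurable_state hS h₁ hu.mem.adapted n).mono (hS.filt_le n) le_rfl
  induction n with
  | zero =>
    have ha := h₁.a_pos
    refine memLpBelow_of_le (p := 2 * S.a) ?_ (memLp_of_lintegral_rpow
      (hXm 0).aestronglyMeasurable (by positivity) hS.x₀_moment)
    have h3 : deltaLim S.theta < 1 :=
      (deltaLim_lt_deltaProd h₁.theta_pos 0).trans_le (deltaProd_le_one h₁.theta_pos 0)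
    nlinarith
  | succ n ih =>
    have hb := h₁.memLpBelow hS (h₁.drift_mem 0 0) n
    have hs := h₁.memLpBelow hS (h₁.diff_mem 0 0) n
    have hun := h₁.memLpBelow hS hu.mem n
    have hξ : ∀ p : ℝ≥0∞, p ≠ ∞ → MemLp (S.xi n) p μ := fun p hp =>
      (hS.isNoise.polyMoments_noise hS.hurst_pos).memLp n hp
    have hA := (ih.abs.add hun.abs).const_mul L
    refine (ih.abs.add ((hb.abs.add hA).add (((hs.abs.add hA).mul hξ).abs))).mono (hXm _)
      fun ω => ?_
    have h := hL.forward n ω (S.state u n ω) 0 (u n ω) 0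
    simp only [sub_zero] at h
    set A := L * (|S.state u n ω| + |u n ω|)
    have h1 : |S.drift n ω (S.state u n ω) (u n ω)| ≤ |S.drift n ω 0 0| + A := by
      have := abs_sub_abs_le_abs_sub (S.drift n ω (S.state u n ω) (u n ω)) (S.drift n ω 0 0)
      linarith [abs_nonneg (S.diff n ω (S.state u n ω) (u n ω) - S.diff n ω 0 0)]
    have h2 : |S.diff n ω (S.state u n ω) (u n ω)| ≤ |S.diff n ω 0 0| + A := by
      have := abs_sub_abs_le_abs_sub (S.diff n ω (S.state u n ω) (u n ω)) (S.diff n ω 0 0)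
      linarith [abs_nonneg (S.drift n ω (S.state u n ω) (u n ω) - S.drift n ω 0 0)]
    have hA0 : 0 ≤ A := by have := hL.pos; positivity
    rw [state, abs_mul, abs_of_nonneg (a := |S.diff n ω 0 0| + A) (by positivity),
      abs_of_nonneg (a := |S.state u n ω| + _) (by positivity)]
    refine (abs_add_three _ _ _).trans ?_
    rw [abs_mul, add_assoc]
    gcongr

/-- The backward term of the cost equation is square integrable. -/
lemma IsCostSolution.memLp_backwardTerm (hS : S.Standing μ) (h₁ : S.IntegrabilityCondition μ)
    (hL : S.IsLipschitz L) (hu : S.Admissible μ u) (h : S.IsCostSolution μ u Y Z) (n : ℕ) :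
    MemLp (backwardTerm S.lam S.gam
      (fun n ω y z => S.gen n ω (S.state u n ω) y z (u n ω)) Y Z n) 2 μ := by
  have hb : 2 ≤ 2 * S.b := by linarith [h₁.one_le_b]
  have hX := (memLpBelow_state hS h₁ hL hu (n + 1)).memLp_two h₁.two_lt
  have hun := (h₁.memLpBelow hS hu.mem (n + 1)).memLp_two h₁.two_lt
  have hYn := h.memY.memLp_two hS.filt_le h₁.theta_pos hb h₁.lam_pos (n + 1)
  have hZn := h.memZ.memLp_two hS.filt_le h₁.theta_pos hb h₁.lam_pos (n + 1)
  have hg := (h₁.gen_mem 0 0 0 0).memLp_two hS.filt_le h₁.theta_pos hb h₁.lam_pos (n + 1)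
  have hm : Measurable[S.filt (n + 1)] fun ω =>
      S.gen (n + 1) ω (S.state u (n + 1) ω) (Y (n + 1) ω) (Z (n + 1) ω) (u (n + 1) ω) :=
    measurable_gen hS h₁ (n + 1) (measurable_state hS h₁ hu.mem.adapted _) (h.memY.adapted _)
      (h.memZ.adapted _) (hu.mem.adapted _)
  refine (hYn.add (MemLp.mono (hg.abs.add ((((hX.abs.add hYn.abs).add hZn.abs).add
    hun.abs).const_mul L)) (hm.mono (hS.filt_le _) le_rfl).aestronglyMeasurable
    (ae_of_all _ fun ω => ?_))).const_mul _
  have h2 := hL.gen (n + 1) ω (S.state u (n + 1) ω) 0 (Y (n + 1) ω) 0 (Z (n + 1) ω) 0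
    (u (n + 1) ω) 0
  simp only [sub_zero] at h2
  refine le_trans ?_ (le_abs_self _)
  have := abs_sub_abs_le_abs_sub (S.gen (n + 1) ω (S.state u (n + 1) ω) (Y (n + 1) ω)
    (Z (n + 1) ω) (u (n + 1) ω)) (S.gen (n + 1) ω 0 0 0 0)
  simp only [Pi.add_apply, Pi.abs_apply, Real.norm_eq_abs]
  linarith

end Trajectory

end ControlSystem

namespace ControlSystem

/-! ### Perturbation of a control at a single time -/

/-- The control `u` perturbed by `d` at time `m`. -/
def perturb {Ω : Type*} (u : ℕ → Ω → ℝ) (m : ℕ) (d : Ω → ℝ) (n : ℕ) (ω : Ω) : ℝ :=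
  u n ω + if n = m then d ω else 0

/-- The generator of the equation for the increment of the cost under a perturbation. -/
def incrementGen {Ω : Type*} (S : ControlSystem Ω) (u v Y Z : ℕ → Ω → ℝ) (n : ℕ) (ω : Ω)
    (y z : ℝ) : ℝ :=
  S.gen n ω (S.state v n ω) (Y n ω + y) (Z n ω + z) (v n ω)
    - S.gen n ω (S.state u n ω) (Y n ω) (Z n ω) (u n ω)

section Pointwise

variable {Ω : Type*} {S : ControlSystem Ω} {L c : ℝ} {u : ℕ → Ω → ℝ} {m : ℕ} {d : Ω → ℝ}

lemma state_perturb_of_le {n : ℕ} (h : n ≤ m) (ω : Ω) :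
    S.state (perturb u m d) n ω = S.state u n ω := by
  induction n with
  | zero => rfl
  | succ n ih =>
    have h1 : perturb u m d n ω = u n ω := by simp [perturb, (show n ≠ m by omega)]
    simp only [state, ih (by omega), h1]

lemma IsLipschitz.perturb_le (hL : S.IsLipschitz L) (hc : 0 ≤ c) (hd : ∀ ω, |d ω| ≤ c) (n : ℕ)
    (ω : Ω) : |S.state (perturb u m d) n ω - S.state u n ω| + |perturb u m d n ω - u n ω|
      ≤ c * cumWeight (S.weight L) n ω := by
  have hP := one_le_cumWeight (one_le_weight (S := S) hL.pos)
  induction n with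
  | zero =>
    simp only [state, sub_self, abs_zero, zero_add, perturb, add_sub_cancel_left, cumWeight_zero,
      mul_one]
    split_ifs
    · exact hd ω
    · simpa using hc
  | succ n ih =>
    rcases Nat.lt_or_ge n m with h | h
    · rw [state_perturb_of_le (by omega), sub_self, abs_zero, zero_add]
      simp only [perturb, add_sub_cancel_left]
      split_ifs
      · exact (hd ω).trans (le_mul_of_one_le_right hc (hP _ _))
      · simpa using mul_nonneg hc (zero_le_one.trans (hP _ _))
    · have h1 : perturb u m d (n + 1) ω = u (n + 1) ω := by
        simp [perturb, (show n + 1 ≠ m by omega)]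
      rw [h1, sub_self, abs_zero, add_zero, state, state, cumWeight_succ]
      have hf := hL.forward n ω (S.state (perturb u m d) n ω) (S.state u n ω)
        (perturb u m d n ω) (u n ω)
      set x' := S.state (perturb u m d) n ω
      set x := S.state u n ω
      set r' := perturb u m d n ω
      set r := u n ω
      set Δ := |x' - x| + |r' - r| with hΔ
      have hw := (le_weight (S := S) hL.pos n ω).2.1
      have hV := one_le_weight (S := S) hL.pos n ω
      have hξ := abs_nonneg (S.xi n ω)
      calc |x' + S.drift n ω x' r' + S.diff n ω x' r' * S.xi n ω
            - (x + S.drift n ω x r + S.diff n ω x r * S.xi n ω)|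
          = |(x' - x) + (S.drift n ω x' r' - S.drift n ω x r)
            + (S.diff n ω x' r' - S.diff n ω x r) * S.xi n ω| := by congr 1; ring
        _ ≤ Δ + L * Δ + L * Δ * |S.xi n ω| := by
          refine (abs_add_three _ _ _).trans ?_
          rw [abs_mul]
          have := abs_nonneg (S.drift n ω x' r' - S.drift n ω x r)
          have := abs_nonneg (S.diff n ω x' r' - S.diff n ω x r)
          have := abs_nonneg (r' - r)
          gcongr <;> linarith
        _ ≤ Δ * ((1 + 2 * L) * (1 + |S.xi n ω|)) := by
          have hΔ0 : 0 ≤ Δ := by positivity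
          have := mul_nonneg hL.pos.le hξ
          nlinarith [mul_nonneg hΔ0 hL.pos.le, mul_nonneg hΔ0 hξ, mul_nonneg hΔ0 this]
        _ ≤ Δ * S.weight L n ω := by gcongr
        _ ≤ c * cumWeight (S.weight L) n ω * S.weight L n ω :=
          mul_le_mul_of_nonneg_right ih (by linarith)
        _ = _ := by ring

end Pointwise

section Increment

variable {Ω : Type*} [mΩ : MeasurableSpace Ω] {μ : Measure Ω} [IsProbabilityMeasure μ]
  {S : ControlSystem Ω} {L c : ℝ} {u v Y Z : ℕ → Ω → ℝ} {m : ℕ} {d : Ω → ℝ}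

lemma Admissible.perturbed (h₁ : S.IntegrabilityCondition μ)
    (hu : S.Admissible μ u) (hdm : Measurable[S.filt m] d) (hd : ∀ ω, |d ω| ≤ c)
    (hU : ∀ ω, u m ω + d ω ∈ S.U) : S.Admissible μ (perturb u m d) := by
  have ha := h₁.a_pos
  have e : ∀ n, n ≠ m → perturb u m d n = u n := fun n h => by ext ω; simp [ControlSystem.perturb, h]
  have em : perturb u m d m = fun ω => u m ω + d ω := by ext ω; simp [ControlSystem.perturb]
  refine ⟨⟨fun n => ?_, ?_⟩, fun n ω => ?_⟩
  · by_cases h : n = m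
    · subst h
      rw [em]
      exact (hu.mem.adapted n).add hdm
    · rw [e n h]
      exact hu.mem.adapted n
  · set w := fun n => weightedMoment μ S.lam S.gam n (2 * S.a * deltaProd S.theta n) (u n) with hw
    set w' := fun n => weightedMoment μ S.lam S.gam n (2 * S.a * deltaProd S.theta n)
      (ControlSystem.perturb u m d n) with hw'
    have hle : ∀ n, w' n ≤ w n + if n = m then w' m else 0 := fun n => by
      by_cases h : n = m
      · subst h
        simp
      · simp only [hw, hw', e n h, h, if_false, add_zero, le_refl]
    refine (ENNReal.tsum_le_tsum hle).trans_lt ?_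
    rw [ENNReal.tsum_add, tsum_ite_eq]
    refine ENNReal.add_lt_top.2 ⟨hu.mem.finite, ENNReal.mul_lt_top ENNReal.ofReal_lt_top ?_⟩
    have hp : 0 ≤ 2 * S.a * deltaProd S.theta m :=
      mul_nonneg (by positivity) (deltaProd_pos h₁.theta_pos m).le
    have hfin : ∫⁻ ω, ‖u m ω‖ₑ ^ (2 * S.a * deltaProd S.theta m) ∂μ < ∞ :=
      lintegral_rpow_lt_top_of_weightedMoment ((ENNReal.le_tsum (f := w) m).trans_lt hu.mem.finite)
    rw [em]
    refine (lintegral_mono fun ω => (enorm_add_rpow_le (u m ω) (d ω) hp).trans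
      (mul_le_mul_right (add_le_add_right (ENNReal.rpow_le_rpow (z := 2 * S.a * deltaProd S.theta m)
        (show ‖d ω‖ₑ ≤ ENNReal.ofReal c by
          rw [Real.enorm_eq_ofReal_abs]; exact ENNReal.ofReal_le_ofReal (hd ω)) hp) _) _)).trans_lt ?_
    rw [lintegral_const_mul' _ _ (by finiteness), lintegral_add_right _ measurable_const]
    refine ENNReal.mul_lt_top (by finiteness) (ENNReal.add_lt_top.2 ⟨hfin, ?_⟩)
    simp only [lintegral_const, measure_univ, mul_one]
    finiteness
  · by_cases h : n = m
    · subst h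
      rw [em]
      exact hU ω
    · rw [e n h]
      exact hu.values n ω

lemma dominatedGenerator_increment (hS : S.Standing μ) (h₁ : S.IntegrabilityCondition μ)
    (hL : S.IsLipschitz L) (hu : ∀ n, Measurable[S.filt n] (u n))
    (hv : ∀ n, Measurable[S.filt n] (v n)) (hY : ∀ n, Measurable[S.filt n] (Y n))
    (hZ : ∀ n, Measurable[S.filt n] (Z n)) (hc : 0 ≤ c)
    (hd : ∀ n ω, |S.state v n ω - S.state u n ω| + |v n ω - u n ω|
      ≤ c * cumWeight (S.weight L) n ω) :
    DominatedGenerator S.filt S.eta (S.weight L) (L * c) (S.incrementGen u v Y Z) where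
  nonneg := mul_nonneg hL.pos.le hc
  measurable n y z hy hz :=
    (measurable_gen hS h₁ n (measurable_state hS h₁ hv n) ((hY n).add hy) ((hZ n).add hz)
      (hv n)).sub (measurable_gen hS h₁ n (measurable_state hS h₁ hu n) (hY n) (hZ n) (hu n))
  lipschitz n ω y z y' z' := by
    have h := hL.gen (n + 1) ω (S.state v (n + 1) ω) (S.state v (n + 1) ω)
      (Y (n + 1) ω + y) (Y (n + 1) ω + y') (Z (n + 1) ω + z) (Z (n + 1) ω + z')
      (v (n + 1) ω) (v (n + 1) ω)
    simp only [sub_self, abs_zero, zero_add, add_zero, add_sub_add_left_eq_sub] at h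
    have hw := (le_weight (S := S) hL.pos n ω).1
    have h2 : |y + S.incrementGen u v Y Z (n + 1) ω y z
        - (y' + S.incrementGen u v Y Z (n + 1) ω y' z')|
        ≤ (1 + 2 * L) * (|y - y'| + |z - z'|) := by
      have e : y + S.incrementGen u v Y Z (n + 1) ω y z
        - (y' + S.incrementGen u v Y Z (n + 1) ω y' z') = (y - y')
          + (S.gen (n + 1) ω (S.state v (n + 1) ω) (Y (n + 1) ω + y) (Z (n + 1) ω + z)
            (v (n + 1) ω) - S.gen (n + 1) ω (S.state v (n + 1) ω) (Y (n + 1) ω + y')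
              (Z (n + 1) ω + z') (v (n + 1) ω)) := by
        simp only [incrementGen]; ring
      rw [e]
      refine (abs_add_le _ _).trans ?_
      have := hL.pos
      nlinarith [abs_nonneg (y - y'), abs_nonneg (z - z')]
    calc _ ≤ (1 + |S.eta n ω|) * ((1 + 2 * L) * (|y - y'| + |z - z'|)) := by gcongr
      _ = (1 + 2 * L) * (1 + |S.eta n ω|) * (|y - y'| + |z - z'|) := by ring
      _ ≤ _ := by gcongr
  zero_le n ω := by
    have h := hL.gen n ω (S.state v n ω) (S.state u n ω) (Y n ω) (Y n ω) (Z n ω) (Z n ω)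
      (v n ω) (u n ω)
    simp only [sub_self, abs_zero, add_zero] at h
    simp only [incrementGen, add_zero]
    rw [mul_assoc]
    exact h.trans (mul_le_mul_of_nonneg_left (hd n ω) hL.pos.le)

/-- The increment of the cost of an optimal control under an admissible perturbation. -/
lemma IsOptimal.exists_increment (hS : S.Standing μ) (h₁ : S.IntegrabilityCondition μ)
    (hL : S.IsLipschitz L) (hu : S.IsOptimal μ u) (hYZ : S.IsCostSolution μ u Y Z)
    (hv : S.Admissible μ v) (hc : 0 ≤ c)
    (hd : ∀ n ω, |S.state v n ω - S.state u n ω| + |v n ω - u n ω|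
      ≤ c * cumWeight (S.weight L) n ω) :
    ∃ y z : ℕ → Ω → ℝ, IsBackwardSolution μ S.filt S.eta S.b S.theta S.lam S.gam
        (S.incrementGen u v Y Z) y z ∧
      (∀ n, ∀ᵐ ω ∂μ, discount S.lam S.gam n *
        (cumWeight (S.weight L) n ω * (|y n ω| + |z n ω|))
          ≤ L * c * (μ[tailWeight S.lam S.gam (S.weight L) n | S.filt n]) ω) ∧
      0 ≤ ∫ ω, y 0 ω ∂μ := by
  have hV := hS.backwardWeights h₁ hL.pos
  have hb : 2 ≤ 2 * S.b := by linarith [h₁.one_le_b]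
  have hb0 : 0 ≤ S.b := by linarith [h₁.one_le_b]
  have hG := dominatedGenerator_increment hS h₁ hL hu.1.mem.adapted hv.mem.adapted
    hYZ.memY.adapted hYZ.memZ.adapted hc hd
  obtain ⟨y, z, hyz, hbd⟩ := exists_isBackwardSolution hV hG h₁.theta_pos h₁.deltaLim_pos hb0
  refine ⟨y, z, hyz, hbd, ?_⟩
  have hw := hyz.weightIntegrable hV h₁.theta_pos h₁.one_le_b
  have hm := IsCostSolution.memLp_backwardTerm hS h₁ hL hu.1 hYZ
  have hη : ∀ n, MemLp (S.eta n) 2 μ := fun n =>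
    hS.isNoise.polyMoments_whiteNoise.memLp n ENNReal.ofNat_ne_top
  have hsum : S.IsCostSolution μ v (fun n ω => Y n ω + y n ω) (fun n ω => Z n ω + z n ω) :=
    IsBackwardSolution.add hS.filt_le h₁.theta_pos h₁.deltaLim_pos hb0 hYZ hyz
      (fun _ _ _ _ => rfl) (fun n => (hm n).integrable one_le_two)
      (fun n => (hη n).integrable_mul (hm n)) (fun n => (hw.step hV hG n).1)
      fun n => (hw.step hV hG n).2.1
  have h := hu.2 v hv _ _ ⟨Y, Z, hYZ, rfl⟩ ⟨_, _, hsum, rfl⟩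
  rw [integral_add
    ((hYZ.memY.memLp_two hS.filt_le h₁.theta_pos hb h₁.lam_pos 0).integrable one_le_two)
    ((hyz.memY.memLp_two hS.filt_le h₁.theta_pos hb h₁.lam_pos 0).integrable one_le_two)] at h
  linarith

end Increment

/-! ### The adjoint equation -/

/-- The adjoint generator with the explicit prediction of the noise. -/
def adjointGen {Ω : Type*} (S : ControlSystem Ω) (u Y Z : ℕ → Ω → ℝ) (n : ℕ) (ω : Ω)
    (r s : ℝ) : ℝ :=
  S.driftX u n ω * r + noiseBeta S.H n n * S.diffX u n ω * s
    - S.genX u Y Z n ω * S.adjK u Y Z n ω + S.diffX u n ω * r * noisePred S.H S.xi n ω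

section Adjoint

variable {Ω : Type*} [mΩ : MeasurableSpace Ω] {μ : Measure Ω} [IsProbabilityMeasure μ]
  {S : ControlSystem Ω} {L : ℝ} {u Y Z p q : ℕ → Ω → ℝ}

lemma isAdjointSolution_iff (hS : S.Standing μ) : S.IsAdjointSolution μ u Y Z p q ↔
    IsBackwardSolution μ S.filt S.eta S.b S.theta S.lam S.gam (S.adjointGen u Y Z) p q := by
  have h := hS.isNoise.condExp_noise hS.F₀_le hS.indep
  constructor
  · refine fun hp => hp.congr fun n => ?_
    filter_upwards [h n] with ω hω y z
    rw [adjointGen, hω]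
  · refine fun hp => hp.congr fun n => ?_
    filter_upwards [h n] with ω hω y z
    rw [adjointGen, hω]

lemma dominatedGenerator_adjoint (hS : S.Standing μ) (h₁ : S.IntegrabilityCondition μ)
    (hL : S.IsLipschitz L) (hu : ∀ n, Measurable[S.filt n] (u n))
    (hY : ∀ n, Measurable[S.filt n] (Y n)) (hZ : ∀ n, Measurable[S.filt n] (Z n)) :
    DominatedGenerator S.filt S.eta (S.weight L) L (S.adjointGen u Y Z) where
  nonneg := hL.pos.le
  measurable n y z hy hz := by
    have h1 := measurable_driftX hS h₁ hu n
    have h2 := measurable_diffX hS h₁ hu n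
    have h3 := measurable_genX hS h₁ hu hY hZ n
    have h4 := measurable_adjK hS h₁ hu hY hZ n
    exact (((h1.mul hy).add ((h2.const_mul (noiseBeta S.H n n)).mul hz)).sub (h3.mul h4)).add
      ((h2.mul hy).mul (S.measurable_noisePred n))
  lipschitz n ω y z y' z' := by
    have h1 := hL.driftX_le u (n + 1) ω
    have h2 := hL.diffX_le u (n + 1) ω
    have hβ0 := noiseBeta_self_nonneg (H := S.H) (n + 1)
    have hβ1 := noiseBeta_self_le_one hS.hurst_pos (n + 1)
    have hw := (le_weight (S := S) hL.pos n ω).2.2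
    simp only [adjointGen]
    set ξ := noisePred S.H S.xi (n + 1) ω
    set B := S.driftX u (n + 1) ω
    set σ := S.diffX u (n + 1) ω
    set β := noiseBeta S.H (n + 1) (n + 1)
    have h3 : |(y - y') + B * (y - y') + β * σ * (z - z') + σ * (y - y') * ξ|
        ≤ (1 + 2 * L) * (1 + |ξ|) * (|y - y'| + |z - z'|) := by
      calc _ ≤ |y - y'| + |B * (y - y')| + |β * σ * (z - z')| + |σ * (y - y') * ξ| :=
            (abs_add_le _ _).trans (add_le_add_left (abs_add_three _ _ _) _)
        _ ≤ |y - y'| + L * |y - y'| + 1 * L * |z - z'| + L * |y - y'| * |ξ| := by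
            simp only [abs_mul, abs_of_nonneg hβ0]
            gcongr
        _ ≤ _ := by
            have := hL.pos
            have e1 := abs_nonneg (y - y')
            have e2 := abs_nonneg (z - z')
            have e3 := abs_nonneg ξ
            have e4 := mul_nonneg e1 e3
            have e5 := mul_nonneg e2 e3
            nlinarith [mul_nonneg this.le e1, mul_nonneg this.le e2, mul_nonneg this.le e4,
              mul_nonneg this.le e5]
    have e : y + (B * y + β * σ * z - S.genX u Y Z (n + 1) ω * S.adjK u Y Z (n + 1) ω + σ * y * ξ)
        - (y' + (B * y' + β * σ * z' - S.genX u Y Z (n + 1) ω * S.adjK u Y Z (n + 1) ω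
          + σ * y' * ξ))
        = (y - y') + B * (y - y') + β * σ * (z - z') + σ * (y - y') * ξ := by ring
    rw [e]
    calc _ ≤ (1 + |S.eta n ω|) * ((1 + 2 * L) * (1 + |ξ|) * (|y - y'| + |z - z'|)) := by gcongr
      _ = (1 + 2 * L) * (1 + |S.eta n ω|) * (1 + |ξ|) * (|y - y'| + |z - z'|) := by ring
      _ ≤ _ := by gcongr
  zero_le n ω := by
    simp only [adjointGen, mul_zero, zero_mul, add_zero, zero_sub, abs_neg, abs_mul]
    exact mul_le_mul (hL.genX_le u Y Z n ω) (hL.adjK_le u Y Z n ω) (abs_nonneg _) hL.pos.le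

end Adjoint

end ControlSystem

/-! ### Duality between the variation and the adjoint equation -/

section Pairing

variable {Ω : Type*} {m : MeasurableSpace Ω} [mΩ : MeasurableSpace Ω] {μ : Measure Ω}
  [IsProbabilityMeasure μ]

lemma integral_mul_of_condExp (hm : m ≤ mΩ) {α Γ y : Ω → ℝ} (hα : Measurable[m] α)
    (hΓ : Integrable Γ μ) (hαΓ : Integrable (fun ω => α ω * Γ ω) μ) (hy : y =ᵐ[μ] μ[Γ | m]) :
    Integrable (fun ω => α ω * y ω) μ ∧ ∫ ω, α ω * Γ ω ∂μ = ∫ ω, α ω * y ω ∂μ := by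
  have h1 : μ[fun ω => α ω * Γ ω | m] =ᵐ[μ] fun ω => α ω * y ω := by
    filter_upwards [condExp_mul_of_stronglyMeasurable_left (m := m) (μ := μ)
      hα.stronglyMeasurable hαΓ hΓ, hy] with ω h1 h2
    rw [h2]
    exact h1
  refine ⟨integrable_condExp.congr h1, ?_⟩
  rw [← integral_congr_ae h1, integral_condExp hm]

lemma integral_affine_mul_of_condExp (hm : m ≤ mΩ) {α κ η Γ y z : Ω → ℝ} (hα : Measurable[m] α)
    (hκ : Measurable[m] κ) (hΓ : Integrable Γ μ) (hηΓ : Integrable (fun ω => η ω * Γ ω) μ)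
    (hαΓ : Integrable (fun ω => α ω * Γ ω) μ) (hκΓ : Integrable (fun ω => κ ω * (η ω * Γ ω)) μ)
    (hy : y =ᵐ[μ] μ[Γ | m]) (hz : z =ᵐ[μ] μ[fun ω => η ω * Γ ω | m]) :
    Integrable (fun ω => α ω * y ω + κ ω * z ω) μ ∧
      ∫ ω, (α ω + κ ω * η ω) * Γ ω ∂μ = ∫ ω, (α ω * y ω + κ ω * z ω) ∂μ := by
  obtain ⟨i1, e1⟩ := integral_mul_of_condExp hm hα hΓ hαΓ hy
  obtain ⟨i2, e2⟩ := integral_mul_of_condExp hm hκ hηΓ hκΓ hz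
  refine ⟨i1.add i2, ?_⟩
  rw [integral_add i1 i2, ← e1, ← e2, ← integral_add hαΓ hκΓ]
  exact integral_congr_ae (ae_of_all _ fun ω => by ring)

end Pairing

section WeightedIntegrals

variable {Ω : Type*} [mΩ : MeasurableSpace Ω] {μ : Measure Ω} [IsProbabilityMeasure μ]
  {F : ℕ → MeasurableSpace Ω} {η V p q : ℕ → Ω → ℝ} {β θ lam gam : ℝ}

/-- The dominating process of the duality argument. -/
def dualBound (μ : Measure Ω) (F : ℕ → MeasurableSpace Ω) (V : ℕ → Ω → ℝ) (lam gam : ℝ)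
    (p q : ℕ → Ω → ℝ) (n : ℕ) (ω : Ω) : ℝ :=
  discount lam gam n * (cumWeight V n ω ^ 2 * (|p n ω| + |q n ω| + 1))
    + (μ[tailWeight lam gam V n | F n]) ω

lemma memLHat_one (hlam : 0 < lam) (hgam : 1 < gam) :
    MemLHat μ F β θ lam gam fun _ _ => 1 := by
  refine ⟨fun n => measurable_const, ?_⟩
  have : ∀ n, weightedMoment μ lam gam n (β / deltaProd θ n) (fun _ => (1 : ℝ))
      = ENNReal.ofReal (discount lam gam n) := fun n => by
    simp [weightedMoment]
  simp only [this]
  exact (summable_discount hlam hgam).tsum_ofReal_lt_top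

variable (hV : BackwardWeights μ F η lam gam V) (hθ : 0 < θ) (hβ : 2 ≤ β)
  (hp : MemLHat μ F β θ lam gam p) (hq : MemLHat μ F β θ lam gam q)
include hV hθ hβ hp hq

lemma BackwardWeights.integrable_cum_pow_mul {k : ℕ} (hk : k ≤ 4) (n : ℕ) :
    Integrable (fun ω => cumWeight V n ω ^ k * (|p n ω| + |q n ω| + 1)) μ := by
  have h := hV.moderate_pow hk
  have h1 := ((h.summable_integral_mul hp hV.le hθ hβ hV.lam_pos).1 n).abs
  have h2 := ((h.summable_integral_mul hq hV.le hθ hβ hV.lam_pos).1 n).abs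
  refine ((h1.add h2).add (hV.integrable_cum_pow hk n)).congr (ae_of_all _ fun ω => ?_)
  have := hV.cum_pos n ω
  simp only [Pi.add_apply, abs_mul, abs_of_pos (pow_pos this k)]
  ring

lemma BackwardWeights.integrable_of_le_cum_pow {f : Ω → ℝ} {C : ℝ} {k : ℕ} (hk : k ≤ 4) (n : ℕ)
    (hf : Measurable f)
    (h : ∀ ω, |f ω| ≤ C * (cumWeight V n ω ^ k * (|p n ω| + |q n ω| + 1))) : Integrable f μ :=
  ((hV.integrable_cum_pow_mul hθ hβ hp hq hk n).const_mul C).mono' hf.aestronglyMeasurable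
    (ae_of_all _ h)

lemma BackwardWeights.integrable_dualBound (n : ℕ) :
    Integrable (dualBound μ F V lam gam p q n) μ :=
  ((hV.integrable_cum_pow_mul hθ hβ hp hq (by norm_num) n).const_mul _).add integrable_condExp

lemma BackwardWeights.summable_integral_dualBound :
    Summable fun n => ∫ ω, dualBound μ F V lam gam p q n ω ∂μ := by
  have h := hV.moderate_pow (k := 2) (by norm_num)
  have h1 := h.summable_integral_mul hp hV.le hθ hβ hV.lam_pos
  have h2 := h.summable_integral_mul hq hV.le hθ hβ hV.lam_pos
  have h3 := h.summable_integral_mul (memLHat_one (μ := μ) (F := F) hV.lam_pos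
    hV.one_lt_gam) hV.le hθ hβ hV.lam_pos
  refine (((h1.2.add h2.2).add h3.2).add hV.summable_integral_tailWeight).congr fun n => ?_
  have h12 : Integrable (fun ω => |cumWeight V n ω ^ 2 * p n ω| + |cumWeight V n ω ^ 2 * q n ω|) μ :=
    (h1.1 n).abs.add (h2.1 n).abs
  simp only [dualBound]
  rw [integral_add ((hV.integrable_cum_pow_mul hθ hβ hp hq (by norm_num) n).const_mul _)
    integrable_condExp, integral_condExp (hV.le n), integral_const_mul, ← mul_add, ← mul_add,
    ← integral_add (h1.1 n).abs (h2.1 n).abs, ← integral_add h12 (h3.1 n).abs]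
  congr 2
  refine integral_congr_ae (ae_of_all _ fun ω => ?_)
  have := hV.cum_pos n ω
  simp only [abs_mul, abs_of_pos (pow_pos this 2), abs_one]
  ring

lemma BackwardWeights.le_dualBound (n : ℕ) : ∀ᵐ ω ∂μ,
    discount lam gam n * (cumWeight V n ω ^ 2 * (|p n ω| + |q n ω| + 1))
      ≤ dualBound μ F V lam gam p q n ω ∧
    (μ[tailWeight lam gam V n | F n]) ω ≤ dualBound μ F V lam gam p q n ω := by
  have h0 : 0 ≤ᵐ[μ] μ[tailWeight lam gam V n | F n] :=
    condExp_nonneg (ae_of_all _ (hV.tailWeight_nonneg n))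
  filter_upwards [h0] with ω h
  exact ⟨le_add_of_nonneg_right h, le_add_of_nonneg_left
    (mul_nonneg (discount_pos _ _ _).le (by positivity))⟩

end WeightedIntegrals

namespace ControlSystem

/-- The data of the duality argument: the variation `(y, z)` of the cost between the controls `u`
and `v`, which are `c`-close, and the adjoint process `(p, q)`. -/
structure IsVariation {Ω : Type*} [MeasurableSpace Ω] (S : ControlSystem Ω) (μ : Measure Ω)
    (L c : ℝ) (u v Y Z y z p q : ℕ → Ω → ℝ) : Prop where
  standing : S.Standing μ
  integrability : S.IntegrabilityCondition μ
  lipschitz : S.IsLipschitz L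
  adapted_u : ∀ n, Measurable[S.filt n] (u n)
  adapted_v : ∀ n, Measurable[S.filt n] (v n)
  adapted_Y : ∀ n, Measurable[S.filt n] (Y n)
  adapted_Z : ∀ n, Measurable[S.filt n] (Z n)
  nonneg : 0 ≤ c
  close : ∀ n ω, |S.state v n ω - S.state u n ω| + |v n ω - u n ω|
      ≤ c * cumWeight (S.weight L) n ω
  increment : IsBackwardSolution μ S.filt S.eta S.b S.theta S.lam S.gam
    (S.incrementGen u v Y Z) y z
  increment_le : ∀ n, ∀ᵐ ω ∂μ, discount S.lam S.gam n *
    (cumWeight (S.weight L) n ω * (|y n ω| + |z n ω|))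
      ≤ L * c * (μ[tailWeight S.lam S.gam (S.weight L) n | S.filt n]) ω
  adjoint : IsBackwardSolution μ S.filt S.eta S.b S.theta S.lam S.gam (S.adjointGen u Y Z) p q

/-- The pairing of the state increment with the adjoint process. -/
def stateDual {Ω : Type*} (S : ControlSystem Ω) (u v Y Z p q : ℕ → Ω → ℝ) (n : ℕ) (ω : Ω) : ℝ :=
  discount S.lam S.gam n * ((S.state v n ω - S.state u n ω)
    * (p n ω + S.adjointGen u Y Z n ω (p n ω) (q n ω)))

/-- The pairing of the cost increment with the process `k`. -/
def costDual {Ω : Type*} (S : ControlSystem Ω) (u v Y Z y z : ℕ → Ω → ℝ) (n : ℕ) (ω : Ω) : ℝ :=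
  discount S.lam S.gam n * (S.adjK u Y Z n ω
    * (y n ω + S.incrementGen u v Y Z n ω (y n ω) (z n ω)))

/-- The increment of the drift. -/
def driftInc {Ω : Type*} (S : ControlSystem Ω) (u v : ℕ → Ω → ℝ) (n : ℕ) (ω : Ω) : ℝ :=
  S.drift n ω (S.state v n ω) (v n ω) - S.drift n ω (S.state u n ω) (u n ω)

/-- The increment of the diffusion coefficient. -/
def diffInc {Ω : Type*} (S : ControlSystem Ω) (u v : ℕ → Ω → ℝ) (n : ℕ) (ω : Ω) : ℝ :=
  S.diff n ω (S.state v n ω) (v n ω) - S.diff n ω (S.state u n ω) (u n ω)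

/-- The discounted one-step defect of the duality. -/
def dualDefect {Ω : Type*} (S : ControlSystem Ω) (u v Y Z y z p q : ℕ → Ω → ℝ) (n : ℕ) (ω : Ω) :
    ℝ :=
  discount S.lam S.gam n *
    ((S.driftInc u v n ω - S.driftX u n ω * (S.state v n ω - S.state u n ω)) * p n ω
      + (S.diffInc u v n ω - S.diffX u n ω * (S.state v n ω - S.state u n ω))
        * (noisePred S.H S.xi n ω * p n ω + noiseBeta S.H n n * q n ω)
      - S.adjK u Y Z n ω * (S.incrementGen u v Y Z n ω (y n ω) (z n ω)
        - S.genX u Y Z n ω * (S.state v n ω - S.state u n ω)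
        - S.genY u Y Z n ω * y n ω - S.genZ u Y Z n ω * z n ω))

section Variation

variable {Ω : Type*} [mΩ : MeasurableSpace Ω] {μ : Measure Ω} [IsProbabilityMeasure μ]
  {S : ControlSystem Ω} {L c : ℝ} {u v Y Z y z p q : ℕ → Ω → ℝ}

namespace IsVariation

variable (h : S.IsVariation μ L c u v Y Z y z p q)
include h

lemma weights : BackwardWeights μ S.filt S.eta S.lam S.gam (S.weight L) :=
  h.standing.backwardWeights h.integrability h.lipschitz.pos

lemma two_le : 2 ≤ 2 * S.b := by linarith [h.integrability.one_le_b]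

lemma theta_pos : 0 < S.theta := h.integrability.theta_pos

lemma state_le (n : ℕ) (ω : Ω) :
    |S.state v n ω - S.state u n ω| ≤ c * cumWeight (S.weight L) n ω := by
  linarith [h.close n ω, abs_nonneg (v n ω - u n ω)]

lemma driftInc_le (n : ℕ) (ω : Ω) :
    |S.driftInc u v n ω| ≤ L * (c * cumWeight (S.weight L) n ω) := by
  have h1 := h.lipschitz.forward n ω (S.state v n ω) (S.state u n ω) (v n ω) (u n ω)
  have h2 := mul_le_mul_of_nonneg_left (h.close n ω) h.lipschitz.pos.le
  have h3 := abs_nonneg (S.diffInc u v n ω)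
  simp only [driftInc, diffInc] at *
  linarith

lemma diffInc_le (n : ℕ) (ω : Ω) :
    |S.diffInc u v n ω| ≤ L * (c * cumWeight (S.weight L) n ω) := by
  have h1 := h.lipschitz.forward n ω (S.state v n ω) (S.state u n ω) (v n ω) (u n ω)
  have h2 := mul_le_mul_of_nonneg_left (h.close n ω) h.lipschitz.pos.le
  have h3 := abs_nonneg (S.driftInc u v n ω)
  simp only [driftInc, diffInc] at *
  linarith

lemma incrementGen_le (n : ℕ) (ω : Ω) (r s : ℝ) : |S.incrementGen u v Y Z n ω r s|
    ≤ L * (c * cumWeight (S.weight L) n ω + |r| + |s|) := by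
  have h1 := h.lipschitz.gen n ω (S.state v n ω) (S.state u n ω) (Y n ω + r) (Y n ω)
    (Z n ω + s) (Z n ω) (v n ω) (u n ω)
  simp only [add_sub_cancel_left] at h1
  refine h1.trans (mul_le_mul_of_nonneg_left ?_ h.lipschitz.pos.le)
  linarith [h.close n ω]

lemma add_adjointGen_le (n : ℕ) (ω : Ω) (r s : ℝ) : |r + S.adjointGen u Y Z n ω r s|
    ≤ (1 + 2 * L) * (cumWeight (S.weight L) n ω * (|r| + |s| + 1)) := by
  have hL := h.lipschitz
  have h1 := hL.driftX_le u n ω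
  have h2 := hL.diffX_le u n ω
  have h3 := hL.genX_le u Y Z n ω
  have h4 := hL.adjK_le u Y Z n ω
  have h5 := abs_noisePred_le_cumWeight (S := S) hL.pos n ω
  have hP := h.weights.one_le_cum n ω
  have hβ0 := noiseBeta_self_nonneg (H := S.H) n
  have hβ1 := noiseBeta_self_le_one h.standing.hurst_pos n
  simp only [adjointGen]
  set P := cumWeight (S.weight L) n ω
  have h5' : |noisePred S.H S.xi n ω| ≤ P := by linarith
  calc _ = |r + (S.driftX u n ω * r + noiseBeta S.H n n * S.diffX u n ω * s)
        + (-(S.genX u Y Z n ω * S.adjK u Y Z n ω) + S.diffX u n ω * r * noisePred S.H S.xi n ω)| := by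
        congr 1; ring
    _ ≤ |r| + (|S.driftX u n ω * r| + |noiseBeta S.H n n * S.diffX u n ω * s|)
        + (|S.genX u Y Z n ω * S.adjK u Y Z n ω| + |S.diffX u n ω * r * noisePred S.H S.xi n ω|) := by
        refine (abs_add_three _ _ _).trans ?_
        gcongr
        · exact abs_add_le _ _
        · exact (abs_add_le _ _).trans_eq (by rw [abs_neg])
    _ ≤ |r| + (L * |r| + 1 * L * |s|) + (L * P + L * |r| * P) := by
        simp only [abs_mul, abs_of_nonneg hβ0]
        have := hL.pos
        gcongr
    _ ≤ _ := by
        have hL0 := hL.pos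
        have hr := abs_nonneg r
        have hs := abs_nonneg s
        have hP1 : 0 ≤ P - 1 := by linarith
        nlinarith [mul_nonneg hL0.le hr, mul_nonneg hL0.le hs, mul_nonneg hP1 hr,
          mul_nonneg hP1 hs, mul_nonneg hP1 (mul_nonneg hL0.le hr),
          mul_nonneg hP1 (mul_nonneg hL0.le hs), mul_nonneg hP1 hL0.le]

lemma stateDual_le (n : ℕ) : ∀ᵐ ω ∂μ, |S.stateDual u v Y Z p q n ω|
    ≤ c * ((1 + 2 * L) * dualBound μ S.filt (S.weight L) S.lam S.gam p q n ω) := by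
  filter_upwards [h.weights.le_dualBound h.theta_pos h.two_le h.adjoint.memY h.adjoint.memZ n]
    with ω ⟨hω, _⟩
  have hD := discount_pos S.lam S.gam n
  have hP := h.weights.cum_pos n ω
  have hL := h.lipschitz.pos
  have hc := h.nonneg
  rw [stateDual, abs_mul, abs_mul, abs_of_pos hD]
  calc _ ≤ discount S.lam S.gam n * ((c * cumWeight (S.weight L) n ω) *
        ((1 + 2 * L) * (cumWeight (S.weight L) n ω * (|p n ω| + |q n ω| + 1)))) := by
        gcongr
        · exact h.state_le n ω
        · exact h.add_adjointGen_le n ω _ _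
    _ = c * ((1 + 2 * L) * (discount S.lam S.gam n *
        (cumWeight (S.weight L) n ω ^ 2 * (|p n ω| + |q n ω| + 1)))) := by ring
    _ ≤ _ := by gcongr

lemma costDual_le (n : ℕ) : ∀ᵐ ω ∂μ, |S.costDual u v Y Z y z n ω|
    ≤ c * ((2 * L + L ^ 2) * dualBound μ S.filt (S.weight L) S.lam S.gam p q n ω) := by
  filter_upwards [h.weights.le_dualBound h.theta_pos h.two_le h.adjoint.memY h.adjoint.memZ n,
    h.increment_le n] with ω ⟨h1, h2⟩ h3
  have hD := discount_pos S.lam S.gam n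
  have hP := h.weights.cum_pos n ω
  have hL := h.lipschitz.pos
  have hc := h.nonneg
  have hg := h.incrementGen_le n ω (y n ω) (z n ω)
  have hk := h.lipschitz.adjK_le u Y Z n ω
  rw [costDual, abs_mul, abs_mul, abs_of_pos hD]
  set e := discount S.lam S.gam n
  set P := cumWeight (S.weight L) n ω
  set B := dualBound μ S.filt (S.weight L) S.lam S.gam p q n ω
  have h1' : e * P ^ 2 ≤ B := by
    refine le_trans ?_ h1
    have : 0 ≤ |p n ω| + |q n ω| := by positivity
    gcongr
    exact le_mul_of_one_le_right (by positivity) (by linarith)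
  have h3' : e * (P * (|y n ω| + |z n ω|)) ≤ L * c * B := h3.trans (by gcongr)
  calc _ ≤ e * (P * ((1 + L) * (|y n ω| + |z n ω|) + L * (c * P))) := by
        gcongr
        refine (abs_add_le _ _).trans ?_
        nlinarith [abs_nonneg (z n ω)]
    _ = (1 + L) * (e * (P * (|y n ω| + |z n ω|))) + L * c * (e * P ^ 2) := by ring
    _ ≤ (1 + L) * (L * c * B) + L * c * B := by gcongr
    _ = _ := by ring

lemma dualDefect_le (n : ℕ) : ∀ᵐ ω ∂μ, |S.dualDefect u v Y Z y z p q n ω|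
    ≤ c * ((6 * L + 2 * L ^ 2) * dualBound μ S.filt (S.weight L) S.lam S.gam p q n ω) := by
  filter_upwards [h.weights.le_dualBound h.theta_pos h.two_le h.adjoint.memY h.adjoint.memZ n,
    h.increment_le n] with ω ⟨h1, h2⟩ h3
  have hD := discount_pos S.lam S.gam n
  have hP1 := h.weights.one_le_cum n ω
  have hP := h.weights.cum_pos n ω
  have hL := h.lipschitz.pos
  have hc := h.nonneg
  have hg := h.incrementGen_le n ω (y n ω) (z n ω)
  have hk := h.lipschitz.adjK_le u Y Z n ω
  have hx := h.state_le n ω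
  have hb := h.driftInc_le n ω
  have hs := h.diffInc_le n ω
  have b1 := h.lipschitz.driftX_le u n ω
  have b2 := h.lipschitz.diffX_le u n ω
  have b3 := h.lipschitz.genX_le u Y Z n ω
  have b4 := h.lipschitz.genY_le u Y Z n ω
  have b5 := h.lipschitz.genZ_le u Y Z n ω
  have h5 := abs_noisePred_le_cumWeight (S := S) hL n ω
  have hβ0 := noiseBeta_self_nonneg (H := S.H) n
  have hβ1 := noiseBeta_self_le_one h.standing.hurst_pos n
  rw [dualDefect, abs_mul, abs_of_pos hD]
  set e := discount S.lam S.gam n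
  set P := cumWeight (S.weight L) n ω
  set B := dualBound μ S.filt (S.weight L) S.lam S.gam p q n ω
  set dX := S.state v n ω - S.state u n ω
  have m1 : |S.driftInc u v n ω - S.driftX u n ω * dX| ≤ 2 * L * (c * P) := by
    refine (abs_sub _ _).trans ?_
    rw [abs_mul]
    nlinarith [mul_le_mul b1 hx (abs_nonneg _) hL.le]
  have m2 : |S.diffInc u v n ω - S.diffX u n ω * dX| ≤ 2 * L * (c * P) := by
    refine (abs_sub _ _).trans ?_
    rw [abs_mul]
    nlinarith [mul_le_mul b2 hx (abs_nonneg _) hL.le]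
  have m3 : |noisePred S.H S.xi n ω * p n ω + noiseBeta S.H n n * q n ω|
      ≤ P * |p n ω| + P * |q n ω| := by
    refine (abs_add_le _ _).trans ?_
    rw [abs_mul, abs_mul, abs_of_nonneg hβ0]
    gcongr <;> linarith
  have m4 : |S.incrementGen u v Y Z n ω (y n ω) (z n ω) - S.genX u Y Z n ω * dX
      - S.genY u Y Z n ω * y n ω - S.genZ u Y Z n ω * z n ω|
      ≤ 2 * L * (c * P) + 2 * L * (|y n ω| + |z n ω|) := by
    refine (abs_sub _ _).trans ((add_le_add_left ((abs_sub _ _).trans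
      (add_le_add_left (abs_sub _ _) _)) _).trans ?_)
    rw [abs_mul, abs_mul, abs_mul]
    nlinarith [mul_le_mul b3 hx (abs_nonneg _) hL.le,
      mul_le_mul_of_nonneg_right b4 (abs_nonneg (y n ω)),
      mul_le_mul_of_nonneg_right b5 (abs_nonneg (z n ω))]
  have h3' : e * (P * (|y n ω| + |z n ω|)) ≤ L * c * B := h3.trans (by gcongr)
  have hp := abs_nonneg (p n ω)
  have hq := abs_nonneg (q n ω)
  calc _ ≤ e * (2 * L * (c * P) * |p n ω| + 2 * L * (c * P) * (P * |p n ω| + P * |q n ω|)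
        + P * (2 * L * (c * P) + 2 * L * (|y n ω| + |z n ω|))) := by
        refine mul_le_mul_of_nonneg_left ?_ hD.le
        refine (abs_sub _ _).trans ((add_le_add_left (abs_add_le _ _) _).trans ?_)
        rw [abs_mul, abs_mul, abs_mul]
        gcongr
    _ ≤ e * (2 * L * (c * P) * (P * |p n ω|) + 2 * L * (c * P) * (P * |p n ω| + P * |q n ω|)
        + P * (2 * L * (c * P) + 2 * L * (|y n ω| + |z n ω|))) := by
        gcongr
        exact le_mul_of_one_le_left hp hP1
    _ ≤ 4 * L * c * (e * (P ^ 2 * (|p n ω| + |q n ω| + 1)))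
        + 2 * L * (e * (P * (|y n ω| + |z n ω|))) := by
        have hcL : 0 ≤ e * P ^ 2 * L * c := by positivity
        nlinarith [mul_nonneg hcL hq]
    _ ≤ 4 * L * c * B + 2 * L * (L * c * B) := by gcongr
    _ ≤ _ := by
        have hB : 0 ≤ B := le_trans (by positivity) h1
        have : 0 ≤ L * c * B := by positivity
        nlinarith

end IsVariation

end Variation

end ControlSystem

namespace ControlSystem

section Variation

variable {Ω : Type*} [mΩ : MeasurableSpace Ω] {μ : Measure Ω} [IsProbabilityMeasure μ]
  {S : ControlSystem Ω} {L c : ℝ} {u v Y Z y z p q : ℕ → Ω → ℝ}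

namespace IsVariation

variable (h : S.IsVariation μ L c u v Y Z y z p q)
include h

lemma measurable_stateInc (n : ℕ) :
    Measurable[S.filt n] fun ω => S.state v n ω - S.state u n ω :=
  (measurable_state h.standing h.integrability h.adapted_v n).sub
    (measurable_state h.standing h.integrability h.adapted_u n)

lemma measurable_driftInc (n : ℕ) : Measurable[S.filt n] (S.driftInc u v n) :=
  (measurable_drift h.standing h.integrability n
    (measurable_state h.standing h.integrability h.adapted_v n) (h.adapted_v n)).sub
  (measurable_drift h.standing h.integrability n
    (measurable_state h.standing h.integrability h.adapted_u n) (h.adapted_u n))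

lemma measurable_diffInc (n : ℕ) : Measurable[S.filt n] (S.diffInc u v n) :=
  (measurable_diff h.standing h.integrability n
    (measurable_state h.standing h.integrability h.adapted_v n) (h.adapted_v n)).sub
  (measurable_diff h.standing h.integrability n
    (measurable_state h.standing h.integrability h.adapted_u n) (h.adapted_u n))

lemma dominated_increment : DominatedGenerator S.filt S.eta (S.weight L) (L * c)
    (S.incrementGen u v Y Z) :=
  dominatedGenerator_increment h.standing h.integrability h.lipschitz h.adapted_u h.adapted_v
    h.adapted_Y h.adapted_Z h.nonneg h.close

lemma dominated_adjoint : DominatedGenerator S.filt S.eta (S.weight L) L (S.adjointGen u Y Z) :=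
  dominatedGenerator_adjoint h.standing h.integrability h.lipschitz h.adapted_u
    h.adapted_Y h.adapted_Z

lemma measurable_stateDual (n : ℕ) : Measurable[S.filt n] (S.stateDual u v Y Z p q n) :=
  ((h.measurable_stateInc n).mul ((h.adjoint.memY.adapted n).add (h.dominated_adjoint.measurable n
    _ _ (h.adjoint.memY.adapted n) (h.adjoint.memZ.adapted n)))).const_mul _

lemma measurable_costDual (n : ℕ) : Measurable[S.filt n] (S.costDual u v Y Z y z n) :=
  ((measurable_adjK h.standing h.integrability h.adapted_u h.adapted_Y h.adapted_Z n).mul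
    ((h.increment.memY.adapted n).add (h.dominated_increment.measurable n
    _ _ (h.increment.memY.adapted n) (h.increment.memZ.adapted n)))).const_mul _

lemma integrable_dualBound (n : ℕ) :
    Integrable (dualBound μ S.filt (S.weight L) S.lam S.gam p q n) μ :=
  h.weights.integrable_dualBound h.theta_pos h.two_le h.adjoint.memY h.adjoint.memZ n

lemma summable_integral_dualBound :
    Summable fun n => ∫ ω, dualBound μ S.filt (S.weight L) S.lam S.gam p q n ω ∂μ :=
  h.weights.summable_integral_dualBound h.theta_pos h.two_le h.adjoint.memY h.adjoint.memZ

lemma integrable_stateDual (n : ℕ) : Integrable (S.stateDual u v Y Z p q n) μ :=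
  (((h.integrable_dualBound n).const_mul _).const_mul _).mono'
    ((h.measurable_stateDual n).mono (h.standing.filt_le n) le_rfl).aestronglyMeasurable
    (h.stateDual_le n)

lemma integrable_costDual (n : ℕ) : Integrable (S.costDual u v Y Z y z n) μ :=
  (((h.integrable_dualBound n).const_mul _).const_mul _).mono'
    ((h.measurable_costDual n).mono (h.standing.filt_le n) le_rfl).aestronglyMeasurable
    (h.costDual_le n)

lemma abs_eta_le (n : ℕ) (ω : Ω) : |S.eta n ω| ≤ S.weight L n ω := by
  have h1 := (le_weight (S := S) h.lipschitz.pos n ω).1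
  have := h.lipschitz.pos
  nlinarith [abs_nonneg (S.eta n ω)]

/-- One step of the state duality. -/
lemma integral_stateDual_succ (n : ℕ) :
    Integrable (fun ω => discount S.lam S.gam n *
      ((S.driftInc u v n ω - S.driftX u n ω * (S.state v n ω - S.state u n ω)) * p n ω
      + (S.diffInc u v n ω - S.diffX u n ω * (S.state v n ω - S.state u n ω))
        * (noisePred S.H S.xi n ω * p n ω + noiseBeta S.H n n * q n ω)
      + S.adjK u Y Z n ω * S.genX u Y Z n ω * (S.state v n ω - S.state u n ω))) μ ∧
    ∫ ω, S.stateDual u v Y Z p q (n + 1) ω ∂μ = ∫ ω, S.stateDual u v Y Z p q n ω ∂μ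
      + ∫ ω, discount S.lam S.gam n *
      ((S.driftInc u v n ω - S.driftX u n ω * (S.state v n ω - S.state u n ω)) * p n ω
      + (S.diffInc u v n ω - S.diffX u n ω * (S.state v n ω - S.state u n ω))
        * (noisePred S.H S.xi n ω * p n ω + noiseBeta S.H n n * q n ω)
      + S.adjK u Y Z n ω * S.genX u Y Z n ω * (S.state v n ω - S.state u n ω)) ∂μ := by
  have hV := h.weights
  have hw := h.adjoint.weightIntegrable hV h.theta_pos h.integrability.one_le_b
  obtain ⟨iΓ, iηΓ, -⟩ := hw.step hV h.dominated_adjoint n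
  have hL := h.lipschitz.pos
  have hc := h.nonneg
  set Γ := backwardTerm S.lam S.gam (S.adjointGen u Y Z) p q n with hΓ
  have hΓm : Measurable Γ := (measurable_backwardTerm h.dominated_adjoint h.adjoint.memY.adapted
    h.adjoint.memZ.adapted n).mono (hV.le _) le_rfl
  have hΓle : ∀ ω, |Γ ω| ≤ (1 + 2 * L) * (cumWeight (S.weight L) (n + 1) ω
      * (|p (n + 1) ω| + |q (n + 1) ω| + 1)) := fun ω => by
    rw [hΓ, backwardTerm, abs_mul, abs_of_pos (discount_pos _ _ _)]
    refine le_trans (mul_le_of_le_one_left (abs_nonneg _)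
      (discount_le_one hV.lam_pos.le _ _)) (h.add_adjointGen_le _ _ _ _)
  let α : Ω → ℝ := fun ω => S.state v n ω - S.state u n ω + S.driftInc u v n ω
    + S.diffInc u v n ω * noisePred S.H S.xi n ω
  let κ : Ω → ℝ := fun ω => S.diffInc u v n ω * noiseBeta S.H n n
  have hα : Measurable[S.filt n] α := ((h.measurable_stateInc n).add (h.measurable_driftInc n)).add
    ((h.measurable_diffInc n).mul (S.measurable_noisePred n))
  have hκ : Measurable[S.filt n] κ := (h.measurable_diffInc n).mul_const _
  have hP1 := fun k ω => hV.one_le_cum k ω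
  have hmono : ∀ ω, cumWeight (S.weight L) n ω ≤ cumWeight (S.weight L) (n + 1) ω := fun ω => by
    rw [cumWeight_succ]
    exact le_mul_of_one_le_right (hV.cum_pos n ω).le (hV.one_le n ω)
  have iα : Integrable (fun ω => α ω * Γ ω) μ := by
    refine hV.integrable_of_le_cum_pow (C := c * (1 + L) * (1 + 2 * L)) (k := 3) h.theta_pos
      h.two_le h.adjoint.memY h.adjoint.memZ (by norm_num) (n + 1)
      ((hα.mono (hV.le _) le_rfl).mul hΓm) fun ω => ?_
    have h5 := abs_noisePred_le_cumWeight (S := S) hL n ω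
    have hα' : |α ω| ≤ c * (1 + L) * cumWeight (S.weight L) n ω ^ 2 := by
      refine (abs_add_three _ _ _).trans ?_
      rw [abs_mul]
      have h1 := h.state_le n ω
      have h2 := h.driftInc_le n ω
      have h3 := mul_le_mul (h.diffInc_le n ω) (le_sub_iff_add_le'.2 h5) (abs_nonneg _)
        (by have := hV.cum_pos n ω; positivity)
      have h4 : c * cumWeight (S.weight L) n ω ≤ c * cumWeight (S.weight L) n ω ^ 2 :=
        mul_le_mul_of_nonneg_left (by nlinarith [hP1 n ω]) hc
      nlinarith
    rw [abs_mul]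
    have hp0 := hV.cum_pos n ω
    have hp1 := hV.cum_pos (n + 1) ω
    calc |α ω| * |Γ ω| ≤ (c * (1 + L) * cumWeight (S.weight L) (n + 1) ω ^ 2)
          * ((1 + 2 * L) * (cumWeight (S.weight L) (n + 1) ω
            * (|p (n + 1) ω| + |q (n + 1) ω| + 1))) := by
          refine mul_le_mul (hα'.trans ?_) (hΓle ω) (abs_nonneg _) (by positivity)
          have := hmono ω
          gcongr
      _ = _ := by ring
  have iκ : Integrable (fun ω => κ ω * (S.eta n ω * Γ ω)) μ := by
    refine hV.integrable_of_le_cum_pow (C := c * L * (1 + 2 * L)) (k := 2) h.theta_pos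
      h.two_le h.adjoint.memY h.adjoint.memZ (by norm_num) (n + 1)
      ((hκ.mono (hV.le _) le_rfl).mul ((hV.measurable_eta n).mul hΓm)) fun ω => ?_
    have hβ0 := noiseBeta_self_nonneg (H := S.H) n
    have hβ1 := noiseBeta_self_le_one h.standing.hurst_pos n
    have hp0 := hV.cum_pos n ω
    have hp1 := hV.cum_pos (n + 1) ω
    rw [abs_mul, abs_mul, abs_mul, abs_of_nonneg hβ0]
    calc _ ≤ (L * (c * cumWeight (S.weight L) n ω) * 1) * (S.weight L n ω *
          ((1 + 2 * L) * (cumWeight (S.weight L) (n + 1) ω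
            * (|p (n + 1) ω| + |q (n + 1) ω| + 1)))) := by
          have := h.diffInc_le n ω
          have := h.abs_eta_le n ω
          have := zero_le_one.trans (hV.one_le n ω)
          have := hΓle ω
          gcongr
      _ = _ := by
          simp only [cumWeight_succ]
          ring
  obtain ⟨i, e⟩ := integral_affine_mul_of_condExp (hV.le n) hα hκ iΓ iηΓ iα iκ
    (h.adjoint.eqY n) (h.adjoint.eqZ n)
  have e1 : ∀ ω, α ω * (discount S.lam S.gam n * p n ω) + κ ω * (discount S.lam S.gam n * q n ω)
      - S.stateDual u v Y Z p q n ω = discount S.lam S.gam n *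
      ((S.driftInc u v n ω - S.driftX u n ω * (S.state v n ω - S.state u n ω)) * p n ω
      + (S.diffInc u v n ω - S.diffX u n ω * (S.state v n ω - S.state u n ω))
        * (noisePred S.H S.xi n ω * p n ω + noiseBeta S.H n n * q n ω)
      + S.adjK u Y Z n ω * S.genX u Y Z n ω * (S.state v n ω - S.state u n ω)) := fun ω => by
    simp only [α, κ, stateDual, adjointGen]
    ring
  refine ⟨(i.sub (h.integrable_stateDual n)).congr (ae_of_all _ e1), ?_⟩
  have e2 : ∫ ω, S.stateDual u v Y Z p q (n + 1) ω ∂μ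
      = ∫ ω, (α ω + κ ω * S.eta n ω) * Γ ω ∂μ := by
    refine integral_congr_ae ?_
    filter_upwards [h.standing.isNoise.noise_eq n] with ω hω
    have hs : S.state v (n + 1) ω - S.state u (n + 1) ω = α ω + κ ω * S.eta n ω := by
      have hω' : S.xi n ω = noisePred S.H S.xi n ω + noiseBeta S.H n n * S.eta n ω := hω
      simp only [state, α, κ, driftInc, diffInc]
      rw [hω']
      ring
    rw [stateDual, hs, hΓ, backwardTerm]
    ring
  rw [e2, e, ← integral_congr_ae (ae_of_all μ e1), integral_sub i (h.integrable_stateDual n)]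
  ring

/-- One step of the cost duality. -/
lemma integral_costDual_succ (n : ℕ) :
    Integrable (fun ω => discount S.lam S.gam n * (S.adjK u Y Z n ω *
      (S.genY u Y Z n ω * y n ω + S.genZ u Y Z n ω * z n ω
        - S.incrementGen u v Y Z n ω (y n ω) (z n ω)))) μ ∧
    ∫ ω, S.costDual u v Y Z y z (n + 1) ω ∂μ = ∫ ω, S.costDual u v Y Z y z n ω ∂μ
      + ∫ ω, discount S.lam S.gam n * (S.adjK u Y Z n ω *
      (S.genY u Y Z n ω * y n ω + S.genZ u Y Z n ω * z n ω
        - S.incrementGen u v Y Z n ω (y n ω) (z n ω))) ∂μ - if n = 0 then ∫ ω, y 0 ω ∂μ else 0 := by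
  have hV := h.weights
  have hw := h.increment.weightIntegrable hV h.theta_pos h.integrability.one_le_b
  obtain ⟨iΓ, iηΓ, -⟩ := hw.step hV h.dominated_increment n
  have hL := h.lipschitz.pos
  have hc := h.nonneg
  set Γ := backwardTerm S.lam S.gam (S.incrementGen u v Y Z) y z n with hΓ
  have hcost : ∀ ω, S.costDual u v Y Z y z (n + 1) ω = S.adjK u Y Z (n + 1) ω * Γ ω := fun ω => by
    rw [costDual, hΓ, backwardTerm]
    ring
  rcases Nat.eq_zero_or_pos n with rfl | hn
  · have hY0 : ∫ ω, y 0 ω ∂μ = ∫ ω, Γ ω ∂μ := by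
      rw [← integral_condExp (hV.le 0) (f := Γ), ← integral_congr_ae (h.increment.eqY 0)]
      simp [discount, Real.zero_rpow (by have := hV.one_lt_gam; positivity : S.gam ≠ 0)]
    have k1 : ∀ ω, S.adjK u Y Z (0 + 1) ω = -1 := fun ω => rfl
    have k0 : ∀ ω, S.adjK u Y Z 0 ω = 0 := fun ω => rfl
    have c0 : ∀ ω, S.costDual u v Y Z y z 0 ω = 0 := fun ω => by rw [costDual, k0]; ring
    simp only [hcost, c0, k1, k0, zero_mul, mul_zero, integral_zero, neg_one_mul,
      integral_neg, if_true, hY0]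
    exact ⟨integrable_zero _ _ _, by ring⟩
  have hΓm : Measurable Γ := (measurable_backwardTerm h.dominated_increment
    h.increment.memY.adapted h.increment.memZ.adapted n).mono (hV.le _) le_rfl
  have hp1 := fun k ω => hV.one_le_cum k ω
  have hΓle : ∀ ω, |Γ ω| ≤ (1 + L + L * c) * (cumWeight (S.weight L) (n + 1) ω
      * (|y (n + 1) ω| + |z (n + 1) ω| + 1)) := fun ω => by
    rw [hΓ, backwardTerm, abs_mul, abs_of_pos (discount_pos _ _ _)]
    refine le_trans (mul_le_of_le_one_left (abs_nonneg _)
      (discount_le_one hV.lam_pos.le _ _)) ?_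
    refine (abs_add_le _ _).trans
      ((add_le_add_right (h.incrementGen_le (n + 1) ω (y (n + 1) ω) (z (n + 1) ω)) _).trans ?_)
    set P := cumWeight (S.weight L) (n + 1) ω
    set A := |y (n + 1) ω|
    set B := |z (n + 1) ω|
    have hA : 0 ≤ A := abs_nonneg _
    have hB : 0 ≤ B := abs_nonneg _
    have hP : 1 ≤ P := hp1 _ _
    have hLc : 0 ≤ L * c := by positivity
    calc A + L * (c * P + A + B) ≤ (1 + L) * (A + B) + L * c * P := by nlinarith
      _ ≤ (1 + L) * (P * (A + B + 1)) + L * c * (P * (A + B + 1)) := by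
          gcongr
          · nlinarith
          · exact le_mul_of_one_le_right (by linarith) (by linarith)
      _ = _ := by ring
  have hk := measurable_adjK h.standing h.integrability h.adapted_u h.adapted_Y h.adapted_Z n
  let α : Ω → ℝ := fun ω => S.adjK u Y Z n ω + S.genY u Y Z n ω * S.adjK u Y Z n ω
  let κ : Ω → ℝ := fun ω => S.genZ u Y Z n ω * S.adjK u Y Z n ω
  have hα : Measurable[S.filt n] α := hk.add ((measurable_genY h.standing h.integrability
    h.adapted_u h.adapted_Y h.adapted_Z n).mul hk)
  have hκ : Measurable[S.filt n] κ := (measurable_genZ h.standing h.integrability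
    h.adapted_u h.adapted_Y h.adapted_Z n).mul hk
  have iα : Integrable (fun ω => α ω * Γ ω) μ := by
    refine hV.integrable_of_le_cum_pow (C := (1 + L) * (1 + L + L * c)) (k := 2) h.theta_pos
      h.two_le h.increment.memY h.increment.memZ (by norm_num) (n + 1)
      ((hα.mono (hV.le _) le_rfl).mul hΓm) fun ω => ?_
    have hP := hV.cum_pos (n + 1) ω
    have hα' : |α ω| ≤ (1 + L) * cumWeight (S.weight L) (n + 1) ω := by
      have h1 := h.lipschitz.adjK_le u Y Z n ω
      have h2 := h.lipschitz.genY_le u Y Z n ω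
      have h3 : cumWeight (S.weight L) n ω ≤ cumWeight (S.weight L) (n + 1) ω := by
        rw [cumWeight_succ]
        exact le_mul_of_one_le_right (hV.cum_pos n ω).le (hV.one_le n ω)
      refine (abs_add_le _ _).trans ?_
      rw [abs_mul, ← one_add_mul]
      have := h1.trans h3
      gcongr
    rw [abs_mul]
    refine (mul_le_mul hα' (hΓle ω) (abs_nonneg _) (by positivity)).trans_eq ?_
    ring
  have iκ : Integrable (fun ω => κ ω * (S.eta n ω * Γ ω)) μ := by
    refine hV.integrable_of_le_cum_pow (C := L * (1 + L + L * c)) (k := 2) h.theta_pos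
      h.two_le h.increment.memY h.increment.memZ (by norm_num) (n + 1)
      ((hκ.mono (hV.le _) le_rfl).mul ((hV.measurable_eta n).mul hΓm)) fun ω => ?_
    have hp0 := hV.cum_pos n ω
    have hP := hV.cum_pos (n + 1) ω
    rw [abs_mul, abs_mul, abs_mul]
    calc _ ≤ (L * cumWeight (S.weight L) n ω) * (S.weight L n ω *
          ((1 + L + L * c) * (cumWeight (S.weight L) (n + 1) ω
            * (|y (n + 1) ω| + |z (n + 1) ω| + 1)))) := by
          have := h.lipschitz.adjK_le u Y Z n ω
          have := h.lipschitz.genZ_le u Y Z n ω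
          have := h.abs_eta_le n ω
          have := zero_le_one.trans (hV.one_le n ω)
          have := hΓle ω
          gcongr
      _ = _ := by
          simp only [cumWeight_succ]
          ring
  obtain ⟨i, e⟩ := integral_affine_mul_of_condExp (hV.le n) hα hκ iΓ iηΓ iα iκ
    (h.increment.eqY n) (h.increment.eqZ n)
  have e1 : ∀ ω, α ω * (discount S.lam S.gam n * y n ω) + κ ω * (discount S.lam S.gam n * z n ω)
      - S.costDual u v Y Z y z n ω = discount S.lam S.gam n * (S.adjK u Y Z n ω *
      (S.genY u Y Z n ω * y n ω + S.genZ u Y Z n ω * z n ω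
        - S.incrementGen u v Y Z n ω (y n ω) (z n ω))) := fun ω => by
    simp only [α, κ, costDual]
    ring
  refine ⟨(i.sub (h.integrable_costDual n)).congr (ae_of_all _ e1), ?_⟩
  have e2 : ∫ ω, S.costDual u v Y Z y z (n + 1) ω ∂μ
      = ∫ ω, (α ω + κ ω * S.eta n ω) * Γ ω ∂μ := by
    refine integral_congr_ae (ae_of_all _ fun ω => ?_)
    simp only [hcost]
    congr 1
    obtain ⟨k, rfl⟩ := Nat.exists_eq_add_of_le' hn
    rfl
  rw [e2, e, ← integral_congr_ae (ae_of_all μ e1), integral_sub i (h.integrable_costDual n),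
    if_neg hn.ne']
  ring

lemma dualDefect_eq (n : ℕ) : S.dualDefect u v Y Z y z p q n = fun ω => discount S.lam S.gam n *
      ((S.driftInc u v n ω - S.driftX u n ω * (S.state v n ω - S.state u n ω)) * p n ω
      + (S.diffInc u v n ω - S.diffX u n ω * (S.state v n ω - S.state u n ω))
        * (noisePred S.H S.xi n ω * p n ω + noiseBeta S.H n n * q n ω)
      + S.adjK u Y Z n ω * S.genX u Y Z n ω * (S.state v n ω - S.state u n ω))
      + discount S.lam S.gam n * (S.adjK u Y Z n ω *
      (S.genY u Y Z n ω * y n ω + S.genZ u Y Z n ω * z n ω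
        - S.incrementGen u v Y Z n ω (y n ω) (z n ω))) := by
  ext ω
  rw [dualDefect]
  ring

lemma integrable_dualDefect (n : ℕ) : Integrable (S.dualDefect u v Y Z y z p q n) μ := by
  rw [h.dualDefect_eq]
  exact (h.integral_stateDual_succ n).1.add (h.integral_costDual_succ n).1

lemma integral_dual_eq (N : ℕ) : ∫ ω, S.stateDual u v Y Z p q (N + 1) ω ∂μ
    + ∫ ω, S.costDual u v Y Z y z (N + 1) ω ∂μ
    = ∑ n ∈ Finset.range (N + 1), ∫ ω, S.dualDefect u v Y Z y z p q n ω ∂μ - ∫ ω, y 0 ω ∂μ := by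
  have hd : ∀ n, ∫ ω, S.dualDefect u v Y Z y z p q n ω ∂μ = _ := fun n => by
    rw [h.dualDefect_eq, integral_add (h.integral_stateDual_succ n).1
      (h.integral_costDual_succ n).1]
  induction N with
  | zero =>
    rw [(h.integral_stateDual_succ 0).2, (h.integral_costDual_succ 0).2, Finset.sum_range_one, hd 0]
    have h1 : ∀ ω, S.stateDual u v Y Z p q 0 ω = 0 := fun ω => by simp [stateDual, state]
    have h2 : ∀ ω, S.costDual u v Y Z y z 0 ω = 0 := fun ω => by simp [costDual, adjK]
    simp only [h1, h2, integral_zero, if_true]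
    ring
  | succ N ih =>
    rw [(h.integral_stateDual_succ (N + 1)).2, (h.integral_costDual_succ (N + 1)).2,
      Finset.sum_range_succ, hd (N + 1), if_neg (by omega)]
    linarith

/-- The variation of the cost is the sum of the defects. -/
theorem hasSum_integral_dualDefect :
    HasSum (fun n => ∫ ω, S.dualDefect u v Y Z y z p q n ω ∂μ) (∫ ω, y 0 ω ∂μ) := by
  have hB := h.summable_integral_dualBound
  have hle : ∀ (f : ℕ → Ω → ℝ) (C : ℝ),
      (∀ n, ∀ᵐ ω ∂μ, |f n ω| ≤ c * (C * dualBound μ S.filt (S.weight L) S.lam S.gam p q n ω)) →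
      ∀ n, ‖∫ ω, f n ω ∂μ‖
        ≤ c * (C * ∫ ω, dualBound μ S.filt (S.weight L) S.lam S.gam p q n ω ∂μ) := by
    intro f C hf n
    rw [← integral_const_mul, ← integral_const_mul]
    exact norm_integral_le_of_norm_le (((h.integrable_dualBound n).const_mul _).const_mul _) (hf n)
  have hlim : ∀ (f : ℕ → Ω → ℝ) (C : ℝ),
      (∀ n, ∀ᵐ ω ∂μ, |f n ω| ≤ c * (C * dualBound μ S.filt (S.weight L) S.lam S.gam p q n ω)) →
      Tendsto (fun n => ∫ ω, f n ω ∂μ) atTop (𝓝 0) := fun f C hf =>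
    squeeze_zero_norm (hle f C hf)
      (by simpa using (hB.tendsto_atTop_zero.const_mul C).const_mul c)
  have hsum : Summable fun n => ∫ ω, S.dualDefect u v Y Z y z p q n ω ∂μ :=
    Summable.of_norm_bounded ((hB.mul_left _).mul_left c) (hle _ _ h.dualDefect_le)
  have h1 := (tendsto_add_atTop_iff_nat 1).2 ((hlim _ _ h.stateDual_le).add
    (hlim _ _ h.costDual_le))
  simp only [h.integral_dual_eq] at h1
  have h2 := ((tendsto_add_atTop_iff_nat 1).2 hsum.hasSum.tendsto_sum_nat).sub_const
    (∫ ω, y 0 ω ∂μ)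
  have h3 := tendsto_nhds_unique h1 h2
  have h4 : ∑' n, ∫ ω, S.dualDefect u v Y Z y z p q n ω ∂μ = ∫ ω, y 0 ω ∂μ := by linarith
  rw [← h4]
  exact hsum.hasSum

end IsVariation

end Variation

end ControlSystem

namespace ControlSystem

/-! ### The maximum principle -/

/-- The derivative of the Hamiltonian in the control along a trajectory. -/
def hamiltonianU {Ω : Type*} (S : ControlSystem Ω) (u Y Z p q : ℕ → Ω → ℝ) (n : ℕ) (ω : Ω) : ℝ :=
  S.driftU u n ω * p n ω + S.diffU u n ω * (noisePred S.H S.xi n ω * p n ω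
    + noiseBeta S.H n n * q n ω) - S.genU u Y Z n ω * S.adjK u Y Z n ω

section Maximum

variable {Ω : Type*} [mΩ : MeasurableSpace Ω] {μ : Measure Ω} [IsProbabilityMeasure μ]
  {S : ControlSystem Ω} {L : ℝ} {u v Y Z p q : ℕ → Ω → ℝ}

lemma measurable_hamiltonianU (hS : S.Standing μ) (h₁ : S.IntegrabilityCondition μ)
    (hu : ∀ n, Measurable[S.filt n] (u n)) (hY : ∀ n, Measurable[S.filt n] (Y n))
    (hZ : ∀ n, Measurable[S.filt n] (Z n)) (hp : ∀ n, Measurable[S.filt n] (p n))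
    (hq : ∀ n, Measurable[S.filt n] (q n)) (n : ℕ) :
    Measurable[S.filt n] (S.hamiltonianU u Y Z p q n) :=
  (((measurable_driftU hS h₁ hu n).mul (hp n)).add ((measurable_diffU hS h₁ hu n).mul
    (((S.measurable_noisePred n).mul (hp n)).add ((hq n).const_mul _)))).sub
    ((measurable_genU hS h₁ hu hY hZ n).mul (measurable_adjK hS h₁ hu hY hZ n))

lemma hamiltonianU_le (hS : S.Standing μ) (hL : S.IsLipschitz L) (n : ℕ) (ω : Ω) :
    |S.hamiltonianU u Y Z p q n ω|
      ≤ 3 * L * (cumWeight (S.weight L) n ω * (|p n ω| + |q n ω| + 1)) := by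
  have b1 := hL.driftU_le u n ω
  have b2 := hL.diffU_le u n ω
  have b3 := hL.genU_le u Y Z n ω
  have b4 := hL.adjK_le u Y Z n ω
  have h5 := abs_noisePred_le_cumWeight (S := S) hL.pos n ω
  have hP := one_le_cumWeight (one_le_weight (S := S) hL.pos) n ω
  have hβ0 := noiseBeta_self_nonneg (H := S.H) n
  have hβ1 := noiseBeta_self_le_one hS.hurst_pos n
  have hL0 := hL.pos
  rw [hamiltonianU]
  set P := cumWeight (S.weight L) n ω
  have hp := abs_nonneg (p n ω)
  have hq := abs_nonneg (q n ω)
  have h5' : |noisePred S.H S.xi n ω| ≤ P := by linarith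
  calc _ ≤ |S.driftU u n ω * p n ω| + |S.diffU u n ω * (noisePred S.H S.xi n ω * p n ω
        + noiseBeta S.H n n * q n ω)| + |S.genU u Y Z n ω * S.adjK u Y Z n ω| :=
        (abs_sub _ _).trans (add_le_add_left (abs_add_le _ _) _)
    _ ≤ L * |p n ω| + L * (P * |p n ω| + 1 * |q n ω|) + L * P := by
        rw [abs_mul, abs_mul, abs_mul]
        gcongr
        refine (abs_add_le _ _).trans ?_
        rw [abs_mul, abs_mul, abs_of_nonneg hβ0]
        gcongr
    _ ≤ _ := by
        have hP1 : 0 ≤ P - 1 := by linarith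
        nlinarith [mul_nonneg hL0.le hp, mul_nonneg hL0.le hq, mul_nonneg hP1
          (mul_nonneg hL0.le hp), mul_nonneg hP1 (mul_nonneg hL0.le hq), mul_nonneg hP1 hL0.le]

/-- Limit of the difference quotients of the defects. -/
lemma tendsto_dualDefect_div (hS : S.Standing μ) {m n : ℕ} {ω : Ω} {d : Ω → ℝ} {ε : ℕ → ℝ}
    (hε : ∀ j, 0 < ε j) (hε0 : Tendsto ε atTop (𝓝 0)) {y z : ℕ → ℕ → Ω → ℝ} {C : ℝ}
    (hx : ∀ j, |S.state (perturb u m fun ω => ε j * d ω) n ω - S.state u n ω| ≤ C * ε j)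
    (hy : ∀ j, |y j n ω| ≤ C * ε j) (hz : ∀ j, |z j n ω| ≤ C * ε j) :
    Tendsto (fun j => S.dualDefect u (perturb u m fun ω => ε j * d ω) Y Z (y j) (z j) p q n ω / ε j)
      atTop (𝓝 (discount S.lam S.gam n *
        (S.hamiltonianU u Y Z p q n ω * if n = m then d ω else 0))) := by
  set v : ℕ → ℕ → Ω → ℝ := fun j => perturb u m fun ω => ε j * d ω with hv
  set h := if n = m then d ω else 0 with hh
  have hdu : ∀ j, v j n ω - u n ω = ε j * h := fun j => by
    simp only [hv, perturb, hh, add_sub_cancel_left, mul_ite, mul_zero]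
  have t1 := tendsto_expansion_two (hS.drift_differentiable n ω) (x := S.state u n ω)
    (u := u n ω) hε hε0 hx hdu
  have t2 := tendsto_expansion_two (hS.diff_differentiable n ω) (x := S.state u n ω)
    (u := u n ω) hε hε0 hx hdu
  have t3 := tendsto_expansion_four (hS.gen_differentiable n ω) (x := S.state u n ω)
    (y := Y n ω) (z := Z n ω) (u := u n ω) hε hε0 hx hy hz hdu
  simp only [add_sub_cancel] at t1 t2 t3
  have t := (((t1.mul_const (p n ω)).add (t2.mul_const (noisePred S.H S.xi n ω * p n ω
    + noiseBeta S.H n n * q n ω))).sub (t3.const_mul (S.adjK u Y Z n ω))).const_mul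
    (discount S.lam S.gam n)
  refine (t.congr fun j => ?_).trans_eq ?_
  · have := (hε j).ne'
    simp only [hv, dualDefect, driftInc, diffInc, incrementGen, driftX, diffX, genX, genY, genZ]
    field_simp
  · congr 1
    simp only [hamiltonianU, driftU, diffU, genU]
    ring

/-- The variational inequality in integrated form. -/
lemma IsOptimal.integral_hamiltonianU_nonneg (hS : S.Standing μ)
    (h₁ : S.IntegrabilityCondition μ) (hL : S.IsLipschitz L) (hu : S.IsOptimal μ u)
    (hYZ : S.IsCostSolution μ u Y Z)
    (hpq : IsBackwardSolution μ S.filt S.eta S.b S.theta S.lam S.gam (S.adjointGen u Y Z) p q)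
    {m : ℕ} {d : Ω → ℝ} {K : ℝ} (hdm : Measurable[S.filt m] d) (hd : ∀ ω, |d ω| ≤ K)
    (hU : ∀ ω, u m ω + d ω ∈ S.U) :
    0 ≤ ∫ ω, S.hamiltonianU u Y Z p q m ω * d ω ∂μ := by
  obtain ⟨ω₀⟩ : Nonempty Ω := μ.nonempty_of_neZero
  have hK : 0 ≤ K := (abs_nonneg _).trans (hd ω₀)
  let ε : ℕ → ℝ := fun j => 1 / ((j : ℝ) + 1)
  have hε : ∀ j, 0 < ε j := fun j => by positivity
  have hε1 : ∀ j, ε j ≤ 1 := fun j => by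
    rw [div_le_one (by positivity)]
    linarith [j.cast_nonneg (α := ℝ)]
  have hε0 : Tendsto ε atTop (𝓝 0) := tendsto_one_div_add_atTop_nhds_zero_nat
  let v : ℕ → ℕ → Ω → ℝ := fun j => perturb u m fun ω => ε j * d ω
  have hdj : ∀ j ω, |ε j * d ω| ≤ ε j * K := fun j ω => by
    rw [abs_mul, abs_of_pos (hε j)]
    exact mul_le_mul_of_nonneg_left (hd ω) (hε j).le
  have hc : ∀ j, 0 ≤ ε j * K := fun j => mul_nonneg (hε j).le hK
  have hv : ∀ j, S.Admissible μ (v j) := fun j =>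
    hu.1.perturbed h₁ (hdm.const_mul _) (hdj j) fun ω => by
      have := hS.U_convex (hu.1.values m ω) (hU ω) (sub_nonneg.2 (hε1 j)) (hε j).le (by ring)
      simp only [smul_eq_mul] at this
      convert this using 1
      ring
  have hclose := fun j => hL.perturb_le (u := u) (m := m) (hc j) (hdj j)
  choose y z hyz hle hopt using fun j => hu.exists_increment hS h₁ hL hYZ (hv j) (hc j) (hclose j)
  have hvar : ∀ j, S.IsVariation μ L (ε j * K) u (v j) Y Z (y j) (z j) p q := fun j =>
    ⟨hS, h₁, hL, hu.1.mem.adapted, (hv j).mem.adapted, hYZ.memY.adapted, hYZ.memZ.adapted, hc j,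
      hclose j, hyz j, hle j, hpq⟩
  set B := dualBound μ S.filt (S.weight L) S.lam S.gam p q with hB
  have hBi : ∀ n, Integrable (B n) μ := (hvar 0).integrable_dualBound
  have hBs : Summable fun n => ∫ ω, B n ω ∂μ := (hvar 0).summable_integral_dualBound
  set C := 6 * L + 2 * L ^ 2
  let f : ℕ → ℕ → Ω → ℝ := fun j n ω => S.dualDefect u (v j) Y Z (y j) (z j) p q n ω / ε j
  let f' : ℕ → Ω → ℝ := fun n ω => discount S.lam S.gam n *
    (S.hamiltonianU u Y Z p q n ω * if n = m then d ω else 0)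
  have hfle : ∀ j n, ∀ᵐ ω ∂μ, ‖f j n ω‖ ≤ K * (C * B n ω) := fun j n => by
    filter_upwards [(hvar j).dualDefect_le n] with ω hω
    rw [Real.norm_eq_abs, abs_div, abs_of_pos (hε j), div_le_iff₀ (hε j)]
    refine hω.trans_eq ?_
    ring
  have hVw := hS.backwardWeights h₁ hL.pos
  have hlim : ∀ n, ∀ᵐ ω ∂μ, Tendsto (fun j => f j n ω) atTop (𝓝 (f' n ω)) := fun n => by
    filter_upwards [ae_all_iff.2 fun j => hle j n] with ω hω
    have hP := hVw.cum_pos n ω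
    have hD := discount_pos S.lam S.gam n
    set T := (μ[tailWeight S.lam S.gam (S.weight L) n | S.filt n]) ω
    set A := L * K * T / (discount S.lam S.gam n * cumWeight (S.weight L) n ω) with hA
    have hyz' : ∀ j, |y j n ω| + |z j n ω| ≤ A * ε j := fun j => by
      rw [hA, div_mul_eq_mul_div, le_div_iff₀ (by positivity)]
      refine le_trans (le_of_eq ?_) ((hω j).trans_eq ?_) <;> ring
    refine tendsto_dualDefect_div hS hε hε0 (C := max A (K * cumWeight (S.weight L) n ω))
      (fun j => ?_) (fun j => ?_) fun j => ?_
    · have h1 : |S.state (v j) n ω - S.state u n ω|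
          ≤ K * cumWeight (S.weight L) n ω * ε j := by
        have := hclose j n ω
        have h2 := abs_nonneg (v j n ω - u n ω)
        linarith
      exact h1.trans (mul_le_mul_of_nonneg_right (le_max_right _ _) (hε j).le)
    · refine le_trans ?_ (mul_le_mul_of_nonneg_right (le_max_left _ _) (hε j).le)
      linarith [hyz' j, abs_nonneg (z j n ω)]
    · refine le_trans ?_ (mul_le_mul_of_nonneg_right (le_max_left _ _) (hε j).le)
      linarith [hyz' j, abs_nonneg (y j n ω)]
  have hint : ∀ n, Tendsto (fun j => ∫ ω, f j n ω ∂μ) atTop (𝓝 (∫ ω, f' n ω ∂μ)) := fun n =>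
    tendsto_integral_of_dominated_convergence (fun ω => K * (C * B n ω))
      (fun j => (((hvar j).integrable_dualDefect n).div_const _).1)
      (((hBi n).const_mul _).const_mul _) (fun j => hfle j n) (hlim n)
  have hsum := tendsto_tsum_of_dominated_convergence (f := fun j n => ∫ ω, f j n ω ∂μ)
    (g := fun n => ∫ ω, f' n ω ∂μ) (bound := fun n => K * (C * ∫ ω, B n ω ∂μ))
    ((hBs.mul_left _).mul_left _) hint (Eventually.of_forall fun j n => by
      rw [← integral_const_mul, ← integral_const_mul]
      exact norm_integral_le_of_norm_le (((hBi n).const_mul _).const_mul _) (hfle j n))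
  have hpos : ∀ j, 0 ≤ ∑' n, ∫ ω, f j n ω ∂μ := fun j => by
    have h1 := (hvar j).hasSum_integral_dualDefect.div_const (ε j)
    simp only [f, integral_div]
    rw [h1.tsum_eq]
    exact div_nonneg (hopt j) (hε j).le
  have hres := ge_of_tendsto' hsum hpos
  rw [tsum_eq_single m fun n hn => by simp [f', hn]] at hres
  simp only [f', if_true, integral_const_mul] at hres
  exact nonneg_of_mul_nonneg_right hres (discount_pos _ _ _)

/-- The variational inequality along an optimal trajectory. -/
theorem IsOptimal.hamiltonianU_mul_nonneg (hS : S.Standing μ)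
    (h₁ : S.IntegrabilityCondition μ) (hL : S.IsLipschitz L) (hu : S.IsOptimal μ u)
    (hYZ : S.IsCostSolution μ u Y Z)
    (hpq : IsBackwardSolution μ S.filt S.eta S.b S.theta S.lam S.gam (S.adjointGen u Y Z) p q)
    (hv : S.Admissible μ v) (n : ℕ) :
    ∀ᵐ ω ∂μ, 0 ≤ S.hamiltonianU u Y Z p q n ω * (v n ω - u n ω) := by
  have hVw := hS.backwardWeights h₁ hL.pos
  have hH := measurable_hamiltonianU hS h₁ hu.1.mem.adapted hYZ.memY.adapted hYZ.memZ.adapted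
    hpq.memY.adapted hpq.memZ.adapted n
  have hD : Measurable[S.filt n] fun ω => v n ω - u n ω :=
    (hv.mem.adapted n).sub (hu.1.mem.adapted n)
  let A : ℕ → Set Ω := fun K =>
    {ω | S.hamiltonianU u Y Z p q n ω * (v n ω - u n ω) < 0 ∧ |v n ω - u n ω| ≤ K}
  let d : ℕ → Ω → ℝ := fun K => (A K).indicator fun ω => v n ω - u n ω
  have hdm : ∀ K, Measurable[S.filt n] (d K) := fun K => by
    let _ : MeasurableSpace Ω := S.filt n
    have hH' : Measurable (S.hamiltonianU u Y Z p q n) := hH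
    have hD' : Measurable fun ω => v n ω - u n ω := hD
    exact hD'.indicator ((measurableSet_lt (hH'.mul hD') measurable_const).inter
      (measurableSet_le hD'.norm measurable_const))
  have hdK : ∀ K ω, |d K ω| ≤ K := fun K ω => by
    by_cases h : ω ∈ A K
    · simpa [d, h] using h.2
    · simp [d, h]
  have hU : ∀ K ω, u n ω + d K ω ∈ S.U := fun K ω => by
    by_cases h : ω ∈ A K
    · simpa [d, h] using hv.values n ω
    · simpa [d, h] using hu.1.values n ω
  have hle : ∀ K ω, S.hamiltonianU u Y Z p q n ω * d K ω ≤ 0 := fun K ω => by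
    by_cases h : ω ∈ A K
    · simpa [d, h] using h.1.le
    · simp [d, h]
  have hint : ∀ K, Integrable (fun ω => S.hamiltonianU u Y Z p q n ω * d K ω) μ := fun K => by
    refine hVw.integrable_of_le_cum_pow (C := 3 * L * K) (k := 1) h₁.theta_pos
      (by linarith [h₁.one_le_b]) hpq.memY hpq.memZ (by norm_num) n
      ((hH.mono (hVw.le n) le_rfl).mul ((hdm K).mono (hVw.le n) le_rfl)) fun ω => ?_
    have h1 := hVw.cum_pos n ω
    have h2 := hL.pos
    rw [abs_mul, pow_one]
    refine (mul_le_mul (hamiltonianU_le hS hL n ω) (hdK K ω) (abs_nonneg _)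
      (by positivity)).trans_eq ?_
    ring
  have hzero : ∀ K, ∀ᵐ ω ∂μ, S.hamiltonianU u Y Z p q n ω * d K ω = 0 := fun K => by
    have h0 := hu.integral_hamiltonianU_nonneg hS h₁ hL hYZ hpq (hdm K) (hdK K) (hU K)
    have h1 := (integral_eq_zero_iff_of_nonneg_ae (ae_of_all μ fun ω => neg_nonneg.2 (hle K ω))
      (hint K).neg).1 (by
        rw [integral_neg]
        have := integral_nonpos (μ := μ) (hle K)
        linarith)
    filter_upwards [h1] with ω hω
    simpa using hω
  filter_upwards [ae_all_iff.2 hzero] with ω hω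
  by_contra hneg
  rw [not_le] at hneg
  obtain ⟨K, hK⟩ := exists_nat_ge |v n ω - u n ω|
  have h1 := hω K
  have h2 : ω ∈ A K := ⟨hneg, hK⟩
  simp only [d, Set.indicator_of_mem h2] at h1
  exact hneg.ne h1

lemma deriv_hamiltonian (hS : S.Standing μ) (n : ℕ) (ω : Ω) :
    deriv (fun r => S.hamiltonian μ n ω (S.state u n ω) (Y n ω) (Z n ω) r
      (p n ω) (q n ω) (S.adjK u Y Z n ω)) (u n ω)
    = S.driftU u n ω * p n ω + S.diffU u n ω * p n ω * (μ[S.xi n | S.filt n]) ω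
      + noiseBeta S.H n n * S.diffU u n ω * q n ω - S.genU u Y Z n ω * S.adjK u Y Z n ω := by
  have h1 : HasDerivAt (fun r => S.drift n ω (S.state u n ω) r) (S.driftU u n ω) (u n ω) :=
    ((hS.drift_differentiable n ω).comp ((differentiable_const (S.state u n ω)).prodMk
      differentiable_id)).differentiableAt.hasDerivAt
  have h2 : HasDerivAt (fun r => S.diff n ω (S.state u n ω) r) (S.diffU u n ω) (u n ω) :=
    ((hS.diff_differentiable n ω).comp ((differentiable_const (S.state u n ω)).prodMk
      differentiable_id)).differentiableAt.hasDerivAt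
  have h3 : HasDerivAt (fun r => S.gen n ω (S.state u n ω) (Y n ω) (Z n ω) r)
      (S.genU u Y Z n ω) (u n ω) :=
    ((hS.gen_differentiable n ω).comp ((differentiable_const (S.state u n ω)).prodMk
      ((differentiable_const (Y n ω)).prodMk ((differentiable_const (Z n ω)).prodMk
        differentiable_id)))).differentiableAt.hasDerivAt
  exact ((((h1.mul_const _).add ((h2.mul_const _).mul_const _)).add
    ((h2.const_mul _).mul_const _)).sub (h3.mul_const _)).deriv

end Maximum

end ControlSystem

end FracControl

end

theorem mainTheorem3 {Ω : Type*} [MeasurableSpace Ω] (μ : Measure Ω) [IsProbabilityMeasure μ]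
    (S : FracControl.ControlSystem Ω) (hS : S.Standing μ)
    (h₁ : S.IntegrabilityCondition μ) (h₂ : S.LipschitzCondition) (h₃ : S.AsymptoticCondition μ)
    (u Y Z : ℕ → Ω → ℝ) (hu : S.IsOptimal μ u) (hYZ : S.IsCostSolution μ u Y Z) :
    ∃ p q : ℕ → Ω → ℝ, S.IsAdjointSolution μ u Y Z p q ∧
      (∀ r s : ℕ → Ω → ℝ, S.IsAdjointSolution μ u Y Z r s →
        ∀ n, r n =ᵐ[μ] p n ∧ s n =ᵐ[μ] q n) ∧
      ∀ v : ℕ → Ω → ℝ, S.Admissible μ v → ∀ᵐ ω ∂μ, ∀ n : ℕ,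
        0 ≤ (S.driftU u n ω * p n ω
            + S.diffU u n ω * p n ω *
              (∑ k ∈ Finset.range n, FracControl.noiseGamma S.H n k * S.xi k ω)
            + FracControl.noiseBeta S.H n n * S.diffU u n ω * q n ω
            - S.genU u Y Z n ω * S.adjK u Y Z n ω) * (v n ω - u n ω) ∧
        0 ≤ deriv (fun r => S.hamiltonian μ n ω (S.state u n ω) (Y n ω) (Z n ω) r
            (p n ω) (q n ω) (S.adjK u Y Z n ω)) (u n ω) * (v n ω - u n ω) := by
  obtain ⟨L, hL0, hL1, hL2⟩ := h₂
  have hL : S.IsLipschitz L := ⟨hL0, hL1, hL2⟩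
  have hV := hS.backwardWeights h₁ hL0
  have hg := FracControl.ControlSystem.dominatedGenerator_adjoint hS h₁ hL hu.1.mem.adapted
    hYZ.memY.adapted hYZ.memZ.adapted
  obtain ⟨p, q, hpq, -⟩ := FracControl.exists_isBackwardSolution hV hg h₁.theta_pos
    h₁.deltaLim_pos (by linarith [h₁.one_le_b] : 0 ≤ S.b)
  refine ⟨p, q, (FracControl.ControlSystem.isAdjointSolution_iff hS).2 hpq, fun r s hrs n => ?_,
    fun v hv => ?_⟩
  · exact FracControl.IsBackwardSolution.ae_eq hV hg h₁.theta_pos h₁.one_le_b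
      ((FracControl.ControlSystem.isAdjointSolution_iff hS).1 hrs) hpq n
  · rw [ae_all_iff]
    intro n
    filter_upwards [hu.hamiltonianU_mul_nonneg hS h₁ hL hYZ hpq hv n,
      hS.isNoise.condExp_noise hS.F₀_le hS.indep n] with ω h1 h2
    rw [FracControl.ControlSystem.deriv_hamiltonian hS, h2]
    have e : S.hamiltonianU u Y Z p q n ω = S.driftU u n ω * p n ω
        + S.diffU u n ω * p n ω * FracControl.noisePred S.H S.xi n ω
        + FracControl.noiseBeta S.H n n * S.diffU u n ω * q n ω
        - S.genU u Y Z n ω * S.adjK u Y Z n ω := by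
      rw [FracControl.ControlSystem.hamiltonianU]
      ring
    rw [e] at h1
    exact ⟨h1, h1⟩
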